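/- **Setting (latent Dirichlet allocation).** Let $1\le k\le d$, let $\alpha\in\mathbb R^k$ have strictly positive entries, $\alpha_0=\sum_i\alpha_i$, and let $O\in\mathbb R^{d\times k}$ be a matrix of rank $k$ whose columns $O_1,\dots,O_k$ are probability vectors on $d$ words. A sample (document) is a triple of words $x_1,x_2,x_3$, encoded as standard basis vectors of $\mathbb R^d$: draw $h$ from the Dirichlet distribution with parameter $\alpha$, and then, for each $v\in\{1,2,3\}$ independently given $h$, draw a topic $i$ with probability $h_i$ and a word $x_v$ from the distribution $O_i$. Let $p_{\min}=\min_i\alpha_i/\alpha_0$ and let $\sigma_k(O)$ be the smallest singular value of $O$. **Algorithm (empirical ECA).** From $N$ samples form the empirical averages $\hat\mu=\hat{\mathbb E}[x_1]$, $\hat C=\hat{\mathbb E}[x_1x_2^\top]$, $\hat{\mathbb E}[x_1x_2^\top\langle\eta,x_3\rangle]$, and $$\hat P=\hat C-\tfrac{\alpha_0}{\alpha_0+1}\hat\mu\hat\mu^\top,$$ $$\hat T(\eta)=\hat{\mathbb E}[x_1x_2^\top\langle\eta,x_3\rangle]-\tfrac{\alpha_0}{\alpha_0+2}\bigl(\hat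 C\eta\hat\mu^\top+\hat\mu\eta^\top\hat C+\langle\eta,\hat\mu\rangle\hat C\bigr)+\tfrac{2\alpha_0^2}{(\alpha_0+2)(\alpha_0+1)}\langle\eta,\hat\mu\rangle\hat\mu\hat\mu^\top .$$ Let $\hat W=A\Sigma^{-1/2}\in\mathbb R^{d\times k}$, where the columns of $A$ are orthonormal left singular vectors of $\hat P$ for its $k$ largest singular values and $\Sigma$ is the diagonal matrix of these values. Given $\theta\in\mathbb R^k$, let $\hat v_1,\dots,\hat v_k$ be an orthonormal basis of left singular vectors of $\hat W^\top\hat T(\hat W\theta)\hat W$. Return $$\hat O_i=\frac1{\hat Z_i}(\hat W^+)^\top\hat v_i,\qquad \hat Z_i=\frac{2}{(\alpha_0+2)\,(\hat W\hat v_i)^\top\hat T(\hat W\hat v_i)\hat W\hat v_i},\qquad \hat W^+=(\hat W^\top\hat W)^{-1}\hat W^\top$$ (so $1/\hat Z_i$ means $\frac{\alpha_0+2}{2}(\hat W\hat v_i)^\top\hat T(\hat W\hat v_i)\hat W\hat v_i$). **Theorem (Sample complexity for LDA).** There is a universal constant $c>0$ such that the following holds in this setting. Let $\delta\in(0,1)$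 and suppose that we obtain $$N\ge\left(\frac{(\alpha_0+1)\bigl(6+6\sqrt{\ln(3/\delta)}\bigr)}{p_{\min}\,\sigma_k(O)^2}\right)^2$$ independent samples of $x_1,x_2,x_3$. With probability greater than $1-\delta$ over the samples, for every admissible choice of $\hat W$: $\hat W$ has rank $k$, and for $\theta$ drawn uniformly from the unit sphere of $\mathbb R^k$, with probability greater than $3/4$, for every admissible choice of $\hat v_1,\dots,\hat v_k$ there is a permutation $\tau$ of $\{1,\dots,k\}$ such that for all $i$ $$\|O_i-\hat O_{\tau(i)}\|_2\le c\,\frac{(\alpha_0+1)^2k^3}{p_{\min}^2\,\sigma_k(O)^3}\cdot\frac{1+\sqrt{\ln(1/\delta)}}{\sqrt N}.$$ -/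

import Mathlib

open MeasureTheory ProbabilityTheory
open scoped Matrix

noncomputable section

namespace LDA

/-! ### The Dirichlet distribution -/

/-- The point of the probability simplex in `ℝ^(m+1)` whose last `m` coordinates are `x`. -/
def simplexPoint {m : ℕ} (x : Fin m → ℝ) : Fin (m + 1) → ℝ :=
  Fin.cons (1 - ∑ i, x i) x

/-- The Dirichlet density
`Γ(α₀) / ∏ Γ(αᵢ) * ∏ hᵢ ^ (αᵢ - 1)` at a point `h` of the simplex. -/
def dirichletDensity {k : ℕ} (α : Fin k → ℝ) (h : Fin k → ℝ) : ℝ :=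
  Real.Gamma (∑ i, α i) / (∏ i, Real.Gamma (α i)) * ∏ i, h i ^ (α i - 1)

/-- The Dirichlet distribution with parameter `α`, as a measure on `ℝ^k`. The simplex is
parametrized by all coordinates but one, with Lebesgue measure on these, as usual; there is no
Dirichlet distribution for `k = 0`. -/
def dirichlet : {k : ℕ} → (Fin k → ℝ) → Measure (Fin k → ℝ)
  | 0, _ => 0
  | m + 1, α =>
    (((volume : Measure (Fin m → ℝ)).restrict {x | (∀ i, 0 < x i) ∧ ∑ i, x i < 1}).withDensity
      fun x => ENNReal.ofReal (dirichletDensity α (simplexPoint x))).map simplexPoint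

/-! ### Latent Dirichlet allocation -/

/-- `O` is a topic matrix: each column is a probability distribution over the `d` words. -/
structure IsTopicMatrix {d k : ℕ} (O : Matrix (Fin d) (Fin k) ℝ) : Prop where
  nonneg : ∀ j i, 0 ≤ O j i
  sum_col : ∀ i, ∑ j, O j i = 1

/-- The joint law of the three words `x₁, x₂, x₃` of a document. Draw `h` from the Dirichlet
distribution; given `h`, the words are independent, and each is `j` with probability
`∑ i, hᵢ * O j i` (draw a topic `i` from `h`, then a word from the `i`-th column of `O`). -/
def documentLaw {d k : ℕ} (α : Fin k → ℝ) (O : Matrix (Fin d) (Fin k) ℝ) :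
    Measure (Fin 3 → Fin d) :=
  ∑ w : Fin 3 → Fin d,
    (∫⁻ h, ∏ v, ENNReal.ofReal (∑ i, h i * O (w v) i) ∂(dirichlet α)) • Measure.dirac w

/-- `p_min = minᵢ αᵢ / α₀`. -/
def pMin {k : ℕ} (α : Fin k → ℝ) : ℝ :=
  ⨅ i, α i / ∑ j, α j

/-- `σ_k(O)`, the smallest (the `k`-th) singular value of a matrix with `k` columns.
Mathlib numbers singular values from `0`, in decreasing order. -/
def sigmaMin {d k : ℕ} (O : Matrix (Fin d) (Fin k) ℝ) : ℝ :=
  (Matrix.toEuclideanLin O).singularValues (k - 1)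

/-! ### Empirical moments

`w n v` is the `v`-th word of the `n`-th document. -/

/-- The encoding of the word `j` as a standard basis vector. -/
def hot {d : ℕ} (j : Fin d) : Fin d → ℝ := Pi.single j 1

/-- Empirical average of `x₁`. -/
def empMean {N d : ℕ} (w : Fin N → Fin 3 → Fin d) : Fin d → ℝ :=
  (N : ℝ)⁻¹ • ∑ n, hot (w n 0)

/-- Empirical average of `x₁ x₂ᵀ`. -/
def empSecond {N d : ℕ} (w : Fin N → Fin 3 → Fin d) : Matrix (Fin d) (Fin d) ℝ :=
  (N : ℝ)⁻¹ • ∑ n, Matrix.vecMulVec (hot (w n 0)) (hot (w n 1))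

/-- Empirical average of `x₁ x₂ᵀ ⟨η, x₃⟩`. -/
def empThird {N d : ℕ} (w : Fin N → Fin 3 → Fin d) (η : Fin d → ℝ) :
    Matrix (Fin d) (Fin d) ℝ :=
  (N : ℝ)⁻¹ • ∑ n, (η ⬝ᵥ hot (w n 2)) • Matrix.vecMulVec (hot (w n 0)) (hot (w n 1))

/-- The modified empirical second moment. -/
def empPairs {N d : ℕ} (α₀ : ℝ) (w : Fin N → Fin 3 → Fin d) : Matrix (Fin d) (Fin d) ℝ :=
  empSecond w - (α₀ / (α₀ + 1)) • Matrix.vecMulVec (empMean w) (empMean w)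

/-- The modified empirical third moment, contracted with `η`. -/
def empTriples {N d : ℕ} (α₀ : ℝ) (w : Fin N → Fin 3 → Fin d) (η : Fin d → ℝ) :
    Matrix (Fin d) (Fin d) ℝ :=
  empThird w η
    - (α₀ / (α₀ + 2)) •
      (Matrix.vecMulVec (empSecond w *ᵥ η) (empMean w)
        + Matrix.vecMulVec (empMean w) (η ᵥ* empSecond w)
        + (η ⬝ᵥ empMean w) • empSecond w)
    + (2 * α₀ ^ 2 / ((α₀ + 2) * (α₀ + 1))) •
      ((η ⬝ᵥ empMean w) • Matrix.vecMulVec (empMean w) (empMean w))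

/-! ### Empirical excess correlation analysis -/

/-- `M = U diag(s) Vᵀ` is a singular value decomposition of the square matrix `M`, with the
singular values in decreasing order. The columns of `U` are left singular vectors. -/
structure IsSVD {n : ℕ} (M U : Matrix (Fin n) (Fin n) ℝ) (s : Fin n → ℝ)
    (V : Matrix (Fin n) (Fin n) ℝ) : Prop where
  left_orthogonal : U ∈ Matrix.orthogonalGroup (Fin n) ℝ
  right_orthogonal : V ∈ Matrix.orthogonalGroup (Fin n) ℝ
  nonneg : ∀ i, 0 ≤ s i
  antitone : Antitone s
  eq : M = U * Matrix.diagonal s * Vᵀ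

/-- Whitening step: `W = A Σ^(-1/2)` where the columns of `A` are orthonormal left singular vectors
of `P` for its `k` largest singular values and `Σ` is the diagonal matrix of these values. An SVD
is not unique; `IsWhitening hkd P W` says that `W` arises from some choice of it. -/
def IsWhitening {d k : ℕ} (hkd : k ≤ d) (P : Matrix (Fin d) (Fin d) ℝ)
    (W : Matrix (Fin d) (Fin k) ℝ) : Prop :=
  ∃ U s V, IsSVD P U s V ∧
    W = U.submatrix id (Fin.castLE hkd) *
      Matrix.diagonal fun i => (Real.sqrt (s (Fin.castLE hkd i)))⁻¹

/-- SVD step: `v` is a (complete, orthonormal) family of left singular vectors of `M`. -/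
def IsLeftSingularFamily {k : ℕ} (M : Matrix (Fin k) (Fin k) ℝ) (v : Fin k → Fin k → ℝ) : Prop :=
  ∃ U s V, IsSVD M U s V ∧ ∀ i, v i = U.col i

/-- The pseudo-inverse `A⁺ = (AᵀA)⁻¹Aᵀ` of a matrix with linearly independent columns. -/
def pinv {d k : ℕ} (A : Matrix (Fin d) (Fin k) ℝ) : Matrix (Fin k) (Fin d) ℝ :=
  (Aᵀ * A)⁻¹ * Aᵀ

/-- The scale `Ẑ = 2 / ((α₀ + 2) (W v)ᵀ T(W v) (W v))`. -/
def scale {d k : ℕ} (α₀ : ℝ) (T : (Fin d → ℝ) → Matrix (Fin d) (Fin d) ℝ)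
    (W : Matrix (Fin d) (Fin k) ℝ) (v : Fin k → ℝ) : ℝ :=
  2 / ((α₀ + 2) * ((W *ᵥ v) ⬝ᵥ (T (W *ᵥ v) *ᵥ (W *ᵥ v))))

/-- Reconstruction step: `Ô = (1 / Ẑ) (W⁺)ᵀ v`. If the cubic form in `Ẑ` vanishes this reads `0`,
in agreement with `1 / Ẑ = (α₀ + 2) (W v)ᵀ T(W v) (W v) / 2`. -/
def reconstruct {d k : ℕ} (α₀ : ℝ) (T : (Fin d → ℝ) → Matrix (Fin d) (Fin d) ℝ)
    (W : Matrix (Fin d) (Fin k) ℝ) (v : Fin k → ℝ) : Fin d → ℝ :=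
  (scale α₀ T W v)⁻¹ • ((pinv W)ᵀ *ᵥ v)

/-- The uniform probability distribution on the unit sphere of `ℝ^k` (for `k ≥ 1`). -/
def sphereUniform (k : ℕ) : Measure (Metric.sphere (0 : EuclideanSpace ℝ (Fin k)) 1) :=
  ((volume : Measure (EuclideanSpace ℝ (Fin k))).toSphere Set.univ)⁻¹ •
    (volume : Measure (EuclideanSpace ℝ (Fin k))).toSphere

/-- Success of the empirical algorithm on the data `w`, with accuracy `ε`. Whichever singular
vectors of the empirical second moment are used for whitening, the whitening matrix `W` has full
rank, and for `θ` uniform on the sphere, with probability greater than `3/4`, whichever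
left singular vectors are used in the second SVD, the outputs match the columns of `O` up to a
permutation and up to `ℓ₂` error `ε`. The whitening is chosen before `θ` is drawn. -/
def ECASucceeds {N d k : ℕ} (hkd : k ≤ d) (α₀ : ℝ) (O : Matrix (Fin d) (Fin k) ℝ) (ε : ℝ)
    (w : Fin N → Fin 3 → Fin d) : Prop :=
  ∀ W : Matrix (Fin d) (Fin k) ℝ, IsWhitening hkd (empPairs α₀ w) W →
    W.rank = k ∧
    3 / 4 < (sphereUniform k).real
      {θ | ∀ v : Fin k → Fin k → ℝ,
        IsLeftSingularFamily (Wᵀ * empTriples α₀ w (W *ᵥ (θ.1 : Fin k → ℝ)) * W) v →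
        ∃ τ : Equiv.Perm (Fin k), ∀ i,
          ‖WithLp.toLp 2 (O.col i - reconstruct α₀ (empTriples α₀ w) W (v (τ i)))‖ ≤ ε}

end LDA

end

/-!
Writing `α₀ = ∑ i, α i`, the second and third modified population moments are
`∑ i, D i O_i O_iᵀ` and `∑ i, 2 / (α₀ + 2) * D i * ⟨η, O_i⟩ O_i O_iᵀ`, where
`D i = α i / (α₀ (α₀ + 1))`. If `W` whitens the second moment, the vectors `√(D i) Wᵀ O_i` are
orthonormal and diagonalize the whitened third moment, so that its singular vectors determine the
columns `O_i` of `O`.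

The empirical frequencies of words, pairs and triples of words are averages of unit vectors, so
their Euclidean distance to the means has expectation at most `1 / √N`, whatever `d` is, and
concentrates by McDiarmid's inequality. Whitening with the perturbed second moment, whose small
singular values are controlled by those of `O`, makes the vectors `√(D i) Wᵀ O_i` nearly
orthonormal and the whitened third moment nearly diagonal. The coefficients of a uniform direction
`θ` along an orthonormal basis are separated, up to sign and with probability greater than `3 / 4`,
by a multiple of `k ^ (-3)`: this is a union bound over slabs of the sphere. Such a gap makes
the singular vectors stable under the perturbation. When the error is too large for the gap, the
accuracy claimed is weaker than a bound that holds for every unit vector.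
-/

noncomputable section

namespace LDA

/-! ### Anti-concentration on the sphere -/

section Slab

open scoped Pointwise

variable {E : Type*} [NormedAddCommGroup E] [InnerProductSpace ℝ E] {u : E} {a r t : ℝ}

/-- The part of the open unit ball at distance less than `t` from the hyperplane orthogonal to the
unit vector `u`. -/
def slab (u : E) (t : ℝ) : Set E := Metric.ball 0 1 ∩ {x | |inner ℝ u x| < t}

lemma isOpen_slab (u : E) (t : ℝ) : IsOpen (slab u t) :=
  Metric.isOpen_ball.inter (isOpen_lt (by fun_prop) continuous_const)

lemma abs_inner_sub_lt_of_mem_vadd_smul_slab (hu : ‖u‖ = 1) (hr : 0 < r) (hr1 : r ≤ 1) {y : E}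
    (hy : y ∈ a • u +ᵥ r • slab u t) : |inner ℝ u y - a| < t := by
  obtain ⟨_, ⟨x, hx, rfl⟩, rfl⟩ := hy
  have hinner : inner ℝ u (a • u +ᵥ r • x) - a = r * inner ℝ u x := by
    rw [vadd_eq_add, inner_add_right, inner_smul_right, inner_smul_right,
      real_inner_self_eq_norm_sq, hu]
    ring
  rw [hinner, abs_mul, abs_of_pos hr]
  exact (mul_le_of_le_one_left (abs_nonneg _) hr1).trans_lt hx.2

lemma pairwise_disjoint_vadd_smul_slab (hu : ‖u‖ = 1) (hr : 0 < r) (hr1 : r ≤ 1) (ht : 0 ≤ t) :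
    Pairwise (Function.onFun Disjoint fun j : ℕ => (2 * j * t) • u +ᵥ r • slab u t) := by
  intro i j hij
  refine Set.disjoint_left.2 fun y hyi hyj => ?_
  have hi := abs_lt.1 (abs_inner_sub_lt_of_mem_vadd_smul_slab hu hr hr1 hyi)
  have hj := abs_lt.1 (abs_inner_sub_lt_of_mem_vadd_smul_slab hu hr hr1 hyj)
  rcases lt_or_gt_of_ne hij with h | h
  · have : (i : ℝ) + 1 ≤ j := by exact_mod_cast h
    nlinarith
  · have : (j : ℝ) + 1 ≤ i := by exact_mod_cast h
    nlinarith

lemma vadd_smul_slab_subset_ball (hu : ‖u‖ = 1) (hr : 0 < r) (ha : 0 ≤ a) (har : a + r ≤ 1) :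
    a • u +ᵥ r • slab u t ⊆ Metric.ball 0 1 := by
  rintro _ ⟨_, ⟨x, hx, rfl⟩, rfl⟩
  rw [mem_ball_zero_iff]
  calc ‖a • u + r • x‖ ≤ ‖a • u‖ + ‖r • x‖ := norm_add_le _ _
    _ = a + r * ‖x‖ := by
      rw [norm_smul, norm_smul, hu, mul_one, Real.norm_of_nonneg ha, Real.norm_of_nonneg hr.le]
    _ < a + r := by
      have : ‖x‖ < 1 := mem_ball_zero_iff.1 hx.1
      nlinarith
    _ ≤ 1 := har

variable [FiniteDimensional ℝ E] [MeasurableSpace E] [BorelSpace E]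
  (μ : Measure E) [μ.IsAddHaarMeasure]

-- `n` disjoint translates of the slab, shrunk by the factor `r`, fit into the ball.
lemma card_mul_measureReal_slab_le (hu : ‖u‖ = 1) (hr : 0 < r) (ht : 0 ≤ t) {n : ℕ}
    (hn : 2 * n * t + r ≤ 1) :
    n * (r ^ Module.finrank ℝ E * μ.real (slab u t)) ≤ μ.real (Metric.ball 0 1) := by
  have hr1 : r ≤ 1 := by linarith [show 0 ≤ 2 * n * t by positivity]
  have hmeasure (j : ℕ) : μ.real ((2 * j * t) • u +ᵥ r • slab u t) =
      r ^ Module.finrank ℝ E * μ.real (slab u t) := by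
    simp [Measure.real, Measure.addHaar_smul, abs_of_pos hr, hr.le]
  have hsubset : ⋃ j ∈ Finset.range n, ((2 * j * t) • u +ᵥ r • slab u t) ⊆ Metric.ball 0 1 := by
    refine Set.iUnion₂_subset fun j hj => vadd_smul_slab_subset_ball hu hr (by positivity) ?_
    have : (j : ℝ) ≤ n := by exact_mod_cast (Finset.mem_range.1 hj).le
    linarith [mul_le_mul_of_nonneg_right this ht]
  have hmeas (j : ℕ) : MeasurableSet ((2 * j * t) • u +ᵥ r • slab u t) :=
    (((isOpen_slab u t).smul₀ hr.ne').vadd _).measurableSet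
  calc n * (r ^ Module.finrank ℝ E * μ.real (slab u t))
      = μ.real (⋃ j ∈ Finset.range n, ((2 * j * t) • u +ᵥ r • slab u t)) := by
        rw [measureReal_biUnion_finset
          (fun i _ j _ hij => pairwise_disjoint_vadd_smul_slab hu hr hr1 ht hij)
          (fun j _ => hmeas j)
          fun j hj => ((measure_mono ((Set.subset_biUnion_of_mem
            (u := fun j : ℕ => (2 * j * t) • u +ᵥ r • slab u t) hj).trans hsubset)).trans_lt
              measure_ball_lt_top).ne]
        simp [hmeasure]
    _ ≤ μ.real (Metric.ball 0 1) := measureReal_mono hsubset measure_ball_lt_top.ne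

lemma measureReal_slab_le (hu : ‖u‖ = 1) {n : ℕ} (hn : 0 < n) :
    μ.real (slab u (1 / (4 * Module.finrank ℝ E * n))) ≤ 2 / n * μ.real (Metric.ball 0 1) := by
  have : Nontrivial E := ⟨u, 0, by rintro rfl; simp at hu⟩
  set k := Module.finrank ℝ E
  have hk0 : 0 < k := Module.finrank_pos
  have hk1 : (1 : ℝ) ≤ k := by exact_mod_cast hk0
  have hhalf : 1 / (2 * (k : ℝ)) ≤ 1 / 2 := by
    apply one_div_le_one_div_of_le <;> linarith
  have hpack := card_mul_measureReal_slab_le μ hu (r := 1 - 1 / (2 * k)) (n := n)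
    (t := 1 / (4 * k * n)) (by linarith) (by positivity) (by field_simp; linarith)
  have hbernoulli : 1 / 2 ≤ (1 - 1 / (2 * (k : ℝ))) ^ k := by
    calc (1 : ℝ) / 2 = 1 + k * -(1 / (2 * k)) := by field_simp; norm_num
      _ ≤ (1 + -(1 / (2 * (k : ℝ)))) ^ k := one_add_mul_le_pow (by linarith) k
  rw [div_mul_eq_mul_div, le_div_iff₀ (by positivity)]
  have := mul_le_mul_of_nonneg_right hbernoulli
    (mul_nonneg n.cast_nonneg (measureReal_nonneg (μ := μ) (s := slab u (1 / (4 * k * n)))))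
  linarith

end Slab

section Sphere

open scoped Pointwise

variable {k : ℕ}

lemma Ioo_smul_image_inner_lt_subset_slab {u : EuclideanSpace ℝ (Fin k)} (hu : u ≠ 0) (t : ℝ) :
    Set.Ioo (0 : ℝ) 1 • ((↑) '' {θ : Metric.sphere (0 : EuclideanSpace ℝ (Fin k)) 1 |
      |inner ℝ u (θ : EuclideanSpace ℝ (Fin k))| < ‖u‖ * t}) ⊆ slab (‖u‖⁻¹ • u) t := by
  rintro _ ⟨a, ha, _, ⟨θ, hθ, rfl⟩, rfl⟩
  have hnorm : ‖a • (θ : EuclideanSpace ℝ (Fin k))‖ = a := by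
    rw [norm_smul, norm_eq_of_mem_sphere, mul_one, Real.norm_of_nonneg ha.1.le]
  refine ⟨mem_ball_zero_iff.2 (hnorm.trans_lt ha.2), ?_⟩
  calc |inner ℝ (‖u‖⁻¹ • u) (a • (θ : EuclideanSpace ℝ (Fin k)))|
      = a * (‖u‖⁻¹ * |inner ℝ u (θ : EuclideanSpace ℝ (Fin k))|) := by
        rw [inner_smul_right, real_inner_smul_left, abs_mul, abs_mul, abs_of_pos ha.1, abs_inv,
          abs_norm]
    _ ≤ ‖u‖⁻¹ * |inner ℝ u (θ : EuclideanSpace ℝ (Fin k))| :=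
        mul_le_of_le_one_left (by positivity) ha.2.le
    _ < t := (inv_mul_lt_iff₀ (norm_pos_iff.2 hu)).2 hθ

variable [NeZero k]

instance : IsProbabilityMeasure (sphereUniform k) where
  measure_univ := ENNReal.inv_mul_cancel
    (Measure.measure_univ_eq_zero.not.2 (Measure.toSphere_ne_zero _)) (measure_ne_top _ _)

lemma sphereUniform_real_eq_div {s : Set (Metric.sphere (0 : EuclideanSpace ℝ (Fin k)) 1)}
    (hs : MeasurableSet s) :
    (sphereUniform k).real s =
      volume.real (Set.Ioo (0 : ℝ) 1 • ((↑) '' s : Set (EuclideanSpace ℝ (Fin k)))) /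
        volume.real (Metric.ball (0 : EuclideanSpace ℝ (Fin k)) 1) := by
  have hk : (k : ℝ) ≠ 0 := NeZero.ne _
  rw [sphereUniform, Measure.real, Measure.smul_apply, smul_eq_mul, Measure.toSphere_apply' _ hs,
    Measure.toSphere_apply_univ]
  simp only [ENNReal.toReal_mul, ENNReal.toReal_inv, Measure.real, finrank_euclideanSpace,
    Fintype.card_fin, ENNReal.toReal_natCast]
  field_simp

lemma sphereUniform_abs_inner_lt_le {u : EuclideanSpace ℝ (Fin k)} (hu : u ≠ 0) :
    (sphereUniform k).real {θ | |inner ℝ u (θ : EuclideanSpace ℝ (Fin k))| < ‖u‖ / (32 * k ^ 3)} ≤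
      1 / (4 * k ^ 2) := by
  have hk : 0 < k := Nat.pos_of_ne_zero (NeZero.ne k)
  have hslab := measureReal_slab_le volume (u := ‖u‖⁻¹ • u)
    (by rw [norm_smul, norm_inv, norm_norm, inv_mul_cancel₀ (norm_ne_zero_iff.2 hu)])
    (n := 8 * k ^ 2) (by positivity)
  have ht : (1 : ℝ) / (4 * k * (8 * k ^ 2 : ℕ)) = 1 / (32 * k ^ 3) := by push_cast; ring_nf
  rw [finrank_euclideanSpace_fin, ht] at hslab
  have hball : 0 < volume.real (Metric.ball (0 : EuclideanSpace ℝ (Fin k)) 1) :=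
    ENNReal.toReal_pos (Metric.measure_ball_pos volume _ one_pos).ne' measure_ball_lt_top.ne
  rw [sphereUniform_real_eq_div (isOpen_lt (by fun_prop) continuous_const).measurableSet,
    div_le_iff₀ hball, div_eq_mul_one_div ‖u‖]
  refine (measureReal_mono (Ioo_smul_image_inner_lt_subset_slab hu _)
    ((measure_mono Set.inter_subset_left).trans_lt measure_ball_lt_top).ne).trans
      (hslab.trans_eq ?_)
  push_cast
  ring

lemma sphereUniform_forall_le_abs_inner {ι : Type*} {s : Finset ι} (hs : s.card < k ^ 2)
    {u : ι → EuclideanSpace ℝ (Fin k)} (hu : ∀ i ∈ s, u i ≠ 0) :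
    3 / 4 < (sphereUniform k).real
      {θ | ∀ i ∈ s, ‖u i‖ / (32 * k ^ 3) ≤ |inner ℝ (u i) (θ : EuclideanSpace ℝ (Fin k))|} := by
  have hk : (0 : ℝ) < k := by exact_mod_cast Nat.pos_of_ne_zero (NeZero.ne k)
  let bad (i : ι) : Set (Metric.sphere (0 : EuclideanSpace ℝ (Fin k)) 1) :=
    {θ | |inner ℝ (u i) (θ : EuclideanSpace ℝ (Fin k))| < ‖u i‖ / (32 * k ^ 3)}
  have hmeas : MeasurableSet (⋃ i ∈ s, bad i) :=
    Finset.measurableSet_biUnion _ fun i _ =>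
      (isOpen_lt (by fun_prop) continuous_const).measurableSet
  have hcompl : {θ : Metric.sphere (0 : EuclideanSpace ℝ (Fin k)) 1 | ∀ i ∈ s,
      ‖u i‖ / (32 * k ^ 3) ≤ |inner ℝ (u i) (θ : EuclideanSpace ℝ (Fin k))|} =
        (⋃ i ∈ s, bad i)ᶜ := by
    ext θ
    simp [bad]
  have hbad : (sphereUniform k).real (⋃ i ∈ s, bad i) < 1 / 4 :=
    calc (sphereUniform k).real (⋃ i ∈ s, bad i)
        ≤ ∑ i ∈ s, (sphereUniform k).real (bad i) := measureReal_biUnion_finset_le s _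
      _ ≤ ∑ _i ∈ s, 1 / (4 * (k : ℝ) ^ 2) :=
        Finset.sum_le_sum fun i hi => sphereUniform_abs_inner_lt_le (hu i hi)
      _ = s.card * (1 / (4 * (k : ℝ) ^ 2)) := by rw [Finset.sum_const, nsmul_eq_mul]
      _ < k ^ 2 * (1 / (4 * (k : ℝ) ^ 2)) := by gcongr; exact_mod_cast hs
      _ = 1 / 4 := by field_simp
  rw [hcompl, probReal_compl_eq_one_sub hmeas]
  linarith

end Sphere

/-! ### Dirichlet moments -/

section OpenSimplex

/-- The open simplex of side `s` in `ℝ^m`; for `s = 1` it parametrizes the interior of the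
probability simplex of `ℝ^(m+1)` through `simplexPoint`. -/
def openSimplex (m : ℕ) (s : ℝ) : Set (Fin m → ℝ) := {x | (∀ i, 0 < x i) ∧ ∑ i, x i < s}

variable {m : ℕ} {s : ℝ}

lemma measurableSet_openSimplex (m : ℕ) (s : ℝ) : MeasurableSet (openSimplex m s) :=
  (measurableSet_setOfPred.2 (.forall fun i => measurableSet_setOfPred.1
    (measurableSet_lt measurable_const (measurable_pi_apply i)))).inter
    (measurableSet_lt (f := fun x : Fin m → ℝ => ∑ i, x i) (by fun_prop) measurable_const)

lemma cons_mem_openSimplex {y : ℝ} {z : Fin m → ℝ} :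
    (Fin.cons y z : Fin (m + 1) → ℝ) ∈ openSimplex (m + 1) s ↔
      y ∈ Set.Ioo 0 s ∧ z ∈ openSimplex m (s - y) := by
  simp only [openSimplex, Set.mem_ofPred_eq, Fin.forall_fin_succ, Fin.cons_zero, Fin.cons_succ,
    Fin.sum_univ_succ, Set.mem_Ioo, lt_sub_iff_add_lt']
  refine ⟨fun ⟨⟨hy, hz⟩, hs⟩ => ⟨⟨hy, ?_⟩, hz, hs⟩, fun ⟨⟨hy, _⟩, hz, hs⟩ => ⟨⟨hy, hz⟩, hs⟩⟩
  linarith [Finset.sum_nonneg fun i (_ : i ∈ Finset.univ) => (hz i).le]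

lemma lintegral_fin_succ {F : (Fin (m + 1) → ℝ) → ENNReal} (hF : Measurable F) :
    ∫⁻ x, F x = ∫⁻ y : ℝ, ∫⁻ z : Fin m → ℝ, F (Fin.cons y z) := by
  have he := (volume_preserving_piFinSuccAbove (fun _ : Fin (m + 1) => ℝ) 0).symm
  rw [← he.lintegral_comp hF, Measure.volume_eq_prod, lintegral_prod]
  · simp [MeasurableEquiv.piFinSuccAbove, Fin.insertNthEquiv]
  · exact (hF.comp he.measurable).aemeasurable

lemma setLIntegral_openSimplex_succ {F : (Fin (m + 1) → ℝ) → ENNReal} (hF : Measurable F) :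
    ∫⁻ x in openSimplex (m + 1) s, F x =
      ∫⁻ y in Set.Ioo 0 s, ∫⁻ z in openSimplex m (s - y), F (Fin.cons y z) := by
  rw [← lintegral_indicator (measurableSet_openSimplex _ _),
    lintegral_fin_succ (hF.indicator (measurableSet_openSimplex _ _)),
    ← lintegral_indicator measurableSet_Ioo]
  refine lintegral_congr fun y => ?_
  by_cases hy : y ∈ Set.Ioo 0 s
  · rw [Set.indicator_of_mem hy, ← lintegral_indicator (measurableSet_openSimplex _ _)]
    refine lintegral_congr fun z => ?_
    by_cases hz : z ∈ openSimplex m (s - y)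
    · rw [Set.indicator_of_mem hz, Set.indicator_of_mem (cons_mem_openSimplex.2 ⟨hy, hz⟩)]
    · rw [Set.indicator_of_notMem hz,
        Set.indicator_of_notMem fun h => hz (cons_mem_openSimplex.1 h).2]
  · simp only [Set.indicator, cons_mem_openSimplex, hy, false_and, if_false, lintegral_zero]

lemma lintegral_Ioo_comp_mul_left (hs : 0 < s) {f : ℝ → ENNReal} (hf : Measurable f) :
    ∫⁻ y in Set.Ioo 0 s, f y = ENNReal.ofReal s * ∫⁻ x in Set.Ioo 0 1, f (s * x) := by
  have hpreimage : (fun x => s * x) ⁻¹' Set.Ioo 0 s = Set.Ioo 0 1 := by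
    rw [Set.preimage_const_mul_Ioo₀ _ _ hs, zero_div, div_self hs.ne']
  conv_lhs => rw [← Real.smul_map_volume_mul_left hs.ne']
  rw [Measure.restrict_smul, lintegral_smul_measure,
    setLIntegral_map measurableSet_Ioo hf (by fun_prop), hpreimage, abs_of_pos hs, smul_eq_mul]

lemma lintegral_rpow_mul_one_sub_rpow {a b : ℝ} (ha : 0 < a) (hb : 0 < b) :
    ∫⁻ x in Set.Ioo 0 1, ENNReal.ofReal (x ^ (a - 1) * (1 - x) ^ (b - 1)) =
      ENNReal.ofReal (beta a b) := by
  have hbeta : 0 < beta a b := beta_pos ha hb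
  have hpdf : ∫⁻ x in Set.Ioo 0 1,
      ENNReal.ofReal (1 / beta a b * x ^ (a - 1) * (1 - x) ^ (b - 1)) = 1 :=
    lintegral_betaPDF.symm.trans (lintegral_betaPDF_eq_one ha hb)
  simp only [mul_assoc, ENNReal.ofReal_mul (one_div_pos.2 hbeta).le] at hpdf
  rw [lintegral_const_mul' _ _ ENNReal.ofReal_ne_top, one_div, ENNReal.ofReal_inv_of_pos hbeta]
    at hpdf
  rw [← mul_one (ENNReal.ofReal (beta a b)), ← hpdf, ENNReal.mul_inv_cancel_left
    (ENNReal.ofReal_pos.2 hbeta).ne' ENNReal.ofReal_ne_top]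

lemma lintegral_rpow_mul_sub_rpow {a b : ℝ} (ha : 0 < a) (hb : 0 < b) (hs : 0 < s) :
    ∫⁻ y in Set.Ioo 0 s, ENNReal.ofReal (y ^ (a - 1) * (s - y) ^ (b - 1)) =
      ENNReal.ofReal (s ^ (a + b - 1) * beta a b) := by
  have hscale : ∀ x ∈ Set.Ioo (0 : ℝ) 1,
      ENNReal.ofReal ((s * x) ^ (a - 1) * (s - s * x) ^ (b - 1)) =
        ENNReal.ofReal (s ^ (a + b - 2)) * ENNReal.ofReal (x ^ (a - 1) * (1 - x) ^ (b - 1)) := by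
    intro x hx
    rw [← ENNReal.ofReal_mul (by positivity), ← mul_one_sub, Real.mul_rpow hs.le hx.1.le,
      Real.mul_rpow hs.le (sub_pos.2 hx.2).le, show a + b - 2 = (a - 1) + (b - 1) by ring,
      Real.rpow_add hs]
    ring_nf
  rw [lintegral_Ioo_comp_mul_left hs (by fun_prop), setLIntegral_congr_fun measurableSet_Ioo hscale,
    lintegral_const_mul' _ _ ENNReal.ofReal_ne_top, lintegral_rpow_mul_one_sub_rpow ha hb,
    ← mul_assoc, ← ENNReal.ofReal_mul hs.le, mul_comm s, ← Real.rpow_add_one hs.ne',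
    ← ENNReal.ofReal_mul (by positivity)]
  ring_nf

lemma lintegral_openSimplex {β : Fin m → ℝ} (hβ : ∀ i, 0 < β i) {a : ℝ} (ha : 0 < a)
    (hs : 0 < s) :
    ∫⁻ x in openSimplex m s,
        ENNReal.ofReal ((∏ i, x i ^ (β i - 1)) * (s - ∑ i, x i) ^ (a - 1)) =
      ENNReal.ofReal (s ^ (∑ i, β i + a - 1) *
        ((∏ i, Real.Gamma (β i)) * Real.Gamma a / Real.Gamma (∑ i, β i + a))) := by
  induction m generalizing s with
  | zero =>
    have huniv : openSimplex 0 s = Set.univ := by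
      ext x; simp [openSimplex, hs]
    rw [huniv, Measure.restrict_univ, volume_pi, Measure.pi_of_empty, lintegral_dirac]
    simp [(Real.Gamma_pos_of_pos ha).ne']
  | succ m ih =>
    set b := ∑ i : Fin m, β i.succ + a with hb
    have hb0 : 0 < b := add_pos_of_nonneg_of_pos (Finset.sum_nonneg fun i _ => (hβ _).le) ha
    set K := (∏ i : Fin m, Real.Gamma (β i.succ)) * Real.Gamma a / Real.Gamma b with hK
    have hK0 : 0 < K := div_pos (mul_pos (Finset.prod_pos fun i _ => Real.Gamma_pos_of_pos (hβ _))
      (Real.Gamma_pos_of_pos ha)) (Real.Gamma_pos_of_pos hb0)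
    have hinner : ∀ y ∈ Set.Ioo 0 s, ∫⁻ z in openSimplex m (s - y), ENNReal.ofReal
        ((∏ i, (Fin.cons y z : Fin (m + 1) → ℝ) i ^ (β i - 1)) *
          (s - ∑ i, (Fin.cons y z : Fin (m + 1) → ℝ) i) ^ (a - 1)) =
        ENNReal.ofReal K * ENNReal.ofReal (y ^ (β 0 - 1) * (s - y) ^ (b - 1)) := by
      intro y hy
      have hy0 : 0 ≤ y ^ (β 0 - 1) := Real.rpow_nonneg hy.1.le _
      simp only [Fin.prod_univ_succ, Fin.sum_univ_succ, Fin.cons_zero, Fin.cons_succ, mul_assoc,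
        ENNReal.ofReal_mul hy0, ← sub_sub]
      rw [lintegral_const_mul' _ _ ENNReal.ofReal_ne_top, ih (fun i => hβ i.succ)
        (sub_pos.2 hy.2), mul_comm (_ ^ _) K, ENNReal.ofReal_mul hK0.le, mul_left_comm]
    rw [setLIntegral_openSimplex_succ (by fun_prop),
      setLIntegral_congr_fun measurableSet_Ioo hinner,
      lintegral_const_mul' _ _ ENNReal.ofReal_ne_top, lintegral_rpow_mul_sub_rpow (hβ 0) hb0 hs,
      ← ENNReal.ofReal_mul hK0.le, beta, hK, Fin.prod_univ_succ, Fin.sum_univ_succ, add_assoc, ← hb]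
    have := (Real.Gamma_pos_of_pos hb0).ne'
    congr 1
    field_simp

end OpenSimplex

section Dirichlet

variable {k m : ℕ}

lemma measurable_simplexPoint : Measurable (simplexPoint (m := m)) := by
  refine measurable_pi_iff.2 fun i => ?_
  refine Fin.cases ?_ (fun j => ?_) i
  · simp only [simplexPoint, Fin.cons_zero]
    fun_prop
  · simp only [simplexPoint, Fin.cons_succ]
    fun_prop

lemma measurable_dirichletDensity (α : Fin k → ℝ) : Measurable (dirichletDensity α) := by
  unfold dirichletDensity
  fun_prop

lemma simplexPoint_mem_Ioc {x : Fin m → ℝ} (hx : x ∈ openSimplex m 1) (i : Fin (m + 1)) :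
    simplexPoint x i ∈ Set.Ioc 0 1 := by
  have hpos (j : Fin (m + 1)) : 0 < simplexPoint x j := by
    refine Fin.cases ?_ (fun j => ?_) j
    · simpa [simplexPoint] using hx.2
    · simpa [simplexPoint] using hx.1 j
  have hsum : ∑ j, simplexPoint x j = 1 := by simp [simplexPoint, Fin.sum_univ_succ]
  exact ⟨hpos i, hsum ▸ Finset.single_le_sum (fun j _ => (hpos j).le) (Finset.mem_univ i)⟩

lemma lintegral_dirichlet (α : Fin (m + 1) → ℝ) {f : (Fin (m + 1) → ℝ) → ENNReal}
    (hf : Measurable f) :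
    ∫⁻ h, f h ∂(dirichlet α) = ∫⁻ x in openSimplex m 1,
      ENNReal.ofReal (dirichletDensity α (simplexPoint x)) * f (simplexPoint x) := by
  rw [dirichlet, lintegral_map hf measurable_simplexPoint, lintegral_withDensity_eq_lintegral_mul]
  · rfl
  · exact ((measurable_dirichletDensity α).comp measurable_simplexPoint).ennreal_ofReal
  · exact hf.comp measurable_simplexPoint

lemma ae_dirichlet_mem_Ioc (α : Fin k → ℝ) : ∀ᵐ h ∂(dirichlet α), ∀ i, h i ∈ Set.Ioc 0 1 := by
  cases k with
  | zero => simp [dirichlet]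
  | succ m =>
    have hmeas : MeasurableSet {h : Fin (m + 1) → ℝ | ∀ i, h i ∈ Set.Ioc 0 1} :=
      measurableSet_setOfPred.2 (.forall fun i => measurableSet_setOfPred.1
        (measurable_pi_apply i measurableSet_Ioc))
    rw [dirichlet, ae_map_iff measurable_simplexPoint.aemeasurable hmeas]
    refine (withDensity_absolutelyContinuous _ _).ae_le ?_
    filter_upwards [ae_restrict_mem (measurableSet_openSimplex m 1)] with x hx
    exact simplexPoint_mem_Ioc hx

lemma isProbabilityMeasure_dirichlet [NeZero k] {α : Fin k → ℝ} (hα : ∀ i, 0 < α i) :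
    IsProbabilityMeasure (dirichlet α) := by
  obtain ⟨m, rfl⟩ := Nat.exists_eq_succ_of_ne_zero (NeZero.ne k)
  have hG : 0 < Real.Gamma (∑ i, α i) :=
    Real.Gamma_pos_of_pos (Finset.sum_pos (fun i _ => hα i) Finset.univ_nonempty)
  have hP : 0 < ∏ i, Real.Gamma (α i) := Finset.prod_pos fun i _ => Real.Gamma_pos_of_pos (hα i)
  have hdensity (x : Fin m → ℝ) : ENNReal.ofReal (dirichletDensity α (simplexPoint x)) =
      ENNReal.ofReal (Real.Gamma (∑ i, α i) / ∏ i, Real.Gamma (α i)) *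
        ENNReal.ofReal ((∏ i, x i ^ (α i.succ - 1)) * (1 - ∑ i, x i) ^ (α 0 - 1)) := by
    rw [← ENNReal.ofReal_mul (div_pos hG hP).le, dirichletDensity,
      Fin.prod_univ_succ fun i => simplexPoint x i ^ (α i - 1), mul_comm (_ ^ (α 0 - 1))]
    rfl
  refine ⟨?_⟩
  rw [← lintegral_one, lintegral_dirichlet α measurable_const]
  simp only [mul_one, hdensity]
  rw [lintegral_const_mul' _ _ ENNReal.ofReal_ne_top,
    lintegral_openSimplex (fun i => hα i.succ) (hα 0) one_pos,
    ← ENNReal.ofReal_mul (div_pos hG hP).le, Real.one_rpow, one_mul,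
    mul_comm (∏ i : Fin m, Real.Gamma (α i.succ)), add_comm (∑ i : Fin m, α i.succ),
    ← Fin.prod_univ_succ fun i => Real.Gamma (α i), ← Fin.sum_univ_succ α,
    div_mul_div_cancel₀ hP.ne', div_self hG.ne', ENNReal.ofReal_one]

lemma sum_add_single (α : Fin k → ℝ) (i : Fin k) :
    ∑ j, (α + Pi.single i 1 : Fin k → ℝ) j = ∑ j, α j + 1 := by
  simp [Finset.sum_add_distrib]

lemma add_single_pos {α : Fin k → ℝ} (hα : ∀ i, 0 < α i) (i j : Fin k) :
    0 < (α + Pi.single i 1 : Fin k → ℝ) j := by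
  have hnonneg : (0 : Fin k → ℝ) ≤ Pi.single i 1 := Pi.single_nonneg.2 zero_le_one
  exact add_pos_of_pos_of_nonneg (hα j) (hnonneg j)

lemma prod_Gamma_add_single {α : Fin k → ℝ} (hα : ∀ i, 0 < α i) (i : Fin k) :
    ∏ j, Real.Gamma ((α + Pi.single i 1 : Fin k → ℝ) j) = α i * ∏ j, Real.Gamma (α j) := by
  rw [← Finset.mul_prod_erase _ _ (Finset.mem_univ i),
    ← Finset.mul_prod_erase _ (fun j => Real.Gamma (α j)) (Finset.mem_univ i), ← mul_assoc,
    ← Real.Gamma_add_one (hα i).ne', Pi.add_apply, Pi.single_eq_same]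
  congr 1
  refine Finset.prod_congr rfl fun j hj => ?_
  rw [Pi.add_apply, Pi.single_eq_of_ne (Finset.ne_of_mem_erase hj), add_zero]

lemma prod_rpow_add_single (α : Fin k → ℝ) {i : Fin k} {h : Fin k → ℝ} (hi : h i ≠ 0) :
    ∏ j, h j ^ ((α + Pi.single i 1 : Fin k → ℝ) j - 1) = h i * ∏ j, h j ^ (α j - 1) := by
  rw [← Finset.mul_prod_erase _ _ (Finset.mem_univ i),
    ← Finset.mul_prod_erase _ (fun j => h j ^ (α j - 1)) (Finset.mem_univ i), ← mul_assoc,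
    mul_comm (h i), ← Real.rpow_add_one hi, Pi.add_apply, Pi.single_eq_same, sub_add_cancel,
    add_sub_cancel_right]
  congr 1
  refine Finset.prod_congr rfl fun j hj => ?_
  rw [Pi.add_apply, Pi.single_eq_of_ne (Finset.ne_of_mem_erase hj), add_zero]

lemma dirichletDensity_mul_coord {α : Fin k → ℝ} (hα : ∀ i, 0 < α i) {i : Fin k} {h : Fin k → ℝ}
    (hi : h i ≠ 0) :
    dirichletDensity α h * h i =
      α i / (∑ j, α j) * dirichletDensity (α + Pi.single i 1) h := by
  have hsum : 0 < ∑ j, α j := Finset.sum_pos (fun j _ => hα j) ⟨i, Finset.mem_univ i⟩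
  have hG := (Real.Gamma_pos_of_pos hsum).ne'
  have hP : ∏ j, Real.Gamma (α j) ≠ 0 :=
    (Finset.prod_pos fun j _ => Real.Gamma_pos_of_pos (hα j)).ne'
  have hαi := (hα i).ne'
  rw [dirichletDensity, dirichletDensity, sum_add_single, prod_Gamma_add_single hα,
    prod_rpow_add_single α hi, Real.Gamma_add_one hsum.ne']
  field_simp

lemma withDensity_coord_dirichlet {α : Fin k → ℝ} (hα : ∀ i, 0 < α i) (i : Fin k) :
    (dirichlet α).withDensity (fun h => ENNReal.ofReal (h i)) =
      ENNReal.ofReal (α i / ∑ j, α j) • dirichlet (α + Pi.single i 1) := by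
  obtain ⟨m, rfl⟩ := Nat.exists_eq_succ_of_ne_zero i.pos.ne'
  have hc : 0 ≤ α i / ∑ j, α j := div_nonneg (hα i).le (Finset.sum_nonneg fun j _ => (hα j).le)
  refine Measure.ext_of_lintegral _ fun f hf => ?_
  rw [lintegral_withDensity_eq_lintegral_mul _ (by fun_prop) hf, lintegral_smul_measure,
    smul_eq_mul, lintegral_dirichlet _ (by fun_prop), lintegral_dirichlet _ hf,
    ← lintegral_const_mul' _ _ ENNReal.ofReal_ne_top]
  refine setLIntegral_congr_fun (measurableSet_openSimplex _ _) fun x hx => ?_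
  have hi := (simplexPoint_mem_Ioc hx i).1
  simp only [Pi.mul_apply]
  rw [← mul_assoc, ← mul_assoc, ← ENNReal.ofReal_mul' hi.le, ← ENNReal.ofReal_mul hc,
    dirichletDensity_mul_coord hα hi.ne']

lemma integral_coord_mul_dirichlet {α : Fin k → ℝ} (hα : ∀ i, 0 < α i) (i : Fin k)
    (f : (Fin k → ℝ) → ℝ) :
    ∫ h, h i * f h ∂(dirichlet α) =
      α i / (∑ j, α j) * ∫ h, f h ∂(dirichlet (α + Pi.single i 1)) := by
  have hc : 0 ≤ α i / ∑ j, α j := div_nonneg (hα i).le (Finset.sum_nonneg fun j _ => (hα j).le)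
  rw [← ENNReal.toReal_ofReal hc, ← smul_eq_mul, ← integral_smul_measure,
    ← withDensity_coord_dirichlet hα, integral_withDensity_eq_integral_toReal_smul (by fun_prop)
      (Filter.Eventually.of_forall fun _ => ENNReal.ofReal_lt_top)]
  refine integral_congr_ae ?_
  filter_upwards [ae_dirichlet_mem_Ioc α] with h hh
  rw [ENNReal.toReal_ofReal (hh i).1.le, smul_eq_mul]

lemma integrable_dirichlet {α : Fin k → ℝ} (hα : ∀ i, 0 < α i) {f : (Fin k → ℝ) → ℝ}
    (hf : Continuous f) : Integrable f (dirichlet α) := by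
  rcases eq_or_ne k 0 with rfl | hk
  · simp [dirichlet]
  have : NeZero k := ⟨hk⟩
  have := isProbabilityMeasure_dirichlet hα
  have hcompact : IsCompact (Set.univ.pi fun _ : Fin k => Set.Icc (0 : ℝ) 1) :=
    isCompact_univ_pi fun _ => isCompact_Icc
  obtain ⟨C, hC⟩ := hcompact.exists_bound_of_continuousOn hf.continuousOn
  refine .of_bound hf.aestronglyMeasurable C ?_
  filter_upwards [ae_dirichlet_mem_Ioc α] with h hh
  exact hC h fun i _ => Set.Ioc_subset_Icc_self (hh i)

lemma integral_dotProduct_mul_dirichlet {α : Fin k → ℝ} (hα : ∀ i, 0 < α i) (x : Fin k → ℝ)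
    {f : (Fin k → ℝ) → ℝ} (hf : Continuous f) :
    ∫ h, (h ⬝ᵥ x) * f h ∂(dirichlet α) =
      ∑ i, α i / (∑ j, α j) * x i * ∫ h, f h ∂(dirichlet (α + Pi.single i 1)) := by
  simp only [dotProduct, Finset.sum_mul, mul_assoc, mul_left_comm (_ : ℝ) (x _)]
  rw [integral_finsetSum _ fun i _ => integrable_dirichlet hα (by fun_prop)]
  exact Finset.sum_congr rfl fun i _ => by
    rw [integral_const_mul, integral_coord_mul_dirichlet hα]

variable [NeZero k] {α : Fin k → ℝ}

lemma integral_dotProduct_dirichlet (hα : ∀ i, 0 < α i) (x : Fin k → ℝ) :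
    ∫ h, h ⬝ᵥ x ∂(dirichlet α) = (α ⬝ᵥ x) / ∑ i, α i := by
  have (i : Fin k) := isProbabilityMeasure_dirichlet (add_single_pos hα i)
  simpa [dotProduct, Finset.sum_div, div_mul_eq_mul_div] using
    integral_dotProduct_mul_dirichlet hα x (f := fun _ => 1) continuous_const

lemma integral_dotProduct_two_dirichlet (hα : ∀ i, 0 < α i) (x y : Fin k → ℝ) :
    ∫ h, (h ⬝ᵥ x) * (h ⬝ᵥ y) ∂(dirichlet α) =
      ((α ⬝ᵥ x) * (α ⬝ᵥ y) + α ⬝ᵥ (x * y)) / ((∑ i, α i) * (∑ i, α i + 1)) := by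
  rw [integral_dotProduct_mul_dirichlet hα x (by fun_prop)]
  simp only [integral_dotProduct_dirichlet (add_single_pos hα _), sum_add_single,
    add_dotProduct, single_dotProduct, one_mul]
  generalize ∑ i, α i = s
  have hterm (i : Fin k) : α i / s * x i * ((α ⬝ᵥ y + y i) / (s + 1)) =
      (α i * x i * (α ⬝ᵥ y) + α i * (x i * y i)) / (s * (s + 1)) := by
    rw [div_mul_eq_mul_div, div_mul_div_comm]
    ring
  simp only [hterm, ← Finset.sum_div, Finset.sum_add_distrib, ← Finset.sum_mul]
  rfl

lemma integral_dotProduct_three_dirichlet (hα : ∀ i, 0 < α i) (x y z : Fin k → ℝ) :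
    ∫ h, (h ⬝ᵥ x) * ((h ⬝ᵥ y) * (h ⬝ᵥ z)) ∂(dirichlet α) =
      ((α ⬝ᵥ x) * (α ⬝ᵥ y) * (α ⬝ᵥ z) + (α ⬝ᵥ x) * (α ⬝ᵥ (y * z)) + (α ⬝ᵥ y) * (α ⬝ᵥ (x * z)) +
          (α ⬝ᵥ z) * (α ⬝ᵥ (x * y)) + 2 * α ⬝ᵥ (x * y * z)) /
        ((∑ i, α i) * (∑ i, α i + 1) * (∑ i, α i + 2)) := by
  rw [integral_dotProduct_mul_dirichlet hα x (by fun_prop)]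
  simp only [integral_dotProduct_two_dirichlet (add_single_pos hα _), sum_add_single,
    add_dotProduct, single_dotProduct, one_mul]
  generalize ∑ i, α i = s
  have hterm (i : Fin k) : α i / s * x i * (((α ⬝ᵥ y + y i) * (α ⬝ᵥ z + z i) +
        (α ⬝ᵥ (y * z) + (y * z) i)) / ((s + 1) * (s + 1 + 1))) =
      (α i * x i * ((α ⬝ᵥ y) * (α ⬝ᵥ z) + α ⬝ᵥ (y * z)) + α i * (x * z) i * (α ⬝ᵥ y) +
        α i * (x * y) i * (α ⬝ᵥ z) + α i * (x * y * z) i * 2) / (s * (s + 1) * (s + 2)) := by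
    rw [div_mul_eq_mul_div, div_mul_div_comm, Pi.mul_apply, Pi.mul_apply, Pi.mul_apply,
      Pi.mul_apply, Pi.mul_apply]
    ring
  simp only [hterm, ← Finset.sum_div, Finset.sum_add_distrib, ← Finset.sum_mul]
  rw [← dotProduct, ← dotProduct, ← dotProduct, ← dotProduct]
  ring

end Dirichlet

/-! ### Population moments -/

section DocumentLaw

variable {d k : ℕ} {α : Fin k → ℝ} {O : Matrix (Fin d) (Fin k) ℝ}

/-- The mean `E[x₁]` of a document. -/
def popMean (α : Fin k → ℝ) (O : Matrix (Fin d) (Fin k) ℝ) (a : Fin d) : ℝ :=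
  (α ⬝ᵥ O a) / ∑ i, α i

/-- The second moment `E[x₁ ⊗ x₂]` of a document. -/
def popSecond (α : Fin k → ℝ) (O : Matrix (Fin d) (Fin k) ℝ) (a b : Fin d) : ℝ :=
  ((α ⬝ᵥ O a) * (α ⬝ᵥ O b) + α ⬝ᵥ (O a * O b)) / ((∑ i, α i) * (∑ i, α i + 1))

/-- The third moment `E[x₁ ⊗ x₂ ⊗ x₃]` of a document. -/
def popThird (α : Fin k → ℝ) (O : Matrix (Fin d) (Fin k) ℝ) (a b c : Fin d) : ℝ :=
  ((α ⬝ᵥ O a) * (α ⬝ᵥ O b) * (α ⬝ᵥ O c) + (α ⬝ᵥ O a) * (α ⬝ᵥ (O b * O c)) +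
      (α ⬝ᵥ O b) * (α ⬝ᵥ (O a * O c)) + (α ⬝ᵥ O c) * (α ⬝ᵥ (O a * O b)) +
      2 * α ⬝ᵥ (O a * O b * O c)) /
    ((∑ i, α i) * (∑ i, α i + 1) * (∑ i, α i + 2))

lemma sum_dotProduct_row (hO : IsTopicMatrix O) : ∑ a, α ⬝ᵥ O a = ∑ i, α i := by
  simp only [dotProduct]
  rw [Finset.sum_comm]
  simp only [← Finset.mul_sum, hO.sum_col, mul_one]

lemma sum_dotProduct_mul_row (hO : IsTopicMatrix O) (y : Fin k → ℝ) :
    ∑ a, α ⬝ᵥ (y * O a) = α ⬝ᵥ y := by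
  simp only [dotProduct, Pi.mul_apply]
  rw [Finset.sum_comm]
  simp only [← Finset.mul_sum, hO.sum_col, mul_one]

lemma sum_popThird [NeZero k] (hα : ∀ i, 0 < α i) (hO : IsTopicMatrix O) (a b : Fin d) :
    ∑ c, popThird α O a b c = popSecond α O a b := by
  have hs : 0 < ∑ i, α i := Finset.sum_pos (fun i _ => hα i) Finset.univ_nonempty
  simp only [popThird, popSecond, ← Finset.sum_div, Finset.sum_add_distrib, ← Finset.mul_sum,
    ← Finset.sum_mul, sum_dotProduct_row hO, sum_dotProduct_mul_row hO]
  field_simp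
  ring

lemma sum_popSecond [NeZero k] (hα : ∀ i, 0 < α i) (hO : IsTopicMatrix O) (a : Fin d) :
    ∑ b, popSecond α O a b = popMean α O a := by
  have hs : 0 < ∑ i, α i := Finset.sum_pos (fun i _ => hα i) Finset.univ_nonempty
  simp only [popSecond, popMean, ← Finset.sum_div, Finset.sum_add_distrib, ← Finset.mul_sum,
    sum_dotProduct_row hO, sum_dotProduct_mul_row hO]
  field_simp

lemma popSecond_sub [NeZero k] (hα : ∀ i, 0 < α i) (a b : Fin d) :
    popSecond α O a b - (∑ i, α i) / (∑ i, α i + 1) * (popMean α O a * popMean α O b) =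
      α ⬝ᵥ (O a * O b) / ((∑ i, α i) * (∑ i, α i + 1)) := by
  have hs : 0 < ∑ i, α i := Finset.sum_pos (fun i _ => hα i) Finset.univ_nonempty
  rw [popSecond, popMean, popMean]
  field_simp
  ring

lemma popThird_sub [NeZero k] (hα : ∀ i, 0 < α i) (a b c : Fin d) :
    popThird α O a b c - (∑ i, α i) / (∑ i, α i + 2) *
        (popSecond α O a c * popMean α O b + popMean α O a * popSecond α O c b +
          popMean α O c * popSecond α O a b) +
      2 * (∑ i, α i) ^ 2 / ((∑ i, α i + 2) * (∑ i, α i + 1)) *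
        (popMean α O c * (popMean α O a * popMean α O b)) =
      2 * α ⬝ᵥ (O a * O b * O c) / ((∑ i, α i) * (∑ i, α i + 1) * (∑ i, α i + 2)) := by
  have hs : 0 < ∑ i, α i := Finset.sum_pos (fun i _ => hα i) Finset.univ_nonempty
  simp only [popThird, popSecond, popMean, mul_comm (O c) (O b)]
  field_simp
  ring

variable [NeZero k] (hα : ∀ i, 0 < α i) (hO : IsTopicMatrix O)
include hα hO

lemma lintegral_prod_words (w : Fin 3 → Fin d) :
    ∫⁻ h, ∏ v, ENNReal.ofReal (∑ i, h i * O (w v) i) ∂(dirichlet α) =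
      ENNReal.ofReal (popThird α O (w 0) (w 1) (w 2)) := by
  have hnonneg : ∀ᵐ h ∂(dirichlet α), ∀ v, 0 ≤ h ⬝ᵥ O (w v) := by
    filter_upwards [ae_dirichlet_mem_Ioc α] with h hh v
    exact Finset.sum_nonneg fun i _ => mul_nonneg (hh i).1.le (hO.nonneg _ _)
  rw [popThird, ← integral_dotProduct_three_dirichlet hα,
    ofReal_integral_eq_lintegral_ofReal (integrable_dirichlet hα (by fun_prop)) (by
      filter_upwards [hnonneg] with h hh
      exact mul_nonneg (hh 0) (mul_nonneg (hh 1) (hh 2)))]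
  refine lintegral_congr_ae ?_
  filter_upwards [hnonneg] with h hh
  rw [Fin.prod_univ_three, ENNReal.ofReal_mul (hh 0), ENNReal.ofReal_mul (hh 1), mul_assoc]
  rfl

lemma popThird_nonneg (a b c : Fin d) : 0 ≤ popThird α O a b c := by
  rw [popThird, ← integral_dotProduct_three_dirichlet hα]
  refine integral_nonneg_of_ae ?_
  filter_upwards [ae_dirichlet_mem_Ioc α] with h hh
  have hnonneg (a : Fin d) : 0 ≤ h ⬝ᵥ O a :=
    Finset.sum_nonneg fun i _ => mul_nonneg (hh i).1.le (hO.nonneg _ _)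
  exact mul_nonneg (hnonneg a) (mul_nonneg (hnonneg b) (hnonneg c))

lemma documentLaw_real (s : Finset (Fin 3 → Fin d)) :
    (documentLaw α O).real s = ∑ w ∈ s, popThird α O (w 0) (w 1) (w 2) := by
  classical
  simp only [Measure.real, documentLaw, lintegral_prod_words hα hO, Measure.coe_finsetSum,
    Finset.sum_apply, Measure.smul_apply, smul_eq_mul,
    Measure.dirac_apply' _ s.finite_toSet.measurableSet, Set.indicator_apply, Finset.mem_coe,
    Pi.one_apply, mul_ite, mul_one, mul_zero, Finset.sum_ite_mem, Finset.univ_inter]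
  rw [← ENNReal.ofReal_sum_of_nonneg fun w _ => popThird_nonneg hα hO _ _ _,
    ENNReal.toReal_ofReal (Finset.sum_nonneg fun w _ => popThird_nonneg hα hO _ _ _)]

lemma documentLaw_real_words (a b c : Fin d) :
    (documentLaw α O).real {w | (w 0, w 1, w 2) = (a, b, c)} = popThird α O a b c := by
  have hset : {w : Fin 3 → Fin d | (w 0, w 1, w 2) = (a, b, c)} =
      ({![a, b, c]} : Finset (Fin 3 → Fin d)) := by
    ext w
    simp [funext_iff, Fin.forall_fin_succ]
  rw [hset, documentLaw_real hα hO]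
  simp

lemma documentLaw_real_first_two_words (a b : Fin d) :
    (documentLaw α O).real {w | (w 0, w 1) = (a, b)} = popSecond α O a b := by
  have hset : {w : Fin 3 → Fin d | (w 0, w 1) = (a, b)} =
      (Finset.univ.filter fun w : Fin 3 → Fin d => (w 0, w 1) = (a, b) : Finset _) := by simp
  rw [hset, documentLaw_real hα hO, ← sum_popThird hα hO]
  refine Finset.sum_nbij' (fun w => w 2) (fun c => ![a, b, c]) ?_ ?_ ?_ ?_ ?_ <;>
    simp +contextual [funext_iff, Fin.forall_fin_succ, eq_comm]

lemma documentLaw_real_first_word (a : Fin d) :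
    (documentLaw α O).real {w | w 0 = a} = popMean α O a := by
  have hset : {w : Fin 3 → Fin d | w 0 = a} =
      (Finset.univ.filter fun w : Fin 3 → Fin d => w 0 = a : Finset _) := by simp
  rw [hset, documentLaw_real hα hO, ← sum_popSecond hα hO]
  simp only [← sum_popThird hα hO, ← Fintype.sum_prod_type']
  refine Finset.sum_nbij' (fun w => (w 1, w 2)) (fun p => ![a, p.1, p.2]) ?_ ?_ ?_ ?_ ?_ <;>
    simp +contextual [funext_iff, Fin.forall_fin_succ, eq_comm]

end DocumentLaw

local notation "‖" x "‖₂" => ‖WithLp.toLp 2 x‖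

/-! ### Bounded differences -/

section BoundedDifferences

open scoped NNReal

variable {S T : Type*}

lemma abs_sub_le_of_abs_update_sub_le {N : ℕ} {f : (Fin N → S) → ℝ} {c : ℝ}
    (hc : ∀ x n s, |f (Function.update x n s) - f x| ≤ c) (x y : Fin N → S) :
    |f x - f y| ≤ N * c := by
  induction N with
  | zero => simp [Subsingleton.elim x y]
  | succ N ih =>
    have htail := ih (f := fun z => f (Fin.cons (x 0) z))
      (fun z n s => by rw [Fin.cons_update]; exact hc _ _ _) (Fin.tail x) (Fin.tail y)
    have hhead := hc y 0 (x 0)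
    rw [← Fin.cons_self_tail y, Fin.update_cons_zero] at hhead
    simp only [Fin.cons_self_tail] at htail hhead
    push_cast
    linarith [abs_sub_le (f x) (f (Fin.cons (x 0) (Fin.tail y))) (f y)]

lemma sum_update_sub_sum {E : Type*} [AddCommGroup E] {N : ℕ} (Y : S → E) (x : Fin N → S)
    (n : Fin N) (s : S) : ∑ m, Y (Function.update x n s m) - ∑ m, Y (x m) = Y s - Y (x n) := by
  rw [← Finset.sum_sub_distrib, Finset.sum_eq_single n]
  · simp
  · intro m _ hm
    simp [Function.update_of_ne hm]
  · simp

variable [MeasurableSpace S] [MeasurableSpace T]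

lemma hasSubgaussianMGF_of_abs_sub_le {μ : Measure S} [IsProbabilityMeasure μ] {X : S → ℝ}
    (hX : Measurable X) {c : ℝ≥0} (hc : ∀ s t, |X s - X t| ≤ c) :
    HasSubgaussianMGF (fun s => X s - ∫ t, X t ∂μ) ((c / 2) ^ 2) μ := by
  obtain ⟨s₀⟩ : Nonempty S := μ.nonempty_of_neZero
  have hbdd : BddBelow (Set.range X) := ⟨X s₀ - c, by
    rintro _ ⟨s, rfl⟩; linarith [(abs_le.1 (hc s s₀)).1]⟩
  have : Nonempty S := ⟨s₀⟩
  have hmem : ∀ s, X s ∈ Set.Icc (⨅ t, X t) ((⨅ t, X t) + c) := fun s =>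
    ⟨ciInf_le hbdd s, by
      have : X s - c ≤ ⨅ t, X t := le_ciInf fun t => by linarith [(abs_le.1 (hc s t)).2]
      linarith⟩
  simpa using hasSubgaussianMGF_of_mem_Icc hX.aemeasurable (ae_of_all μ hmem)

lemma hasSubgaussianMGF_prod {μ : Measure S} {ν : Measure T} [IsProbabilityMeasure μ]
    [IsProbabilityMeasure ν] {f : S × T → ℝ} (hf : Measurable f) {a b : ℝ}
    (hab : ∀ p, f p ∈ Set.Icc a b) {c₁ c₂ : ℝ≥0}
    (h₁ : HasSubgaussianMGF (fun s => ∫ t, f (s, t) ∂ν - ∫ p, f p ∂μ.prod ν) c₁ μ)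
    (h₂ : ∀ s, HasSubgaussianMGF (fun t => f (s, t) - ∫ t', f (s, t') ∂ν) c₂ ν) :
    HasSubgaussianMGF (fun p => f p - ∫ q, f q ∂μ.prod ν) (c₁ + c₂) (μ.prod ν) := by
  set m := ∫ q, f q ∂μ.prod ν
  have hint : ∀ t, Integrable (fun p => Real.exp (t * (f p - m))) (μ.prod ν) := fun t =>
    integrable_exp_mul_of_mem_Icc (hf.sub_const m).aemeasurable
      (ae_of_all _ fun p => ⟨sub_le_sub_right (hab p).1 m, sub_le_sub_right (hab p).2 m⟩)
  refine ⟨hint, fun t => ?_⟩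
  have hfibre : ∀ s, ∫ y, Real.exp (t * (f (s, y) - m)) ∂ν ≤
      Real.exp (t * (∫ y, f (s, y) ∂ν - m)) * Real.exp (c₂ * t ^ 2 / 2) := fun s => by
    calc ∫ y, Real.exp (t * (f (s, y) - m)) ∂ν
        = Real.exp (t * (∫ y, f (s, y) ∂ν - m)) *
            mgf (fun y => f (s, y) - ∫ y', f (s, y') ∂ν) ν t := by
          rw [mgf, ← integral_const_mul]
          congr 1 with y
          rw [← Real.exp_add]
          ring_nf
      _ ≤ _ := by gcongr; exact (h₂ s).mgf_le t
  calc mgf (fun p => f p - m) (μ.prod ν) t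
      = ∫ s, ∫ y, Real.exp (t * (f (s, y) - m)) ∂ν ∂μ := integral_prod _ (hint t)
    _ ≤ ∫ s, Real.exp (t * (∫ y, f (s, y) ∂ν - m)) * Real.exp (c₂ * t ^ 2 / 2) ∂μ :=
        integral_mono (hint t).integral_prod_left ((h₁.integrable_exp_mul t).mul_const _) hfibre
    _ ≤ Real.exp (c₁ * t ^ 2 / 2) * Real.exp (c₂ * t ^ 2 / 2) := by
        rw [integral_mul_const]
        gcongr
        exact h₁.mgf_le t
    _ = Real.exp (↑(c₁ + c₂) * t ^ 2 / 2) := by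
        rw [← Real.exp_add, NNReal.coe_add]
        ring_nf

lemma hasSubgaussianMGF_prod_of_abs_sub_le {μ : Measure S} {ν : Measure T}
    [IsProbabilityMeasure μ] [IsProbabilityMeasure ν] {f : S × T → ℝ} (hf : Measurable f) {a b : ℝ}
    (hab : ∀ p, f p ∈ Set.Icc a b) {c₁ c₂ : ℝ≥0} (h₁ : ∀ s s' t, |f (s, t) - f (s', t)| ≤ c₁)
    (h₂ : ∀ s, HasSubgaussianMGF (fun t => f (s, t) - ∫ t', f (s, t') ∂ν) c₂ ν) :
    HasSubgaussianMGF (fun p => f p - ∫ q, f q ∂μ.prod ν) ((c₁ / 2) ^ 2 + c₂) (μ.prod ν) := by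
  have hint : ∀ s, Integrable (fun t => f (s, t)) ν := fun s =>
    .of_mem_Icc a b (hf.comp measurable_prodMk_left).aemeasurable (ae_of_all _ fun t => hab _)
  have hosc : ∀ s s', |∫ t, f (s, t) ∂ν - ∫ t, f (s', t) ∂ν| ≤ c₁ := fun s s' => by
    rw [← integral_sub (hint s) (hint s')]
    simpa using norm_integral_le_of_norm_le_const (μ := ν)
      (ae_of_all _ fun t => (Real.norm_eq_abs _).trans_le (h₁ s s' t))
  have hmean : ∫ s, ∫ t, f (s, t) ∂ν ∂μ = ∫ p, f p ∂μ.prod ν :=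
    (integral_prod _ (.of_mem_Icc a b hf.aemeasurable (ae_of_all _ hab))).symm
  have hmeas : Measurable fun s => ∫ t, f (s, t) ∂ν :=
    hf.stronglyMeasurable.integral_prod_right'.measurable
  exact hasSubgaussianMGF_prod hf hab (hmean ▸ hasSubgaussianMGF_of_abs_sub_le hmeas hosc) h₂

/-- McDiarmid's inequality, at the level of moment generating functions. -/
lemma hasSubgaussianMGF_of_abs_update_sub_le (μ : Measure S) [IsProbabilityMeasure μ] {N : ℕ}
    {f : (Fin N → S) → ℝ} (hf : Measurable f) {c : ℝ≥0}
    (hc : ∀ x n s, |f (Function.update x n s) - f x| ≤ c) :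
    HasSubgaussianMGF (fun x => f x - ∫ y, f y ∂Measure.pi fun _ => μ) (N * (c / 2) ^ 2)
      (Measure.pi fun _ => μ) := by
  obtain ⟨s₀⟩ : Nonempty S := μ.nonempty_of_neZero
  induction N with
  | zero =>
    have hconst : f = fun _ => f fun _ => s₀ := funext fun x =>
      congrArg f (Subsingleton.elim _ _)
    rw [hconst]
    simp
  | succ N ih =>
    let e := MeasurableEquiv.piFinSuccAbove (fun _ : Fin (N + 1) => S) 0
    have he : MeasurePreserving e (Measure.pi fun _ => μ) (μ.prod (Measure.pi fun _ => μ)) :=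
      measurePreserving_piFinSuccAbove (fun _ => μ) 0
    have hcons : ∀ s x, e.symm (s, x) = Fin.cons s x := fun s x => Fin.insertNth_zero' s x
    have hfe : Measurable fun p => f (e.symm p) := hf.comp e.symm.measurable
    have hosc := abs_sub_le_of_abs_update_sub_le hc (fun _ => s₀)
    have hmem : ∀ p, f (e.symm p) ∈ Set.Icc (f (fun _ => s₀) - (N + 1 : ℕ) * c)
        (f (fun _ => s₀) + (N + 1 : ℕ) * c) := fun p =>
      ⟨by linarith [(abs_le.1 (hosc (e.symm p))).2], by linarith [(abs_le.1 (hosc (e.symm p))).1]⟩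
    have hprod := hasSubgaussianMGF_prod_of_abs_sub_le (μ := μ) hfe hmem (c₁ := c)
      (fun s s' x => by
        simpa only [hcons, Fin.update_cons_zero] using hc (Fin.cons s' x) 0 s)
      (fun s => ih (hfe.comp measurable_prodMk_left) fun x n t => by
        simp only [hcons, Fin.cons_update]; exact hc _ _ _)
    rw [← he.map_eq] at hprod
    convert! HasSubgaussianMGF.of_map e.measurable.aemeasurable hprod using 1
    · funext x
      rw [integral_map e.measurable.aemeasurable hfe.aestronglyMeasurable]
      simp
    · push_cast; ring

end BoundedDifferences

section EmpiricalMean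

variable {S ι : Type*} [MeasurableSpace S] [Fintype ι] {μ : Measure S} [IsProbabilityMeasure μ]
  {Y : S → EuclideanSpace ℝ ι} {B : ℝ} {N : ℕ}

lemma memLp_empiricalMean {E : Type*} [NormedAddCommGroup E] [NormedSpace ℝ E] {X : S → E}
    (hX : MemLp X 2 μ) (N : ℕ) :
    MemLp (fun x => (N : ℝ)⁻¹ • ∑ n, X (x n)) 2 (Measure.pi fun _ : Fin N => μ) :=
  (memLp_finsetSum _ fun n _ =>
    hX.comp_measurePreserving (measurePreserving_eval (fun _ => μ) n)).const_smul _

lemma variance_empiricalMean {X : S → ℝ} (hX : MemLp X 2 μ) (N : ℕ) :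
    Var[fun x => (N : ℝ)⁻¹ • ∑ n, X (x n); Measure.pi fun _ : Fin N => μ] = Var[X; μ] / N := by
  have hsum : (fun x : Fin N → S => ∑ n, X (x n)) = ∑ n, fun x => X (x n) := by
    ext x; simp
  simp only [smul_eq_mul]
  rw [variance_const_mul, hsum, variance_sum_pi fun _ => hX]
  rcases N.eq_zero_or_pos with rfl | hN
  · simp
  · simp only [Finset.sum_const, Finset.card_univ, Fintype.card_fin, nsmul_eq_mul]
    field_simp

lemma integral_empiricalMean {X : S → ℝ} (hX : Integrable X μ) (hN : 0 < N) :
    ∫ x, (N : ℝ)⁻¹ • ∑ n, X (x n) ∂(Measure.pi fun _ : Fin N => μ) = ∫ s, X s ∂μ := by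
  rw [integral_smul, integral_finsetSum _ fun n _ => integrable_comp_eval hX]
  have heval : ∀ n, ∫ x, X (x n) ∂(Measure.pi fun _ : Fin N => μ) = ∫ s, X s ∂μ := fun n =>
    integral_comp_eval (μ := fun _ : Fin N => μ) hX.aestronglyMeasurable
  simp only [heval, Finset.sum_const, Finset.card_univ, Fintype.card_fin, nsmul_eq_mul,
    smul_eq_mul]
  field_simp

lemma integral_norm_sq_empiricalMean_sub_le (hY : Measurable Y) (hB : ∀ s, ‖Y s‖ ≤ B)
    (hN : 0 < N) :
    ∫ x, ‖(N : ℝ)⁻¹ • ∑ n, Y (x n) - ∫ s, Y s ∂μ‖ ^ 2 ∂(Measure.pi fun _ : Fin N => μ) ≤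
      B ^ 2 / N := by
  have hmem : MemLp Y 2 μ := .of_bound hY.aestronglyMeasurable B (ae_of_all _ hB)
  have hcoord : ∀ a, MemLp (fun s => Y s a) 2 μ := fun a =>
    .of_bound (by fun_prop) B (ae_of_all _ fun s => (PiLp.norm_apply_le (Y s) a).trans (hB s))
  have hmean : ∀ a, (∫ s, Y s ∂μ) a = ∫ s, Y s a ∂μ := fun a =>
    ((EuclideanSpace.proj (𝕜 := ℝ) a).integral_comp_comm (hmem.integrable one_le_two)).symm
  have hvar : ∀ a, ∫ x, ((N : ℝ)⁻¹ • ∑ n, Y (x n) a - ∫ s, Y s a ∂μ) ^ 2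
      ∂(Measure.pi fun _ : Fin N => μ) = Var[fun s => Y s a; μ] / N := fun a => by
    rw [← variance_empiricalMean (hcoord a), variance_eq_integral
      (memLp_empiricalMean (hcoord a) N).aemeasurable,
      integral_empiricalMean ((hcoord a).integrable one_le_two) hN]
  calc ∫ x, ‖(N : ℝ)⁻¹ • ∑ n, Y (x n) - ∫ s, Y s ∂μ‖ ^ 2 ∂(Measure.pi fun _ : Fin N => μ)
      = ∑ a, Var[fun s => Y s a; μ] / N := by
        simp only [EuclideanSpace.real_norm_sq_eq, PiLp.sub_apply, PiLp.smul_apply, hmean,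
          WithLp.ofLp_sum, Finset.sum_apply]
        rw [integral_finsetSum _ fun a _ => ?_]
        · exact Finset.sum_congr rfl fun a _ => hvar a
        · exact ((memLp_empiricalMean (hcoord a) N).sub (memLp_const _)).integrable_sq
    _ ≤ ∑ a, (∫ s, Y s a ^ 2 ∂μ) / N := by
        gcongr with a
        exact variance_le_expectation_sq (by fun_prop)
    _ = (∫ s, ‖Y s‖ ^ 2 ∂μ) / N := by
        simp only [EuclideanSpace.real_norm_sq_eq]
        rw [integral_finsetSum _ fun a _ => (hcoord a).integrable_sq, Finset.sum_div]
    _ ≤ B ^ 2 / N := by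
        gcongr
        have h := integral_mono hmem.norm.integrable_sq (integrable_const (B ^ 2)) fun s =>
          pow_le_pow_left₀ (norm_nonneg (Y s)) (hB s) 2
        simpa using h

lemma integral_norm_empiricalMean_sub_le (hY : Measurable Y) (hB : ∀ s, ‖Y s‖ ≤ B) (hN : 0 < N) :
    ∫ x, ‖(N : ℝ)⁻¹ • ∑ n, Y (x n) - ∫ s, Y s ∂μ‖ ∂(Measure.pi fun _ : Fin N => μ) ≤ B / √N := by
  obtain ⟨s₀⟩ : Nonempty S := μ.nonempty_of_neZero
  have hB0 : 0 ≤ B := (norm_nonneg _).trans (hB s₀)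
  have hmem : MemLp (fun x => ‖(N : ℝ)⁻¹ • ∑ n, Y (x n) - ∫ s, Y s ∂μ‖) 2
      (Measure.pi fun _ : Fin N => μ) :=
    ((memLp_empiricalMean (.of_bound hY.aestronglyMeasurable B (ae_of_all _ hB)) N).sub
      (memLp_const _)).norm
  have hvar := variance_nonneg (fun x => ‖(N : ℝ)⁻¹ • ∑ n, Y (x n) - ∫ s, Y s ∂μ‖)
    (Measure.pi fun _ : Fin N => μ)
  rw [variance_eq_sub hmem, sub_nonneg] at hvar
  refine abs_le_of_sq_le_sq' ?_ (by positivity) |>.2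
  calc _ ≤ _ := hvar
    _ ≤ B ^ 2 / N := integral_norm_sq_empiricalMean_sub_le hY hB hN
    _ = (B / √N) ^ 2 := by rw [div_pow, Real.sq_sqrt N.cast_nonneg]

lemma measureReal_norm_empiricalMean_sub_ge_le (hY : Measurable Y) (hB : ∀ s, ‖Y s‖ ≤ B) {D : ℝ}
    (hD : ∀ s t, ‖Y s - Y t‖ ≤ D) (hN : 0 < N) {r : ℝ} (hr : 0 ≤ r) :
    (Measure.pi fun _ : Fin N => μ).real
      {x | B / √N + r ≤ ‖(N : ℝ)⁻¹ • ∑ n, Y (x n) - ∫ s, Y s ∂μ‖} ≤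
        Real.exp (-(2 * N * r ^ 2 / D ^ 2)) := by
  obtain ⟨s₀⟩ : Nonempty S := μ.nonempty_of_neZero
  lift D to NNReal using (norm_nonneg _).trans (hD s₀ s₀)
  have hdiff : ∀ (x : Fin N → S) n s, |‖(N : ℝ)⁻¹ • ∑ m, Y (Function.update x n s m) -
      ∫ s, Y s ∂μ‖ - ‖(N : ℝ)⁻¹ • ∑ m, Y (x m) - ∫ s, Y s ∂μ‖| ≤ (D / N : NNReal) := by
    intro x n s
    refine (abs_norm_sub_norm_le _ _).trans ?_
    rw [sub_sub_sub_cancel_right, ← smul_sub, sum_update_sub_sum, norm_smul, norm_inv,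
      Real.norm_natCast, NNReal.coe_div, NNReal.coe_natCast, inv_mul_eq_div]
    gcongr
    exact hD _ _
  have hmcd := hasSubgaussianMGF_of_abs_update_sub_le μ
    (f := fun x : Fin N → S => ‖(N : ℝ)⁻¹ • ∑ n, Y (x n) - ∫ s, Y s ∂μ‖) (by fun_prop) hdiff
  calc _ ≤ (Measure.pi fun _ : Fin N => μ).real {x | r ≤ ‖(N : ℝ)⁻¹ • ∑ n, Y (x n) - ∫ s, Y s ∂μ‖ -
        ∫ y, ‖(N : ℝ)⁻¹ • ∑ n, Y (y n) - ∫ s, Y s ∂μ‖ ∂Measure.pi fun _ => μ} := by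
        refine measureReal_mono (fun x hx => ?_) (measure_ne_top _ _)
        simp only [Set.mem_ofPred_eq] at hx ⊢
        linarith [integral_norm_empiricalMean_sub_le (μ := μ) hY hB hN]
    _ ≤ _ := hmcd.measure_ge_le hr
    _ = _ := by
        push_cast
        congr 1
        field_simp

end EmpiricalMean

/-! ### Label frequencies -/

section Frequencies

variable {S ι : Type*} [MeasurableSpace S] [DecidableEq ι] {N : ℕ}

/-- The empirical frequencies of the labels `g (x n)` of a sample `x`. -/
def freq (g : S → ι) (x : Fin N → S) : ι → ℝ :=
  (N : ℝ)⁻¹ • ∑ n, Pi.single (g (x n)) 1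

/-- The probabilities of the labels `g s` of a random point `s` of law `ν`. -/
def labelProb (ν : Measure S) (g : S → ι) (a : ι) : ℝ :=
  ν.real {s | g s = a}

variable [Fintype ι]

lemma norm_single_sub_single_le (a b : ι) :
    ‖EuclideanSpace.single a (1 : ℝ) - EuclideanSpace.single b 1‖ ≤ √2 := by
  rcases eq_or_ne a b with rfl | hab
  · simp
  · refine (Real.sqrt_le_sqrt (le_of_eq ?_)).trans' (Real.sqrt_sq (norm_nonneg _)).ge
    rw [norm_sub_sq_real, EuclideanSpace.inner_single_left]
    simp [hab]
    norm_num

variable [MeasurableSpace ι] [DiscreteMeasurableSpace ι]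

lemma integral_single_label (ν : Measure S) [IsProbabilityMeasure ν] {g : S → ι}
    (hg : Measurable g) :
    ∫ s, EuclideanSpace.single (g s) (1 : ℝ) ∂ν = WithLp.toLp 2 (labelProb ν g) := by
  have hint : Integrable (fun s => EuclideanSpace.single (g s) (1 : ℝ)) ν :=
    Integrable.of_bound (((Measurable.of_discrete
      (f := fun a : ι => EuclideanSpace.single a (1 : ℝ))).comp hg).aestronglyMeasurable) 1
      (ae_of_all _ fun s => by simp)
  ext a
  have hind (s : S) : EuclideanSpace.proj a (EuclideanSpace.single (g s) (1 : ℝ)) =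
      (g ⁻¹' {a}).indicator (1 : S → ℝ) s := by
    by_cases h : g s = a <;> simp [h, eq_comm (a := a)]
  calc (∫ s, EuclideanSpace.single (g s) (1 : ℝ) ∂ν) a
      = ∫ s, EuclideanSpace.proj a (EuclideanSpace.single (g s) (1 : ℝ)) ∂ν :=
        ((EuclideanSpace.proj (𝕜 := ℝ) a).integral_comp_comm hint).symm
    _ = labelProb ν g a := by
        simp only [hind]
        exact integral_indicator_one (hg (measurableSet_singleton a))

lemma measureReal_norm_freq_sub_ge_le (ν : Measure S) [IsProbabilityMeasure ν] {g : S → ι}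
    (hg : Measurable g) (hN : 0 < N) {r : ℝ} (hr : 0 ≤ r) :
    (Measure.pi fun _ : Fin N => ν).real {x | 1 / √N + r ≤ ‖freq g x - labelProb ν g‖₂} ≤
      Real.exp (-(N * r ^ 2)) := by
  have hY : Measurable fun s => EuclideanSpace.single (g s) (1 : ℝ) :=
    (Measurable.of_discrete (f := fun a : ι => EuclideanSpace.single a (1 : ℝ))).comp hg
  have hfreq (x : Fin N → S) : WithLp.toLp 2 (freq g x - labelProb ν g) =
      (N : ℝ)⁻¹ • ∑ n, EuclideanSpace.single (g (x n)) (1 : ℝ) -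
        ∫ s, EuclideanSpace.single (g s) (1 : ℝ) ∂ν := by
    rw [integral_single_label ν hg, freq]
    simp
  have hexp : 2 * N * r ^ 2 / √2 ^ 2 = N * r ^ 2 := by
    rw [Real.sq_sqrt zero_le_two]
    ring
  have hdev := measureReal_norm_empiricalMean_sub_ge_le (μ := ν) hY (B := 1) (fun s => by simp)
    (fun s t => norm_single_sub_single_le (g s) (g t)) hN hr
  simpa only [hfreq, hexp] using hdev

lemma measureReal_freq_error_lt {Ω : Type*} [MeasurableSpace Ω] {P : Measure Ω}
    [IsProbabilityMeasure P] {X : Fin N → Ω → S} (hX : ∀ n, Measurable (X n)) {ν : Measure S}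
    (hlaw : ∀ n, P.map (X n) = ν) (hindep : iIndepFun X P) {g : S → ι} (hg : Measurable g)
    (hN : 0 < N) {δ : ℝ} (hδ₀ : 0 < δ) (hδ₁ : δ < 1) :
    P.real {ω | 6 / 5 * (1 + √(Real.log (1 / δ))) / √N <
      ‖freq g (fun n => X n ω) - labelProb ν g‖₂} < δ := by
  have hν : IsProbabilityMeasure ν :=
    hlaw ⟨0, hN⟩ ▸ Measure.isProbabilityMeasure_map (hX _).aemeasurable
  have hN' : (0 : ℝ) < N := by exact_mod_cast hN
  set ℓ := √(Real.log (1 / δ))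
  have hℓ2 : ℓ ^ 2 = Real.log (1 / δ) :=
    Real.sq_sqrt (Real.log_nonneg (by rw [le_div_iff₀ hδ₀]; linarith))
  set r := (1 / 5 + 6 / 5 * ℓ) / √N with hr
  have hr0 : 0 ≤ r := by positivity
  have hsplit : 6 / 5 * (1 + ℓ) / √N = 1 / √N + r := by rw [hr]; ring
  have hmap : P.map (fun ω n => X n ω) = Measure.pi fun _ => ν := by
    rw [hindep.map_fun_eq_pi_map fun n => (hX n).aemeasurable]
    simp only [hlaw]
  have hfreq : Measurable fun x : Fin N → S => ‖freq g x - labelProb ν g‖₂ := by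
    have hsum : Measurable fun y : Fin N → ι =>
        ‖(N : ℝ)⁻¹ • (∑ n, Pi.single (y n) 1) - labelProb ν g‖₂ := .of_discrete
    exact hsum.comp (measurable_pi_lambda _ fun n => hg.comp (measurable_pi_apply n))
  calc P.real {ω | 6 / 5 * (1 + ℓ) / √N < ‖freq g (fun n => X n ω) - labelProb ν g‖₂}
      ≤ (P.map fun ω n => X n ω).real {x | 1 / √N + r ≤ ‖freq g x - labelProb ν g‖₂} := by
        rw [map_measureReal_apply (measurable_pi_lambda _ hX)
          (measurableSet_le measurable_const hfreq), hsplit]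
        exact measureReal_mono (fun ω hω => (Set.mem_ofPred_eq ▸ hω : _ < _).le)
          (measure_ne_top _ _)
    _ ≤ Real.exp (-(N * r ^ 2)) := hmap ▸ measureReal_norm_freq_sub_ge_le ν hg hN hr0
    _ < Real.exp (-ℓ ^ 2) := by
        rw [hr, div_pow, Real.sq_sqrt hN'.le, mul_div_cancel₀ _ hN'.ne', Real.exp_lt_exp]
        nlinarith [Real.sqrt_nonneg (Real.log (1 / δ))]
    _ = δ := by rw [hℓ2, one_div, Real.log_inv, neg_neg, Real.exp_log hδ₀]

end Frequencies

section WordFrequencies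

variable {d k N : ℕ} {α : Fin k → ℝ} {O : Matrix (Fin d) (Fin k) ℝ}

/-- The empirical moments of the data `w` are within `E` of the population moments, in Euclidean
norm. -/
structure MomentsClose (α : Fin k → ℝ) (O : Matrix (Fin d) (Fin k) ℝ) (E : ℝ)
    (w : Fin N → Fin 3 → Fin d) : Prop where
  first : ‖freq (fun w => w 0) w - popMean α O‖₂ ≤ E
  second : ‖freq (fun w => (w 0, w 1)) w - fun p => popSecond α O p.1 p.2‖₂ ≤ E
  third : ‖freq (fun w => (w 0, w 1, w 2)) w - fun p => popThird α O p.1 p.2.1 p.2.2‖₂ ≤ E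

lemma measureReal_momentsClose_gt [NeZero k] (hα : ∀ i, 0 < α i) (hO : IsTopicMatrix O)
    {Ω : Type*} [MeasurableSpace Ω] {P : Measure Ω} [IsProbabilityMeasure P]
    {X : Fin N → Ω → Fin 3 → Fin d} (hX : ∀ n, Measurable (X n))
    (hlaw : ∀ n, P.map (X n) = documentLaw α O) (hindep : iIndepFun X P)
    (hN : 0 < N) {δ : ℝ} (hδ₀ : 0 < δ) (hδ₁ : δ < 1) :
    1 - δ < P.real {ω | MomentsClose α O (6 / 5 * (1 + √(Real.log (3 / δ))) / √N)
      fun n => X n ω} := by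
  have hδ : 1 / (δ / 3) = 3 / δ := by field_simp
  have h₁ := measureReal_freq_error_lt hX hlaw hindep (g := fun w => w 0)
    .of_discrete hN (by positivity : 0 < δ / 3) (by linarith)
  have h₂ := measureReal_freq_error_lt hX hlaw hindep (g := fun w => (w 0, w 1))
    .of_discrete hN (by positivity : 0 < δ / 3) (by linarith)
  have h₃ := measureReal_freq_error_lt hX hlaw hindep (g := fun w => (w 0, w 1, w 2))
    .of_discrete hN (by positivity : 0 < δ / 3) (by linarith)
  have hfirst : labelProb (documentLaw α O) (fun w => w 0) = popMean α O :=
    funext fun a => documentLaw_real_first_word hα hO a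
  have hsecond : labelProb (documentLaw α O) (fun w => (w 0, w 1)) =
      fun p => popSecond α O p.1 p.2 :=
    funext fun p => documentLaw_real_first_two_words hα hO p.1 p.2
  have hthird : labelProb (documentLaw α O) (fun w => (w 0, w 1, w 2)) =
      fun p => popThird α O p.1 p.2.1 p.2.2 :=
    funext fun p => documentLaw_real_words hα hO p.1 p.2.1 p.2.2
  rw [hδ, hfirst] at h₁
  rw [hδ, hsecond] at h₂
  rw [hδ, hthird] at h₃
  set E := 6 / 5 * (1 + √(Real.log (3 / δ))) / √N
  have hcover : (Set.univ : Set Ω) ⊆ {ω | MomentsClose α O E fun n => X n ω} ∪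
      ({ω | E < ‖freq (fun w => w 0) (fun n => X n ω) - popMean α O‖₂} ∪
        ({ω | E < ‖freq (fun w => (w 0, w 1)) (fun n => X n ω) -
            fun p => popSecond α O p.1 p.2‖₂} ∪
          {ω | E < ‖freq (fun w => (w 0, w 1, w 2)) (fun n => X n ω) -
            fun p => popThird α O p.1 p.2.1 p.2.2‖₂})) := by
    intro ω _
    by_contra hω
    simp only [Set.mem_union, Set.mem_ofPred_eq, not_or, not_lt] at hω
    exact hω.1 ⟨hω.2.1, hω.2.2.1, hω.2.2.2⟩
  have hunion := (measureReal_mono (μ := P) hcover).trans <| (measureReal_union_le _ _).trans <|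
    add_le_add le_rfl <| (measureReal_union_le _ _).trans <|
      add_le_add le_rfl (measureReal_union_le _ _)
  rw [probReal_univ] at hunion
  linarith

end WordFrequencies

/-! ### Euclidean and operator norms -/

section EuclideanNorm

variable {ι ι' : Type*} [Fintype ι] [Fintype ι']

lemma norm_sq_eq_dotProduct (x : ι → ℝ) : ‖x‖₂ ^ 2 = x ⬝ᵥ x := by
  rw [EuclideanSpace.real_norm_sq_eq]
  exact Finset.sum_congr rfl fun i _ => sq _

lemma abs_dotProduct_le (x y : ι → ℝ) : |x ⬝ᵥ y| ≤ ‖x‖₂ * ‖y‖₂ := by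
  have h := abs_real_inner_le_norm (WithLp.toLp 2 x) (WithLp.toLp 2 y)
  rwa [EuclideanSpace.inner_toLp_toLp, star_trivial, dotProduct_comm] at h

lemma norm_le_one_of_sum_eq_one {x : ι → ℝ} (hx : ∀ i, 0 ≤ x i) (hsum : ∑ i, x i = 1) :
    ‖x‖₂ ≤ 1 := by
  rw [← sq_le_one_iff₀ (norm_nonneg _), EuclideanSpace.real_norm_sq_eq, ← hsum]
  refine Finset.sum_le_sum fun i _ => ?_
  have hi : x i ≤ 1 := hsum ▸ Finset.single_le_sum (fun i _ => hx i) (Finset.mem_univ i)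
  exact pow_le_of_le_one (hx i) hi two_ne_zero

lemma norm_tensor (f : ι → ℝ) (g : ι' → ℝ) :
    ‖fun p : ι × ι' => f p.1 * g p.2‖₂ = ‖f‖₂ * ‖g‖₂ := by
  simp only [EuclideanSpace.norm_eq, ← Real.sqrt_mul (Finset.sum_nonneg fun _ _ => sq_nonneg _),
    Fintype.sum_prod_type, Finset.sum_mul_sum, norm_mul, mul_pow]

end EuclideanNorm

section OperatorNorm

open scoped Matrix.Norms.L2Operator

variable {m n : Type*} [Fintype m] [Fintype n]

lemma dotProduct_mulVec_eq_transpose (A : Matrix m n ℝ) (x : m → ℝ) (y : n → ℝ) :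
    x ⬝ᵥ A *ᵥ y = (Aᵀ *ᵥ x) ⬝ᵥ y := by
  rw [Matrix.dotProduct_mulVec, Matrix.mulVec_transpose]

/-- The Frobenius norm of a matrix. Mathlib's is a norm instance, which would compete with the
operator norm. -/
def frobNorm (A : Matrix m n ℝ) : ℝ :=
  ‖fun p : m × n => A p.1 p.2‖₂

lemma frobNorm_nonneg (A : Matrix m n ℝ) : 0 ≤ frobNorm A :=
  norm_nonneg _

lemma frobNorm_add_le (A B : Matrix m n ℝ) : frobNorm (A + B) ≤ frobNorm A + frobNorm B :=
  norm_add_le (WithLp.toLp 2 fun p : m × n => A p.1 p.2) (.toLp 2 fun p => B p.1 p.2)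

lemma frobNorm_sub_le (A B : Matrix m n ℝ) : frobNorm (A - B) ≤ frobNorm A + frobNorm B :=
  norm_sub_le (WithLp.toLp 2 fun p : m × n => A p.1 p.2) (.toLp 2 fun p => B p.1 p.2)

lemma frobNorm_smul (c : ℝ) (A : Matrix m n ℝ) : frobNorm (c • A) = |c| * frobNorm A :=
  norm_smul c (WithLp.toLp 2 fun p : m × n => A p.1 p.2)

lemma frobNorm_sq (A : Matrix m n ℝ) : frobNorm A ^ 2 = (Aᵀ * A).trace := by
  rw [frobNorm, EuclideanSpace.real_norm_sq_eq, Fintype.sum_prod_type, Finset.sum_comm,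
    Matrix.trace]
  refine Finset.sum_congr rfl fun j _ => ?_
  rw [Matrix.diag_apply, Matrix.mul_apply]
  exact Finset.sum_congr rfl fun i _ => sq _

variable [DecidableEq n]

lemma norm_mulVec_le (A : Matrix m n ℝ) (x : n → ℝ) : ‖A *ᵥ x‖₂ ≤ ‖A‖ * ‖x‖₂ :=
  Matrix.l2_opNorm_mulVec A (WithLp.toLp 2 x)

lemma norm_col_le_opNorm (A : Matrix m n ℝ) (i : n) : ‖A.col i‖₂ ≤ ‖A‖ := by
  simpa [PiLp.toLp_single] using norm_mulVec_le A (Pi.single i 1)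

lemma opNorm_le_of_forall {A : Matrix m n ℝ} {c : ℝ} (hc : 0 ≤ c)
    (hA : ∀ x, ‖A *ᵥ x‖₂ ≤ c * ‖x‖₂) : ‖A‖ ≤ c := by
  rw [Matrix.l2_opNorm_def]
  exact ContinuousLinearMap.opNorm_le_bound _ hc fun x => hA x.ofLp

lemma abs_dotProduct_mulVec_le (A : Matrix m n ℝ) (x : m → ℝ) (y : n → ℝ) :
    |x ⬝ᵥ A *ᵥ y| ≤ ‖A‖ * (‖x‖₂ * ‖y‖₂) := by
  calc |x ⬝ᵥ A *ᵥ y| ≤ ‖x‖₂ * ‖A *ᵥ y‖₂ := abs_dotProduct_le _ _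
    _ ≤ ‖x‖₂ * (‖A‖ * ‖y‖₂) := by gcongr; exact norm_mulVec_le A y
    _ = ‖A‖ * (‖x‖₂ * ‖y‖₂) := by ring

lemma opNorm_le_frobNorm (A : Matrix m n ℝ) : ‖A‖ ≤ frobNorm A := by
  refine opNorm_le_of_forall (frobNorm_nonneg A) fun x => ?_
  rw [← sq_le_sq₀ (norm_nonneg _) (mul_nonneg (frobNorm_nonneg A) (norm_nonneg _)),
    mul_pow, frobNorm, EuclideanSpace.real_norm_sq_eq, EuclideanSpace.real_norm_sq_eq,
    Fintype.sum_prod_type, Finset.sum_mul]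
  refine Finset.sum_le_sum fun i _ => ?_
  have hrow : ((A *ᵥ x) i) ^ 2 ≤ (‖A i‖₂ * ‖x‖₂) ^ 2 :=
    sq_le_sq' (abs_le.1 (abs_dotProduct_le _ _)).1 (abs_le.1 (abs_dotProduct_le _ _)).2
  rwa [mul_pow, EuclideanSpace.real_norm_sq_eq] at hrow

lemma opNorm_diagonal_le {f : n → ℝ} {c : ℝ} (hc : 0 ≤ c) (hf : ∀ i, |f i| ≤ c) :
    ‖Matrix.diagonal f‖ ≤ c := by
  rw [Matrix.l2_opNorm_diagonal]
  exact (pi_norm_le_iff_of_nonneg hc).2 hf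

lemma norm_mulVec_of_transpose_mul_self {A : Matrix m n ℝ} (hA : Aᵀ * A = 1) (x : n → ℝ) :
    ‖A *ᵥ x‖₂ = ‖x‖₂ := by
  rw [← sq_eq_sq₀ (norm_nonneg _) (norm_nonneg _), norm_sq_eq_dotProduct, norm_sq_eq_dotProduct,
    dotProduct_mulVec_eq_transpose, Matrix.mulVec_mulVec, hA, Matrix.one_mulVec]

lemma opNorm_le_one_of_transpose_mul_self {A : Matrix m n ℝ} (hA : Aᵀ * A = 1) : ‖A‖ ≤ 1 :=
  opNorm_le_of_forall zero_le_one fun x => by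
    rw [norm_mulVec_of_transpose_mul_self hA, one_mul]

variable [DecidableEq m]

lemma opNorm_transpose (A : Matrix m n ℝ) : ‖Aᵀ‖ = ‖A‖ := by
  rw [← Matrix.conjTranspose_eq_transpose_of_trivial, Matrix.l2_opNorm_conjTranspose]

end OperatorNorm

/-! ### Modified moments -/

section ModifiedMoments

variable {d : ℕ}

/-- The modified second moment as a function of the mean `μ` and of the second moment `C`. -/
def modifiedPairs (α₀ : ℝ) (μ : Fin d → ℝ) (C : Matrix (Fin d) (Fin d) ℝ) :
    Matrix (Fin d) (Fin d) ℝ :=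
  C - (α₀ / (α₀ + 1)) • Matrix.vecMulVec μ μ

/-- The third-order tensor `q`, contracted with `η` in its last argument. -/
def contract (q : Fin d × Fin d × Fin d → ℝ) (η : Fin d → ℝ) : Matrix (Fin d) (Fin d) ℝ :=
  Matrix.of fun a b => ∑ c, q (a, b, c) * η c

/-- The modified third moment, contracted with `η`, as a function of the mean `μ`, of the second
moment `C` and of the third moment `q`. -/
def modifiedTriples (α₀ : ℝ) (μ : Fin d → ℝ) (C : Matrix (Fin d) (Fin d) ℝ)
    (q : Fin d × Fin d × Fin d → ℝ) (η : Fin d → ℝ) : Matrix (Fin d) (Fin d) ℝ :=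
  contract q η
    - (α₀ / (α₀ + 2)) •
      (Matrix.vecMulVec (C *ᵥ η) μ + Matrix.vecMulVec μ (η ᵥ* C) + (η ⬝ᵥ μ) • C)
    + (2 * α₀ ^ 2 / ((α₀ + 2) * (α₀ + 1))) • ((η ⬝ᵥ μ) • Matrix.vecMulVec μ μ)

variable {α₀ E : ℝ} {μ μ' : Fin d → ℝ} {C C' : Matrix (Fin d) (Fin d) ℝ}
  {q q' : Fin d × Fin d × Fin d → ℝ}

lemma abs_dotProduct_contract_mulVec_le (q : Fin d × Fin d × Fin d → ℝ) (η x y : Fin d → ℝ) :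
    |x ⬝ᵥ contract q η *ᵥ y| ≤ ‖q‖₂ * (‖x‖₂ * (‖y‖₂ * ‖η‖₂)) := by
  have hform : x ⬝ᵥ contract q η *ᵥ y =
      q ⬝ᵥ fun p => x p.1 * (y p.2.1 * η p.2.2) := by
    simp only [dotProduct, Matrix.mulVec, contract, Matrix.of_apply, Fintype.sum_prod_type,
      Finset.mul_sum, Finset.sum_mul]
    exact Finset.sum_congr rfl fun a _ => Finset.sum_congr rfl fun b _ =>
      Finset.sum_congr rfl fun c _ => by ring
  rw [hform, ← norm_tensor y η, ← norm_tensor x fun r : Fin d × Fin d => y r.1 * η r.2]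
  exact abs_dotProduct_le q _

lemma frobNorm_vecMulVec (u v : Fin d → ℝ) :
    frobNorm (Matrix.vecMulVec u v) = ‖u‖₂ * ‖v‖₂ :=
  norm_tensor u v

lemma frobNorm_modifiedPairs_sub_le (hα₀ : 0 ≤ α₀) (hμ : ‖μ‖₂ ≤ 1) (hμ' : ‖μ'‖₂ ≤ 1)
    (hdμ : ‖μ' - μ‖₂ ≤ E) (hdC : frobNorm (C' - C) ≤ E) :
    frobNorm (modifiedPairs α₀ μ' C' - modifiedPairs α₀ μ C) ≤ 3 * E := by
  have ha : α₀ / (α₀ + 1) ≤ 1 := div_le_one_of_le₀ (by linarith) (by linarith)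
  have hE : 0 ≤ E := (norm_nonneg _).trans hdμ
  have hsplit : modifiedPairs α₀ μ' C' - modifiedPairs α₀ μ C =
      (C' - C) - (α₀ / (α₀ + 1)) • (Matrix.vecMulVec (μ' - μ) μ' +
        Matrix.vecMulVec μ (μ' - μ)) := by
    rw [modifiedPairs, modifiedPairs, Matrix.sub_vecMulVec, Matrix.vecMulVec_sub,
      sub_add_sub_cancel, smul_sub]
    abel
  calc _ ≤ frobNorm (C' - C) + α₀ / (α₀ + 1) * (‖μ' - μ‖₂ * ‖μ'‖₂ + ‖μ‖₂ * ‖μ' - μ‖₂) := by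
        rw [hsplit, ← frobNorm_vecMulVec, ← frobNorm_vecMulVec]
        refine (frobNorm_sub_le _ _).trans (add_le_add le_rfl ?_)
        rw [frobNorm_smul, abs_of_nonneg (by positivity)]
        gcongr
        exact frobNorm_add_le _ _
    _ ≤ E + 1 * (E * 1 + 1 * E) := by gcongr
    _ = 3 * E := by ring

lemma abs_mul_sub_mul_le {p p' r r' s t X Y : ℝ} (hp : |p| ≤ X) (hr' : |r'| ≤ Y)
    (hdp : |p' - p| ≤ s * X) (hdr : |r' - r| ≤ t * Y) :
    |p' * r' - p * r| ≤ (s + t) * (X * Y) := by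
  have hX := (abs_nonneg _).trans hp
  have hsX := (abs_nonneg _).trans hdp
  calc |p' * r' - p * r| = |(p' - p) * r' + p * (r' - r)| := by ring_nf
    _ ≤ |p' - p| * |r'| + |p| * |r' - r| := by
      rw [← abs_mul, ← abs_mul]
      exact abs_add_le _ _
    _ ≤ s * X * Y + X * (t * Y) := by gcongr
    _ = (s + t) * (X * Y) := by ring

lemma dotProduct_modifiedTriples_mulVec (η x y : Fin d → ℝ) :
    x ⬝ᵥ modifiedTriples α₀ μ C q η *ᵥ y = x ⬝ᵥ contract q η *ᵥ y
      - α₀ / (α₀ + 2) * ((y ⬝ᵥ μ) * (x ⬝ᵥ C *ᵥ η) + (x ⬝ᵥ μ) * (η ⬝ᵥ C *ᵥ y) +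
        (η ⬝ᵥ μ) * (x ⬝ᵥ C *ᵥ y))
      + 2 * α₀ ^ 2 / ((α₀ + 2) * (α₀ + 1)) * ((η ⬝ᵥ μ) * ((x ⬝ᵥ μ) * (y ⬝ᵥ μ))) := by
  have hrank_one (u v : Fin d → ℝ) :
      x ⬝ᵥ Matrix.vecMulVec u v *ᵥ y = (x ⬝ᵥ u) * (v ⬝ᵥ y) := by
    rw [Matrix.vecMulVec_mulVec, op_smul_eq_smul, dotProduct_smul, smul_eq_mul, mul_comm]
  simp only [modifiedTriples, Matrix.add_mulVec, Matrix.sub_mulVec, Matrix.smul_mulVec,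
    dotProduct_add, dotProduct_sub, dotProduct_smul, smul_eq_mul, hrank_one,
    Matrix.dotProduct_mulVec, dotProduct_comm μ y, mul_comm _ (y ⬝ᵥ μ)]

lemma abs_dotProduct_contract_sub_le (hdq : ‖q' - q‖₂ ≤ E) (η x y : Fin d → ℝ) :
    |x ⬝ᵥ contract q' η *ᵥ y - x ⬝ᵥ contract q η *ᵥ y| ≤ E * (‖x‖₂ * (‖y‖₂ * ‖η‖₂)) := by
  have hcontract : contract q' η - contract q η = contract (q' - q) η := by
    ext a b
    simp [contract, sub_mul]
  rw [← dotProduct_sub, ← Matrix.sub_mulVec, hcontract]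
  exact (abs_dotProduct_contract_mulVec_le _ _ _ _).trans (by gcongr)

lemma abs_dotProduct_le_of_norm_le {ν : Fin d → ℝ} {c : ℝ} (hν : ‖ν‖₂ ≤ c) (z : Fin d → ℝ) :
    |z ⬝ᵥ ν| ≤ c * ‖z‖₂ :=
  (abs_dotProduct_le z ν).trans (by rw [mul_comm]; gcongr)

lemma abs_dotProduct_mulVec_le_of_frobNorm_le {B : Matrix (Fin d) (Fin d) ℝ} {c : ℝ}
    (hB : frobNorm B ≤ c) (x y : Fin d → ℝ) : |x ⬝ᵥ B *ᵥ y| ≤ c * (‖x‖₂ * ‖y‖₂) :=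
  (abs_dotProduct_mulVec_le B x y).trans <|
    mul_le_mul_of_nonneg_right ((opNorm_le_frobNorm B).trans hB) (by positivity)

lemma abs_dotProduct_mul_dotProduct_mulVec_sub_le (hμ : ‖μ‖₂ ≤ 1)
    (hC' : frobNorm C' ≤ 1) (hdμ : ‖μ' - μ‖₂ ≤ E)
    (hdC : frobNorm (C' - C) ≤ E) (z x y : Fin d → ℝ) :
    |(z ⬝ᵥ μ') * (x ⬝ᵥ C' *ᵥ y) - (z ⬝ᵥ μ) * (x ⬝ᵥ C *ᵥ y)| ≤
      2 * E * (‖z‖₂ * (‖x‖₂ * ‖y‖₂)) := by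
  rw [two_mul]
  refine abs_mul_sub_mul_le ?_ ?_ ?_ ?_
  · simpa only [one_mul] using abs_dotProduct_le_of_norm_le hμ z
  · simpa only [one_mul] using abs_dotProduct_mulVec_le_of_frobNorm_le hC' x y
  · simpa only [dotProduct_sub] using abs_dotProduct_le_of_norm_le hdμ z
  · simpa only [Matrix.sub_mulVec, dotProduct_sub] using
      abs_dotProduct_mulVec_le_of_frobNorm_le hdC x y

lemma abs_dotProduct_mul_dotProduct_mul_dotProduct_sub_le (hμ : ‖μ‖₂ ≤ 1) (hμ' : ‖μ'‖₂ ≤ 1)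
    (hdμ : ‖μ' - μ‖₂ ≤ E) (z x y : Fin d → ℝ) :
    |(z ⬝ᵥ μ') * ((x ⬝ᵥ μ') * (y ⬝ᵥ μ')) - (z ⬝ᵥ μ) * ((x ⬝ᵥ μ) * (y ⬝ᵥ μ))| ≤
      3 * E * (‖z‖₂ * (‖x‖₂ * ‖y‖₂)) := by
  have hle (u) : |u ⬝ᵥ μ| ≤ ‖u‖₂ := by
    simpa only [one_mul] using abs_dotProduct_le_of_norm_le hμ u
  have hle' (u) : |u ⬝ᵥ μ'| ≤ ‖u‖₂ := by
    simpa only [one_mul] using abs_dotProduct_le_of_norm_le hμ' u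
  have hsub (u) : |u ⬝ᵥ μ' - u ⬝ᵥ μ| ≤ E * ‖u‖₂ := by
    simpa only [dotProduct_sub] using abs_dotProduct_le_of_norm_le hdμ u
  have hxy : |(x ⬝ᵥ μ') * (y ⬝ᵥ μ')| ≤ ‖x‖₂ * ‖y‖₂ := by
    rw [abs_mul]
    gcongr
    exacts [hle' x, hle' y]
  exact (abs_mul_sub_mul_le (hle z) hxy (hsub z)
    (abs_mul_sub_mul_le (hle x) (hle' y) (hsub x) (hsub y))).trans_eq (by ring)

lemma abs_dotProduct_modifiedTriples_sub_le (hα₀ : 0 ≤ α₀) (hμ : ‖μ‖₂ ≤ 1) (hμ' : ‖μ'‖₂ ≤ 1)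
    (hC' : frobNorm C' ≤ 1) (hdμ : ‖μ' - μ‖₂ ≤ E)
    (hdC : frobNorm (C' - C) ≤ E) (hdq : ‖q' - q‖₂ ≤ E) (η x y : Fin d → ℝ) :
    |x ⬝ᵥ (modifiedTriples α₀ μ' C' q' η - modifiedTriples α₀ μ C q η) *ᵥ y| ≤
      13 * E * (‖x‖₂ * (‖y‖₂ * ‖η‖₂)) := by
  have ha₀ : 0 ≤ α₀ / (α₀ + 2) := by positivity
  have ha₁ : α₀ / (α₀ + 2) ≤ 1 := div_le_one_of_le₀ (by linarith) (by linarith)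
  have hb₀ : 0 ≤ 2 * α₀ ^ 2 / ((α₀ + 2) * (α₀ + 1)) := by positivity
  have hb₂ : 2 * α₀ ^ 2 / ((α₀ + 2) * (α₀ + 1)) ≤ 2 := by
    rw [div_le_iff₀ (by positivity)]
    nlinarith
  have hq := abs_dotProduct_contract_sub_le hdq η x y
  have hy := abs_dotProduct_mul_dotProduct_mulVec_sub_le hμ hC' hdμ hdC y x η
  have hx := abs_dotProduct_mul_dotProduct_mulVec_sub_le hμ hC' hdμ hdC x η y
  have hη := abs_dotProduct_mul_dotProduct_mulVec_sub_le hμ hC' hdμ hdC η x y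
  have hη' := abs_dotProduct_mul_dotProduct_mul_dotProduct_sub_le hμ hμ' hdμ η x y
  set a := α₀ / (α₀ + 2)
  set b := 2 * α₀ ^ 2 / ((α₀ + 2) * (α₀ + 1))
  rw [Matrix.sub_mulVec, dotProduct_sub, dotProduct_modifiedTriples_mulVec,
    dotProduct_modifiedTriples_mulVec]
  generalize x ⬝ᵥ contract q' η *ᵥ y = Q', x ⬝ᵥ contract q η *ᵥ y = Q,
    (y ⬝ᵥ μ') * (x ⬝ᵥ C' *ᵥ η) = Y', (y ⬝ᵥ μ) * (x ⬝ᵥ C *ᵥ η) = Y,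
    (x ⬝ᵥ μ') * (η ⬝ᵥ C' *ᵥ y) = X', (x ⬝ᵥ μ) * (η ⬝ᵥ C *ᵥ y) = X,
    (η ⬝ᵥ μ') * (x ⬝ᵥ C' *ᵥ y) = H', (η ⬝ᵥ μ) * (x ⬝ᵥ C *ᵥ y) = H,
    (η ⬝ᵥ μ') * ((x ⬝ᵥ μ') * (y ⬝ᵥ μ')) = K', (η ⬝ᵥ μ) * ((x ⬝ᵥ μ) * (y ⬝ᵥ μ)) = K at *
  have : 0 ≤ E * (‖x‖₂ * (‖y‖₂ * ‖η‖₂)) := (abs_nonneg _).trans hq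
  have hsecond : |(Y' - Y) + (X' - X) + (H' - H)| ≤ 6 * (E * (‖x‖₂ * (‖y‖₂ * ‖η‖₂))) :=
    (abs_add_three _ _ _).trans (by linarith)
  calc |Q' - a * (Y' + X' + H') + b * K' - (Q - a * (Y + X + H) + b * K)|
      = |(Q' - Q) - a * ((Y' - Y) + (X' - X) + (H' - H)) + b * (K' - K)| := by ring_nf
    _ ≤ |Q' - Q| + a * |(Y' - Y) + (X' - X) + (H' - H)| + b * |K' - K| := by
      refine (abs_add_le _ _).trans (add_le_add ((abs_sub _ _).trans ?_) ?_) <;>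
        simp [abs_mul, abs_of_nonneg, ha₀, hb₀]
    _ ≤ E * (‖x‖₂ * (‖y‖₂ * ‖η‖₂)) + 1 * (6 * (E * (‖x‖₂ * (‖y‖₂ * ‖η‖₂)))) +
        2 * (3 * (E * (‖x‖₂ * (‖y‖₂ * ‖η‖₂)))) := by
      gcongr
      linarith
    _ = 13 * E * (‖x‖₂ * (‖y‖₂ * ‖η‖₂)) := by ring

end ModifiedMoments

section MomentErrors

variable {d k N : ℕ} {α : Fin k → ℝ} {O : Matrix (Fin d) (Fin k) ℝ}

/-- The weight of the topic `i` in the modified second moment of a document. -/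
def topicWeight (α : Fin k → ℝ) (i : Fin k) : ℝ :=
  α i / (∑ a, α a) / (∑ a, α a + 1)

/-- The modified second moment of a document. -/
def popPairs (α : Fin k → ℝ) (O : Matrix (Fin d) (Fin k) ℝ) : Matrix (Fin d) (Fin d) ℝ :=
  O * Matrix.diagonal (topicWeight α) * Oᵀ

/-- The modified third moment of a document, contracted with `η`. -/
def popTriples (α : Fin k → ℝ) (O : Matrix (Fin d) (Fin k) ℝ) (η : Fin d → ℝ) :
    Matrix (Fin d) (Fin d) ℝ :=
  O * Matrix.diagonal (fun i => 2 / (∑ a, α a + 2) * topicWeight α i * (Oᵀ *ᵥ η) i) * Oᵀ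

lemma mul_diagonal_mul_transpose_apply (f : Fin k → ℝ) (a b : Fin d) :
    (O * Matrix.diagonal f * Oᵀ) a b = ∑ i, f i * (O a i * O b i) := by
  rw [Matrix.mul_apply]
  refine Finset.sum_congr rfl fun i _ => ?_
  rw [Matrix.mul_diagonal, Matrix.transpose_apply]
  ring

lemma modifiedPairs_popSecond [NeZero k] (hα : ∀ i, 0 < α i) :
    modifiedPairs (∑ i, α i) (popMean α O) (Matrix.of (popSecond α O)) = popPairs α O := by
  ext a b
  rw [popPairs, mul_diagonal_mul_transpose_apply, modifiedPairs, Matrix.sub_apply,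
    Matrix.smul_apply, Matrix.vecMulVec_apply, smul_eq_mul, Matrix.of_apply, popSecond_sub hα,
    dotProduct, Finset.sum_div]
  exact Finset.sum_congr rfl fun i _ => by
    rw [topicWeight, Pi.mul_apply, div_div, div_mul_eq_mul_div]

lemma modifiedTriples_apply (α₀ : ℝ) (μ : Fin d → ℝ) (C : Matrix (Fin d) (Fin d) ℝ)
    (q : Fin d × Fin d × Fin d → ℝ) (η : Fin d → ℝ) (a b : Fin d) :
    modifiedTriples α₀ μ C q η a b =
      ∑ c, (q (a, b, c) - α₀ / (α₀ + 2) * (C a c * μ b + μ a * C c b + μ c * C a b) +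
        2 * α₀ ^ 2 / ((α₀ + 2) * (α₀ + 1)) * (μ c * (μ a * μ b))) * η c := by
  simp only [modifiedTriples, contract, Matrix.add_apply, Matrix.sub_apply, Matrix.smul_apply,
    Matrix.vecMulVec_apply, Matrix.of_apply, Matrix.mulVec, Matrix.vecMul, dotProduct, smul_eq_mul]
  generalize α₀ / (α₀ + 2) = s, 2 * α₀ ^ 2 / ((α₀ + 2) * (α₀ + 1)) = t
  simp only [Finset.sum_mul, Finset.mul_sum, ← Finset.sum_add_distrib, ← Finset.sum_sub_distrib]
  exact Finset.sum_congr rfl fun c _ => by ring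

lemma modifiedTriples_popThird [NeZero k] (hα : ∀ i, 0 < α i) (η : Fin d → ℝ) :
    modifiedTriples (∑ i, α i) (popMean α O) (Matrix.of (popSecond α O))
      (fun p => popThird α O p.1 p.2.1 p.2.2) η = popTriples α O η := by
  ext a b
  simp only [modifiedTriples_apply, Matrix.of_apply, popThird_sub hα, popTriples,
    mul_diagonal_mul_transpose_apply, topicWeight]
  generalize ∑ i, α i = s
  simp only [dotProduct, Matrix.mulVec, Matrix.transpose_apply, Pi.mul_apply, Finset.mul_sum,
    Finset.sum_mul, Finset.sum_div]
  rw [Finset.sum_comm]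
  refine Finset.sum_congr rfl fun i _ => Finset.sum_congr rfl fun c _ => ?_
  field_simp

lemma norm_popMean_le_one [NeZero k] (hα : ∀ i, 0 < α i) (hO : IsTopicMatrix O) :
    ‖popMean α O‖₂ ≤ 1 := by
  have hs : 0 < ∑ i, α i := Finset.sum_pos (fun i _ => hα i) Finset.univ_nonempty
  refine norm_le_one_of_sum_eq_one (fun a => div_nonneg ?_ hs.le) ?_
  · exact Finset.sum_nonneg fun i _ => mul_nonneg (hα i).le (hO.nonneg a i)
  · simp only [popMean, ← Finset.sum_div, sum_dotProduct_row hO, div_self hs.ne']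

lemma norm_freq_le_one {S ι : Type*} [DecidableEq ι] [Fintype ι] (g : S → ι) (x : Fin N → S) :
    ‖freq g x‖₂ ≤ 1 := by
  calc ‖freq g x‖₂ ≤ ‖(N : ℝ)⁻¹‖ * ∑ n : Fin N, ‖(Pi.single (g (x n)) 1 : ι → ℝ)‖₂ := by
        rw [freq, WithLp.toLp_smul, WithLp.toLp_sum, norm_smul]
        gcongr
        exact norm_sum_le Finset.univ fun n => WithLp.toLp 2 (Pi.single (g (x n)) 1 : ι → ℝ)
    _ = (N : ℝ)⁻¹ * N := by simp
    _ ≤ 1 := inv_mul_le_one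

lemma freq_apply {S ι : Type*} [DecidableEq ι] (g : S → ι) (x : Fin N → S) (a : ι) :
    freq g x a = (N : ℝ)⁻¹ * ∑ n, if a = g (x n) then 1 else 0 := by
  simp [freq, Finset.sum_apply, Pi.single_apply]

lemma empSecond_apply (w : Fin N → Fin 3 → Fin d) (a b : Fin d) :
    empSecond w a b = freq (fun w => (w 0, w 1)) w (a, b) := by
  rw [freq_apply, empSecond, Matrix.smul_apply, Matrix.sum_apply, smul_eq_mul]
  congr! 2 with n
  simp [hot, Matrix.vecMulVec_apply, Pi.single_apply, ← ite_and, and_comm]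

lemma empThird_eq_contract (w : Fin N → Fin 3 → Fin d) (η : Fin d → ℝ) :
    empThird w η = contract (freq (fun w => (w 0, w 1, w 2)) w) η := by
  ext a b
  simp only [contract, Matrix.of_apply, freq_apply, mul_assoc, Finset.sum_mul, ← Finset.mul_sum]
  rw [empThird, Matrix.smul_apply, Matrix.sum_apply, smul_eq_mul, Finset.sum_comm]
  congr! 2 with n
  by_cases ha : a = w n 0 <;> by_cases hb : b = w n 1 <;>
    simp [hot, Matrix.vecMulVec_apply, ha, hb]

lemma empMean_eq_freq (w : Fin N → Fin 3 → Fin d) : empMean w = freq (fun w => w 0) w :=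
  rfl

lemma frobNorm_empSecond_le_one (w : Fin N → Fin 3 → Fin d) : frobNorm (empSecond w) ≤ 1 := by
  simpa only [frobNorm, empSecond_apply] using norm_freq_le_one (fun w => (w 0, w 1)) w

lemma MomentsClose.frobNorm_empSecond_sub_le {E : ℝ} {w : Fin N → Fin 3 → Fin d}
    (h : MomentsClose α O E w) :
    frobNorm (empSecond w - Matrix.of (popSecond α O)) ≤ E := by
  have hsub : (fun p : Fin d × Fin d => (empSecond w - Matrix.of (popSecond α O)) p.1 p.2) =
      freq (fun w => (w 0, w 1)) w - fun p => popSecond α O p.1 p.2 :=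
    funext fun p => by rw [Matrix.sub_apply, empSecond_apply, Matrix.of_apply, Pi.sub_apply]
  rw [frobNorm, hsub]
  exact h.second

lemma MomentsClose.frobNorm_empPairs_sub_le [NeZero k] (hα : ∀ i, 0 < α i) (hO : IsTopicMatrix O)
    {E : ℝ} {w : Fin N → Fin 3 → Fin d} (h : MomentsClose α O E w) :
    frobNorm (empPairs (∑ i, α i) w - popPairs α O) ≤ 3 * E := by
  have hα₀ : 0 ≤ ∑ i, α i := Finset.sum_nonneg fun i _ => (hα i).le
  rw [empPairs, ← modifiedPairs_popSecond hα, ← modifiedPairs, empMean_eq_freq]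
  exact frobNorm_modifiedPairs_sub_le hα₀ (norm_popMean_le_one hα hO) (norm_freq_le_one _ w)
    h.first h.frobNorm_empSecond_sub_le

lemma MomentsClose.abs_dotProduct_empTriples_sub_le [NeZero k] (hα : ∀ i, 0 < α i)
    (hO : IsTopicMatrix O) {E : ℝ} {w : Fin N → Fin 3 → Fin d} (h : MomentsClose α O E w)
    (η x y : Fin d → ℝ) :
    |x ⬝ᵥ (empTriples (∑ i, α i) w η - popTriples α O η) *ᵥ y| ≤
      13 * E * (‖x‖₂ * (‖y‖₂ * ‖η‖₂)) := by
  have hα₀ : 0 ≤ ∑ i, α i := Finset.sum_nonneg fun i _ => (hα i).le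
  rw [empTriples, empThird_eq_contract, ← modifiedTriples_popThird hα, ← modifiedTriples,
    empMean_eq_freq]
  exact abs_dotProduct_modifiedTriples_sub_le hα₀ (norm_popMean_le_one hα hO)
    (norm_freq_le_one _ w) (frobNorm_empSecond_le_one w) h.first
    h.frobNorm_empSecond_sub_le h.third η x y

end MomentErrors

/-! ### Singular values -/

section SmallestSingularValue

variable {d k : ℕ}

lemma singularValues_mul_norm_le {E F : Type*} [NormedAddCommGroup E] [InnerProductSpace ℝ E]
    [FiniteDimensional ℝ E] [NormedAddCommGroup F] [InnerProductSpace ℝ F]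
    [FiniteDimensional ℝ F] (T : E →ₗ[ℝ] F) (x : E) :
    T.singularValues (Module.finrank ℝ E - 1) * ‖x‖ ≤ ‖T x‖ := by
  obtain h₀ | h₀ := Nat.eq_zero_or_pos (Module.finrank ℝ E)
  · have := Module.finrank_zero_iff.1 h₀
    simp [Subsingleton.elim x 0]
  have hT := T.isSymmetric_adjoint_comp_self
  set b := hT.eigenvectorBasis rfl with hb
  have hTx : ‖T x‖ ^ 2 = ∑ i, hT.eigenvalues rfl i * inner ℝ (b i) x ^ 2 := by
    rw [← real_inner_self_eq_norm_sq, ← LinearMap.adjoint_inner_right, ← LinearMap.comp_apply,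
      ← b.sum_inner_mul_inner]
    refine Finset.sum_congr rfl fun i _ => ?_
    rw [← hT (b i) x, hb, hT.apply_eigenvectorBasis, inner_smul_left, real_inner_comm]
    simp only [RCLike.ofReal_real_eq_id, id_eq, conj_trivial]
    ring
  rw [← sq_le_sq₀ (mul_nonneg (T.singularValues_nonneg _) (norm_nonneg _)) (norm_nonneg _),
    mul_pow, hTx, T.sq_singularValues_of_lt rfl (by omega), ← b.sum_sq_inner_right x,
    Finset.mul_sum]
  refine Finset.sum_le_sum fun i _ => mul_le_mul_of_nonneg_right ?_ (sq_nonneg _)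
  exact hT.eigenvalues_antitone rfl (Fin.mk_le_mk.2 (by have := i.2; omega))

lemma sigmaMin_nonneg (O : Matrix (Fin d) (Fin k) ℝ) : 0 ≤ sigmaMin O :=
  LinearMap.singularValues_nonneg _ _

lemma sigmaMin_mul_norm_le (O : Matrix (Fin d) (Fin k) ℝ) (y : Fin k → ℝ) :
    sigmaMin O * ‖y‖₂ ≤ ‖O *ᵥ y‖₂ := by
  have h := singularValues_mul_norm_le (Matrix.toEuclideanLin O) (WithLp.toLp 2 y)
  rwa [finrank_euclideanSpace_fin] at h

lemma sigmaMin_pos [NeZero k] {O : Matrix (Fin d) (Fin k) ℝ} (hO : O.rank = k) :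
    0 < sigmaMin O := by
  rw [sigmaMin, LinearMap.singularValues_pos_iff_lt_finrank_range,
    Matrix.toEuclideanLin_eq_toLin_orthonormal, ← Matrix.rank_eq_finrank_range_toLin, hO]
  exact Nat.sub_one_lt (NeZero.ne k)

end SmallestSingularValue

section SingularValueDecomposition

open scoped Matrix.Norms.L2Operator

lemma exists_mem_ne_zero_forall_mulVec_eq_zero {m n : Type*} [Fintype n] (A : Matrix m n ℝ)
    {S : Submodule ℝ (n → ℝ)} {t : Finset m} (ht : t.card < Module.finrank ℝ S) :
    ∃ x ∈ S, x ≠ 0 ∧ ∀ i ∈ t, (A *ᵥ x) i = 0 := by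
  let f : S →ₗ[ℝ] t → ℝ := LinearMap.funLeft ℝ ℝ Subtype.val ∘ₗ A.mulVecLin ∘ₗ S.subtype
  obtain ⟨x, hx, hx₀⟩ := (Submodule.ne_bot_iff _).1
    (LinearMap.ker_ne_bot_of_finrank_lt (f := f) (by simpa using ht))
  exact ⟨x, x.2, by simpa using hx₀, fun i hi => congrFun hx ⟨i, hi⟩⟩

variable {n : ℕ} {M U V : Matrix (Fin n) (Fin n) ℝ} {s : Fin n → ℝ}

lemma IsSVD.transpose_mul_left (h : IsSVD M U s V) : Uᵀ * U = 1 :=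
  (Matrix.mem_orthogonalGroup_iff' _ _).1 h.left_orthogonal

lemma IsSVD.left_mul_transpose (h : IsSVD M U s V) : U * Uᵀ = 1 :=
  (Matrix.mem_orthogonalGroup_iff _ _).1 h.left_orthogonal

lemma IsSVD.transpose_mul_right (h : IsSVD M U s V) : Vᵀ * V = 1 :=
  (Matrix.mem_orthogonalGroup_iff' _ _).1 h.right_orthogonal

lemma IsSVD.norm_sq_eq_sum (h : IsSVD M U s V) (x : Fin n → ℝ) :
    ‖x‖₂ ^ 2 = ∑ i, (Uᵀ *ᵥ x) i ^ 2 := by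
  rw [← norm_mulVec_of_transpose_mul_self (A := Uᵀ) (by simpa using h.left_mul_transpose),
    EuclideanSpace.real_norm_sq_eq]

lemma IsSVD.norm_transpose_mulVec_sq_eq_sum (h : IsSVD M U s V) (x : Fin n → ℝ) :
    ‖Mᵀ *ᵥ x‖₂ ^ 2 = ∑ i, s i ^ 2 * (Uᵀ *ᵥ x) i ^ 2 := by
  have hMx : Mᵀ *ᵥ x = V *ᵥ (Matrix.diagonal s *ᵥ (Uᵀ *ᵥ x)) := by
    simp [h.eq, Matrix.mul_assoc]
  rw [hMx, norm_mulVec_of_transpose_mul_self h.transpose_mul_right, EuclideanSpace.real_norm_sq_eq]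
  exact Finset.sum_congr rfl fun i _ => by simp only [Matrix.mulVec_diagonal, mul_pow]

lemma IsSVD.norm_transpose_mulVec_le (h : IsSVD M U s V) {c : ℝ} (hc : 0 ≤ c) {x : Fin n → ℝ}
    (hx : ∀ j, (Uᵀ *ᵥ x) j = 0 ∨ s j ≤ c) : ‖Mᵀ *ᵥ x‖₂ ≤ c * ‖x‖₂ := by
  rw [← sq_le_sq₀ (norm_nonneg _) (by positivity), h.norm_transpose_mulVec_sq_eq_sum, mul_pow,
    h.norm_sq_eq_sum, Finset.mul_sum]
  refine Finset.sum_le_sum fun j _ => ?_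
  obtain hj | hj := hx j
  · simp [hj]
  · have := h.nonneg j
    gcongr

lemma IsSVD.mul_norm_le_norm_transpose_mulVec (h : IsSVD M U s V) {c : ℝ} (hc : 0 ≤ c)
    {x : Fin n → ℝ} (hx : ∀ j, (Uᵀ *ᵥ x) j = 0 ∨ c ≤ s j) : c * ‖x‖₂ ≤ ‖Mᵀ *ᵥ x‖₂ := by
  rw [← sq_le_sq₀ (by positivity) (norm_nonneg _), h.norm_transpose_mulVec_sq_eq_sum, mul_pow,
    h.norm_sq_eq_sum, Finset.mul_sum]
  refine Finset.sum_le_sum fun j _ => ?_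
  obtain hj | hj := hx j
  · simp [hj]
  · gcongr

lemma IsSVD.le_singularValue (h : IsSVD M U s V) {S : Submodule ℝ (Fin n → ℝ)} {c : ℝ}
    (hS : ∀ x ∈ S, c * ‖x‖₂ ≤ ‖Mᵀ *ᵥ x‖₂) {i : Fin n} (hi : i < Module.finrank ℝ S) :
    c ≤ s i := by
  obtain ⟨x, hxS, hx₀, hx⟩ := exists_mem_ne_zero_forall_mulVec_eq_zero Uᵀ (S := S)
    (t := Finset.Iio i) (by simpa using hi)
  refine le_of_mul_le_mul_right ((hS x hxS).trans <| h.norm_transpose_mulVec_le (h.nonneg i)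
    fun j => ?_) (norm_pos_iff.2 ((WithLp.toLp_eq_zero 2).not.2 hx₀))
  obtain hj | hj := lt_or_ge j i
  · exact .inl (hx j (Finset.mem_Iio.2 hj))
  · exact .inr (h.antitone hj)

lemma IsSVD.singularValue_le (h : IsSVD M U s V) {S : Submodule ℝ (Fin n → ℝ)} {c : ℝ}
    (hS : ∀ x ∈ S, ‖Mᵀ *ᵥ x‖₂ ≤ c * ‖x‖₂) {j : Fin n} (hj : n ≤ j + Module.finrank ℝ S) :
    s j ≤ c := by
  obtain ⟨x, hxS, hx₀, hx⟩ := exists_mem_ne_zero_forall_mulVec_eq_zero Uᵀ (S := S)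
    (t := Finset.Ioi j) (by rw [Fin.card_Ioi]; omega)
  refine le_of_mul_le_mul_right ((h.mul_norm_le_norm_transpose_mulVec (h.nonneg j)
    fun i => ?_).trans (hS x hxS)) (norm_pos_iff.2 ((WithLp.toLp_eq_zero 2).not.2 hx₀))
  obtain hi | hi := lt_or_ge j i
  · exact .inl (hx i (Finset.mem_Ioi.2 hi))
  · exact .inr (h.antitone hi)

lemma IsSVD.singularValue_le_opNorm (h : IsSVD M U s V) (j : Fin n) : s j ≤ ‖M‖ :=
  h.singularValue_le (S := ⊤) (fun x _ => opNorm_transpose M ▸ norm_mulVec_le Mᵀ x) (by simp)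

end SingularValueDecomposition

section LeftModulus

variable {n : Type*} [Fintype n] {A B P : Matrix n n ℝ} {s : n → ℝ}

lemma two_mul_dotProduct_mulVec_le (hP : Pᵀ = P) (hP₀ : ∀ x, 0 ≤ x ⬝ᵥ (P *ᵥ x)) (x y : n → ℝ) :
    2 * (x ⬝ᵥ (P *ᵥ y)) ≤ x ⬝ᵥ (P *ᵥ x) + y ⬝ᵥ (P *ᵥ y) := by
  have h := hP₀ (x - y)
  have hyx : y ⬝ᵥ (P *ᵥ x) = x ⬝ᵥ (P *ᵥ y) := by
    rw [dotProduct_mulVec_eq_transpose, hP, dotProduct_comm]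
  rw [Matrix.mulVec_sub, dotProduct_sub, sub_dotProduct, sub_dotProduct, hyx] at h
  linarith

variable [DecidableEq n]

lemma trace_mul_diagonal_mul_transpose_mul (A B P : Matrix n n ℝ) (s : n → ℝ) :
    (A * Matrix.diagonal s * Bᵀ * P).trace = ∑ i, s i * (B.col i ⬝ᵥ (P *ᵥ A.col i)) := by
  rw [Matrix.mul_assoc, Matrix.trace_mul_comm, ← Matrix.mul_assoc, Matrix.trace]
  refine Finset.sum_congr rfl fun i _ => ?_
  rw [Matrix.diag_apply, Matrix.mul_diagonal, mul_comm, Matrix.mul_assoc]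
  rfl

lemma frobNorm_mul_diagonal_mul_transpose_sub_sq (hA : Aᵀ * A = 1) (hB : Bᵀ * B = 1)
    (hP : Pᵀ = P) :
    frobNorm (A * Matrix.diagonal s * Bᵀ - P) ^ 2 =
      ∑ i, s i ^ 2 - 2 * ∑ i, s i * (A.col i ⬝ᵥ (P *ᵥ B.col i)) + (P * P).trace := by
  set R := A * Matrix.diagonal s * Bᵀ with hR
  have hRt : Rᵀ = B * Matrix.diagonal s * Aᵀ := by simp [hR, Matrix.mul_assoc]
  have hRR : (Rᵀ * R).trace = ∑ i, s i ^ 2 := by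
    calc (Rᵀ * R).trace
        = (B * (Matrix.diagonal s * (Aᵀ * A) * Matrix.diagonal s * Bᵀ)).trace := by
          rw [hRt, hR]; simp only [Matrix.mul_assoc]
      _ = (Matrix.diagonal s * Matrix.diagonal s).trace := by
          rw [Matrix.trace_mul_comm, Matrix.mul_assoc, hB, hA, Matrix.mul_one, Matrix.mul_one]
      _ = ∑ i, s i ^ 2 := by simp only [Matrix.diagonal_mul_diagonal, Matrix.trace_diagonal, sq]
  have hRP : (Rᵀ * P).trace = ∑ i, s i * (A.col i ⬝ᵥ (P *ᵥ B.col i)) := by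
    rw [hRt, trace_mul_diagonal_mul_transpose_mul]
  have hPR : (P * R).trace = (Rᵀ * P).trace := by
    rw [← Matrix.trace_transpose, Matrix.transpose_mul, hP]
  rw [frobNorm_sq, Matrix.transpose_sub, hP, Matrix.sub_mul, Matrix.mul_sub, Matrix.mul_sub,
    Matrix.trace_sub, Matrix.trace_sub, Matrix.trace_sub, hRR, hPR, hRP]
  ring

-- The right-hand side bounds even the sum of the squared distances from `P` to the left modulus
-- `U diag(s) Uᵀ` and to the right modulus `V diag(s) Vᵀ`.
lemma IsSVD.frobNorm_leftModulus_sub_sq_le {n : ℕ} {M U V P : Matrix (Fin n) (Fin n) ℝ}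
    {s : Fin n → ℝ} (h : IsSVD M U s V) (hP : Pᵀ = P) (hP₀ : ∀ x, 0 ≤ x ⬝ᵥ (P *ᵥ x)) :
    frobNorm (U * Matrix.diagonal s * Uᵀ - P) ^ 2 ≤ 2 * frobNorm (M - P) ^ 2 := by
  have hsum : 2 * ∑ i, s i * (U.col i ⬝ᵥ (P *ᵥ V.col i)) ≤
      ∑ i, s i * (U.col i ⬝ᵥ (P *ᵥ U.col i)) + ∑ i, s i * (V.col i ⬝ᵥ (P *ᵥ V.col i)) := by
    rw [Finset.mul_sum, ← Finset.sum_add_distrib]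
    refine Finset.sum_le_sum fun i _ => ?_
    have := mul_le_mul_of_nonneg_left (two_mul_dotProduct_mulVec_le hP hP₀ (U.col i) (V.col i))
      (h.nonneg i)
    linarith
  have hright := sq_nonneg (frobNorm (V * Matrix.diagonal s * Vᵀ - P))
  rw [frobNorm_mul_diagonal_mul_transpose_sub_sq h.transpose_mul_right h.transpose_mul_right hP]
    at hright
  rw [h.eq, frobNorm_mul_diagonal_mul_transpose_sub_sq h.transpose_mul_left h.transpose_mul_left hP,
    frobNorm_mul_diagonal_mul_transpose_sub_sq h.transpose_mul_left h.transpose_mul_right hP]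
  linarith

end LeftModulus

/-! ### Whitening with a perturbed second moment -/

section WeightedGram

open scoped Matrix.Norms.L2Operator

variable {d k : ℕ} {O : Matrix (Fin d) (Fin k) ℝ} {D : Fin k → ℝ}

lemma transpose_mul_diagonal_mul_transpose :
    (O * Matrix.diagonal D * Oᵀ)ᵀ = O * Matrix.diagonal D * Oᵀ := by
  simp [Matrix.mul_assoc]

lemma mul_diagonal_mul_transpose_mulVec (x : Fin d → ℝ) :
    (O * Matrix.diagonal D * Oᵀ) *ᵥ x = O *ᵥ fun i => D i * (Oᵀ *ᵥ x) i := by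
  rw [← Matrix.mulVec_mulVec, ← Matrix.mulVec_mulVec]
  congr 1
  ext i
  rw [Matrix.mulVec_diagonal]

lemma dotProduct_mul_diagonal_mul_transpose_mulVec (x y : Fin d → ℝ) :
    x ⬝ᵥ ((O * Matrix.diagonal D * Oᵀ) *ᵥ y) = ∑ i, D i * ((Oᵀ *ᵥ x) i * (Oᵀ *ᵥ y) i) := by
  rw [mul_diagonal_mul_transpose_mulVec, dotProduct_mulVec_eq_transpose, dotProduct]
  exact Finset.sum_congr rfl fun i _ => by ring

lemma opNorm_mul_diagonal_mul_transpose_le (hcol : ∀ i, ‖O.col i‖₂ ≤ 1) (hD : ∀ i, 0 ≤ D i) :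
    ‖O * Matrix.diagonal D * Oᵀ‖ ≤ ∑ i, D i := by
  have hsum : O * Matrix.diagonal D * Oᵀ = ∑ i, D i • Matrix.vecMulVec (O.col i) (O.col i) := by
    ext a b
    rw [mul_diagonal_mul_transpose_apply]
    simp [Matrix.sum_apply, Matrix.vecMulVec_apply]
  rw [hsum]
  refine (norm_sum_le _ _).trans (Finset.sum_le_sum fun i _ => ?_)
  rw [norm_smul, Real.norm_of_nonneg (hD i)]
  refine mul_le_of_le_one_right (hD i) ((opNorm_le_frobNorm _).trans ?_)
  rw [frobNorm_vecMulVec]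
  exact mul_le_one₀ (hcol i) (norm_nonneg _) (hcol i)

lemma sigmaMin_le_one [NeZero k] (hcol : ∀ i, ‖O.col i‖₂ ≤ 1) : sigmaMin O ≤ 1 := by
  have h := sigmaMin_mul_norm_le O (Pi.single 0 1)
  rw [Matrix.mulVec_single_one, PiLp.toLp_single, PiLp.norm_single, norm_one, mul_one] at h
  exact h.trans (hcol 0)

lemma sigmaMin_mul_norm_mulVec_le (O : Matrix (Fin d) (Fin k) ℝ) (y : Fin k → ℝ) :
    sigmaMin O * ‖O *ᵥ y‖₂ ≤ ‖Oᵀ *ᵥ (O *ᵥ y)‖₂ := by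
  obtain h₀ | hpos := (norm_nonneg (WithLp.toLp 2 (O *ᵥ y))).eq_or_lt
  · rw [← h₀, mul_zero]; exact norm_nonneg _
  refine le_of_mul_le_mul_right ?_ hpos
  have hsq : ‖O *ᵥ y‖₂ ^ 2 ≤ ‖Oᵀ *ᵥ (O *ᵥ y)‖₂ * ‖y‖₂ := by
    rw [norm_sq_eq_dotProduct, dotProduct_mulVec_eq_transpose]
    exact (le_abs_self _).trans (abs_dotProduct_le _ _)
  calc sigmaMin O * ‖O *ᵥ y‖₂ * ‖O *ᵥ y‖₂ = sigmaMin O * ‖O *ᵥ y‖₂ ^ 2 := by ring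
    _ ≤ sigmaMin O * (‖Oᵀ *ᵥ (O *ᵥ y)‖₂ * ‖y‖₂) := by gcongr; exact sigmaMin_nonneg O
    _ = ‖Oᵀ *ᵥ (O *ᵥ y)‖₂ * (sigmaMin O * ‖y‖₂) := by ring
    _ ≤ ‖Oᵀ *ᵥ (O *ᵥ y)‖₂ * ‖O *ᵥ y‖₂ := by gcongr; exact sigmaMin_mul_norm_le O y

lemma mul_norm_mulVec_le_norm_mul_diagonal_mul_transpose {D₀ : ℝ} (hD₀ : 0 ≤ D₀)
    (hD : ∀ i, D₀ ≤ D i) (y : Fin k → ℝ) :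
    D₀ * sigmaMin O ^ 2 * ‖O *ᵥ y‖₂ ≤ ‖(O * Matrix.diagonal D * Oᵀ) *ᵥ (O *ᵥ y)‖₂ := by
  generalize hx : O *ᵥ y = x
  obtain h₀ | hpos := (norm_nonneg (WithLp.toLp 2 x)).eq_or_lt
  · rw [← h₀, mul_zero]; exact norm_nonneg _
  refine le_of_mul_le_mul_left ?_ hpos
  have hσ : sigmaMin O * ‖x‖₂ ≤ ‖Oᵀ *ᵥ x‖₂ := hx ▸ sigmaMin_mul_norm_mulVec_le O y
  calc ‖x‖₂ * (D₀ * sigmaMin O ^ 2 * ‖x‖₂) = D₀ * (sigmaMin O * ‖x‖₂) ^ 2 := by ring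
    _ ≤ D₀ * ‖Oᵀ *ᵥ x‖₂ ^ 2 := by
        have := sigmaMin_nonneg O
        gcongr
    _ ≤ x ⬝ᵥ ((O * Matrix.diagonal D * Oᵀ) *ᵥ x) := by
        rw [dotProduct_mul_diagonal_mul_transpose_mulVec, EuclideanSpace.real_norm_sq_eq,
          Finset.mul_sum]
        exact Finset.sum_le_sum fun i _ =>
          (mul_le_mul_of_nonneg_right (hD i) (sq_nonneg _)).trans_eq (by rw [sq])
    _ ≤ ‖x‖₂ * ‖(O * Matrix.diagonal D * Oᵀ) *ᵥ x‖₂ :=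
        (le_abs_self _).trans (abs_dotProduct_le _ _)

variable {P U V : Matrix (Fin d) (Fin d) ℝ} {s : Fin d → ℝ}

lemma IsSVD.le_singularValue_of_lt (h : IsSVD P U s V) (hO : O.rank = k) {D₀ : ℝ} (hD₀ : 0 ≤ D₀)
    (hD : ∀ i, D₀ ≤ D i) {i : Fin d} (hi : i < k) :
    D₀ * sigmaMin O ^ 2 - ‖P - O * Matrix.diagonal D * Oᵀ‖ ≤ s i := by
  refine h.le_singularValue (S := LinearMap.range O.mulVecLin) ?_ (hi.trans_eq hO.symm)
  rintro _ ⟨y, rfl⟩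
  rw [Matrix.mulVecLin_apply]
  have hlow := mul_norm_mulVec_le_norm_mul_diagonal_mul_transpose (O := O) hD₀ hD y
  generalize O *ᵥ y = x at *
  have herr := norm_mulVec_le (P - O * Matrix.diagonal D * Oᵀ)ᵀ x
  rw [opNorm_transpose, Matrix.transpose_sub, transpose_mul_diagonal_mul_transpose,
    Matrix.sub_mulVec] at herr
  have htri := norm_sub_norm_le (WithLp.toLp 2 ((O * Matrix.diagonal D * Oᵀ) *ᵥ x))
    (.toLp 2 (Pᵀ *ᵥ x))
  rw [norm_sub_rev, ← WithLp.toLp_sub] at htri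
  linarith

lemma IsSVD.singularValue_le_of_ge (h : IsSVD P U s V) (D : Fin k → ℝ) {j : Fin d} (hj : k ≤ j) :
    s j ≤ ‖P - O * Matrix.diagonal D * Oᵀ‖ := by
  refine h.singularValue_le (S := LinearMap.ker Oᵀ.mulVecLin) (fun x hx => ?_) ?_
  · have hx₀ : Oᵀ *ᵥ x = 0 := hx
    have hPx : Pᵀ *ᵥ x = (P - O * Matrix.diagonal D * Oᵀ)ᵀ *ᵥ x := by
      rw [Matrix.transpose_sub, Matrix.sub_mulVec, transpose_mul_diagonal_mul_transpose,
        ← Matrix.mulVec_mulVec x, hx₀, Matrix.mulVec_zero, sub_zero]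
    rw [hPx, ← opNorm_transpose (P - _)]
    exact norm_mulVec_le _ x
  · have hker := Oᵀ.mulVecLin.finrank_range_add_finrank_ker
    have hrank : Module.finrank ℝ (LinearMap.range Oᵀ.mulVecLin) ≤ k := Matrix.rank_le_height Oᵀ
    rw [Module.finrank_fin_fun] at hker
    omega

end WeightedGram

section WhiteningMatrix

open scoped Matrix.Norms.L2Operator

variable {d k : ℕ} (hkd : k ≤ d) {U : Matrix (Fin d) (Fin d) ℝ} {s : Fin d → ℝ}

/-- The matrix whose columns are the first `k` columns of `U`. -/
def leadingCols (U : Matrix (Fin d) (Fin d) ℝ) : Matrix (Fin d) (Fin k) ℝ :=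
  U.submatrix id (Fin.castLE hkd)

/-- The whitening matrix `A Σ^(-1/2)` obtained from the left singular vectors `U` and the singular
values `s` of a given singular value decomposition; see `IsWhitening`. -/
def whitener (U : Matrix (Fin d) (Fin d) ℝ) (s : Fin d → ℝ) : Matrix (Fin d) (Fin k) ℝ :=
  leadingCols hkd U * Matrix.diagonal fun i => (√(s (Fin.castLE hkd i)))⁻¹

lemma isWhitening_iff_exists_eq_whitener {P : Matrix (Fin d) (Fin d) ℝ}
    {W : Matrix (Fin d) (Fin k) ℝ} :
    IsWhitening hkd P W ↔ ∃ U s V, IsSVD P U s V ∧ W = whitener hkd U s :=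
  Iff.rfl

lemma transpose_leadingCols_mul_mul (U X : Matrix (Fin d) (Fin d) ℝ) :
    (leadingCols hkd U)ᵀ * X * leadingCols hkd U =
      (Uᵀ * X * U).submatrix (Fin.castLE hkd) (Fin.castLE hkd) := rfl

lemma transpose_leadingCols_mul_self (hU : Uᵀ * U = 1) :
    (leadingCols hkd U)ᵀ * leadingCols hkd U = 1 := by
  have h := transpose_leadingCols_mul_mul hkd U 1
  rwa [Matrix.mul_one, Matrix.mul_one, hU,
    Matrix.submatrix_one _ (Fin.castLE_injective hkd)] at h

lemma pinv_mul_diagonal_inv {A : Matrix (Fin d) (Fin k) ℝ} (hA : Aᵀ * A = 1) {r : Fin k → ℝ}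
    (hr : ∀ i, r i ≠ 0) :
    pinv (A * Matrix.diagonal fun i => (r i)⁻¹) = Matrix.diagonal r * Aᵀ := by
  have hinv : ((A * Matrix.diagonal fun i => (r i)⁻¹)ᵀ * (A * Matrix.diagonal fun i => (r i)⁻¹))⁻¹ =
      Matrix.diagonal fun i => r i * r i := by
    refine Matrix.inv_eq_left_inv ?_
    rw [Matrix.transpose_mul, Matrix.mul_assoc _ Aᵀ, ← Matrix.mul_assoc Aᵀ, hA, Matrix.one_mul]
    rw [Matrix.diagonal_transpose, Matrix.diagonal_mul_diagonal, Matrix.diagonal_mul_diagonal,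
      ← Matrix.diagonal_one]
    congr 1
    ext i
    field_simp [hr i]
  rw [pinv, hinv, Matrix.transpose_mul, Matrix.diagonal_transpose, ← Matrix.mul_assoc,
    Matrix.diagonal_mul_diagonal]
  simp only [mul_inv_cancel_right₀ (hr _)]

variable (hs : ∀ i : Fin k, 0 < s (Fin.castLE hkd i))
include hs

lemma transpose_pinv_whitener (hU : Uᵀ * U = 1) :
    (pinv (whitener hkd U s))ᵀ =
      leadingCols hkd U * Matrix.diagonal fun i => √(s (Fin.castLE hkd i)) := by
  rw [whitener, pinv_mul_diagonal_inv (transpose_leadingCols_mul_self hkd hU)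
    fun i => (Real.sqrt_pos.2 (hs i)).ne', Matrix.transpose_mul, Matrix.transpose_transpose,
    Matrix.diagonal_transpose]

lemma transpose_pinv_whitener_mul_transpose (hU : Uᵀ * U = 1) :
    (pinv (whitener hkd U s))ᵀ * (whitener hkd U s)ᵀ =
      leadingCols hkd U * (leadingCols hkd U)ᵀ := by
  rw [transpose_pinv_whitener hkd hs hU, whitener, Matrix.transpose_mul, Matrix.diagonal_transpose,
    Matrix.mul_assoc, ← Matrix.mul_assoc (Matrix.diagonal _), Matrix.diagonal_mul_diagonal]
  simp [(Real.sqrt_pos.2 (hs _)).ne']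

lemma whitener_transpose_mul_mul (hU : Uᵀ * U = 1) :
    (whitener hkd U s)ᵀ * (U * Matrix.diagonal s * Uᵀ) * whitener hkd U s = 1 := by
  have hmid : Uᵀ * (U * Matrix.diagonal s * Uᵀ) * U = Matrix.diagonal s := by
    calc Uᵀ * (U * Matrix.diagonal s * Uᵀ) * U = (Uᵀ * U) * Matrix.diagonal s * (Uᵀ * U) := by
          simp only [Matrix.mul_assoc]
      _ = Matrix.diagonal s := by rw [hU, Matrix.one_mul, Matrix.mul_one]
  have hlead := transpose_leadingCols_mul_mul hkd U (U * Matrix.diagonal s * Uᵀ)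
  rw [hmid, Matrix.submatrix_diagonal _ _ (Fin.castLE_injective hkd)] at hlead
  rw [whitener, Matrix.transpose_mul, Matrix.diagonal_transpose]
  set A := leadingCols hkd U
  set r : Fin k → ℝ := fun i => (√(s (Fin.castLE hkd i)))⁻¹ with hr
  calc Matrix.diagonal r * Aᵀ * (U * Matrix.diagonal s * Uᵀ) * (A * Matrix.diagonal r)
      = Matrix.diagonal r * (Aᵀ * (U * Matrix.diagonal s * Uᵀ) * A) * Matrix.diagonal r := by
        simp only [Matrix.mul_assoc]
    _ = Matrix.diagonal fun i => r i * s (Fin.castLE hkd i) * r i := by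
        rw [hlead, Matrix.diagonal_mul_diagonal, Matrix.diagonal_mul_diagonal]
        rfl
    _ = 1 := by
        rw [← Matrix.diagonal_one]
        congr 1
        ext i
        have hi := Real.sqrt_pos.2 (hs i)
        rw [hr, ← Real.mul_self_sqrt (hs i).le]
        field_simp

lemma rank_whitener (hU : Uᵀ * U = 1) : (whitener hkd U s).rank = k := by
  refine le_antisymm (Matrix.rank_le_width _) ?_
  have h := (Matrix.rank_mul_le_right ((whitener hkd U s)ᵀ * (U * Matrix.diagonal s * Uᵀ))
    (whitener hkd U s))
  rwa [whitener_transpose_mul_mul hkd hs hU, Matrix.rank_one, Fintype.card_fin] at h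

omit hs in
lemma opNorm_whitener_le (hU : Uᵀ * U = 1) {c : ℝ} (hc : 0 < c)
    (hs : ∀ i : Fin k, c ≤ s (Fin.castLE hkd i)) : ‖whitener hkd U s‖ ≤ √c⁻¹ := by
  refine (Matrix.l2_opNorm_mul _ _).trans <| (mul_le_of_le_one_left (norm_nonneg _)
    (opNorm_le_one_of_transpose_mul_self (transpose_leadingCols_mul_self hkd hU))).trans <|
    opNorm_diagonal_le (Real.sqrt_nonneg _) fun i => ?_
  rw [abs_of_nonneg (inv_nonneg.2 (Real.sqrt_nonneg _)), ← Real.sqrt_inv]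
  exact Real.sqrt_le_sqrt (inv_anti₀ hc (hs i))

lemma opNorm_transpose_pinv_whitener_le (hU : Uᵀ * U = 1) {c : ℝ}
    (hc : ∀ i : Fin k, s (Fin.castLE hkd i) ≤ c) : ‖(pinv (whitener hkd U s))ᵀ‖ ≤ √c := by
  rw [transpose_pinv_whitener hkd hs hU]
  refine (Matrix.l2_opNorm_mul _ _).trans <| (mul_le_of_le_one_left (norm_nonneg _)
    (opNorm_le_one_of_transpose_mul_self (transpose_leadingCols_mul_self hkd hU))).trans <|
    opNorm_diagonal_le (Real.sqrt_nonneg _) fun i => ?_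
  rw [abs_of_nonneg (Real.sqrt_nonneg _)]
  exact Real.sqrt_le_sqrt (hc i)

end WhiteningMatrix

section WhiteningPerturbation

open scoped Matrix.Norms.L2Operator

variable {d k : ℕ} (hkd : k ≤ d) {O : Matrix (Fin d) (Fin k) ℝ} {D : Fin k → ℝ} {D₀ : ℝ}
  {P U V : Matrix (Fin d) (Fin d) ℝ} {s : Fin d → ℝ}

lemma IsSVD.le_singularValue_of_opNorm_sub_le (h : IsSVD P U s V) (hO : O.rank = k) (hD₀ : 0 ≤ D₀)
    (hD : ∀ i, D₀ ≤ D i)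
    (hP : ‖P - O * Matrix.diagonal D * Oᵀ‖ ≤ 3 / 5 * (D₀ * sigmaMin O ^ 2)) (i : Fin k) :
    2 / 5 * (D₀ * sigmaMin O ^ 2) ≤ s (Fin.castLE hkd i) := by
  have hi := h.le_singularValue_of_lt hO hD₀ hD (i := Fin.castLE hkd i) i.2
  linarith

lemma IsSVD.singularValue_le_two_mul_sum [NeZero k] (h : IsSVD P U s V)
    (hcol : ∀ i, ‖O.col i‖₂ ≤ 1) (hD₀ : 0 ≤ D₀) (hD : ∀ i, D₀ ≤ D i)
    (hP : ‖P - O * Matrix.diagonal D * Oᵀ‖ ≤ D₀ * sigmaMin O ^ 2) (j : Fin d) :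
    s j ≤ 2 * ∑ i, D i := by
  have hD' : ∀ i, 0 ≤ D i := fun i => hD₀.trans (hD i)
  have hsum : D₀ * sigmaMin O ^ 2 ≤ ∑ i, D i :=
    calc D₀ * sigmaMin O ^ 2 ≤ D₀ :=
          mul_le_of_le_one_right hD₀ (pow_le_one₀ (sigmaMin_nonneg O) (sigmaMin_le_one hcol))
      _ ≤ D 0 := hD 0
      _ ≤ ∑ i, D i := Finset.single_le_sum (fun i _ => hD' i) (Finset.mem_univ 0)
  have hop : ‖P‖ ≤ ‖P - O * Matrix.diagonal D * Oᵀ‖ + ‖O * Matrix.diagonal D * Oᵀ‖ := by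
    simpa using norm_add_le (P - O * Matrix.diagonal D * Oᵀ) (O * Matrix.diagonal D * Oᵀ)
  have := opNorm_mul_diagonal_mul_transpose_le hcol hD'
  have := h.singularValue_le_opNorm j
  linarith

lemma IsSVD.norm_mulVec_le_of_transpose_leadingCols_mulVec_eq_zero (h : IsSVD P U s V)
    {y : Fin d → ℝ} (hy : (leadingCols hkd U)ᵀ *ᵥ y = 0) :
    ‖(O * Matrix.diagonal D * Oᵀ) *ᵥ y‖₂ ≤ 2 * ‖P - O * Matrix.diagonal D * Oᵀ‖ * ‖y‖₂ := by
  have hPy : ‖Pᵀ *ᵥ y‖₂ ≤ ‖P - O * Matrix.diagonal D * Oᵀ‖ * ‖y‖₂ := by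
    refine h.norm_transpose_mulVec_le (norm_nonneg _) fun j => ?_
    obtain hj | hj := lt_or_ge (j : ℕ) k
    · exact .inl (congrFun hy ⟨j, hj⟩)
    · exact .inr (h.singularValue_le_of_ge D hj)
  have herr := norm_mulVec_le (P - O * Matrix.diagonal D * Oᵀ)ᵀ y
  rw [opNorm_transpose] at herr
  have hsplit : (O * Matrix.diagonal D * Oᵀ) *ᵥ y =
      Pᵀ *ᵥ y - (P - O * Matrix.diagonal D * Oᵀ)ᵀ *ᵥ y := by
    rw [← Matrix.sub_mulVec, ← Matrix.transpose_sub, sub_sub_cancel,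
      transpose_mul_diagonal_mul_transpose]
  rw [hsplit]
  have := norm_sub_le (WithLp.toLp 2 (Pᵀ *ᵥ y))
    (.toLp 2 ((P - O * Matrix.diagonal D * Oᵀ)ᵀ *ᵥ y))
  rw [← WithLp.toLp_sub] at this
  linarith

lemma mul_abs_le_norm_mul_diagonal_mul_transpose_mulVec (hD : ∀ i, 0 ≤ D i) (y : Fin d → ℝ)
    (i : Fin k) :
    sigmaMin O * (D i * |(Oᵀ *ᵥ y) i|) ≤ ‖(O * Matrix.diagonal D * Oᵀ) *ᵥ y‖₂ := by
  rw [mul_diagonal_mul_transpose_mulVec]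
  refine le_trans ?_ (sigmaMin_mul_norm_le O _)
  refine mul_le_mul_of_nonneg_left ?_ (sigmaMin_nonneg O)
  have h := PiLp.norm_apply_le (WithLp.toLp 2 fun i => D i * (Oᵀ *ᵥ y) i) i
  rwa [Real.norm_eq_abs, abs_mul, abs_of_nonneg (hD i)] at h

lemma IsSVD.norm_col_sub_leadingCols_mulVec_le (h : IsSVD P U s V) (hD : ∀ i, 0 ≤ D i)
    (i : Fin k) :
    D i * sigmaMin O * ‖O.col i - (leadingCols hkd U * (leadingCols hkd U)ᵀ) *ᵥ O.col i‖₂ ≤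
      2 * ‖P - O * Matrix.diagonal D * Oᵀ‖ := by
  set A := leadingCols hkd U
  generalize hy : O.col i - (A * Aᵀ) *ᵥ O.col i = y
  have hAy : Aᵀ *ᵥ y = 0 := by
    rw [← hy, Matrix.mulVec_sub, Matrix.mulVec_mulVec, ← Matrix.mul_assoc,
      transpose_leadingCols_mul_self hkd h.transpose_mul_left, Matrix.one_mul, sub_self]
  have hOy : (Oᵀ *ᵥ y) i = ‖y‖₂ ^ 2 := by
    have hproj : ((A * Aᵀ) *ᵥ O.col i) ⬝ᵥ y = 0 := by
      rw [dotProduct_comm, ← Matrix.mulVec_mulVec, dotProduct_mulVec_eq_transpose, hAy,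
        zero_dotProduct]
    calc (Oᵀ *ᵥ y) i = O.col i ⬝ᵥ y := rfl
      _ = y ⬝ᵥ y + ((A * Aᵀ) *ᵥ O.col i) ⬝ᵥ y := by rw [← add_dotProduct, ← hy, sub_add_cancel]
      _ = ‖y‖₂ ^ 2 := by rw [hproj, add_zero, norm_sq_eq_dotProduct]
  obtain h₀ | hpos := (norm_nonneg (WithLp.toLp 2 y)).eq_or_lt
  · rw [← h₀, mul_zero]
    positivity
  refine le_of_mul_le_mul_right ?_ hpos
  have hlow := mul_abs_le_norm_mul_diagonal_mul_transpose_mulVec (O := O) hD y i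
  rw [hOy, abs_of_nonneg (sq_nonneg _)] at hlow
  have hup := h.norm_mulVec_le_of_transpose_leadingCols_mulVec_eq_zero (O := O) (D := D) hkd hAy
  linarith

lemma IsSVD.opNorm_whitener_transpose_mul_mul_sub_one_le (h : IsSVD P U s V)
    (hs : ∀ i : Fin k, 0 < s (Fin.castLE hkd i)) (hD : ∀ i, 0 ≤ D i) :
    ‖(whitener hkd U s)ᵀ * (O * Matrix.diagonal D * Oᵀ) * whitener hkd U s - 1‖ ≤
      ‖whitener hkd U s‖ ^ 2 * (√2 * frobNorm (P - O * Matrix.diagonal D * Oᵀ)) := by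
  have hmod := h.frobNorm_leftModulus_sub_sq_le (P := O * Matrix.diagonal D * Oᵀ)
    transpose_mul_diagonal_mul_transpose fun x => by
      rw [dotProduct_mul_diagonal_mul_transpose_mulVec]
      exact Finset.sum_nonneg fun i _ => mul_nonneg (hD i) (mul_self_nonneg _)
  have hone := whitener_transpose_mul_mul hkd hs h.transpose_mul_left
  generalize whitener hkd U s = W at *
  generalize O * Matrix.diagonal D * Oᵀ = G at *
  generalize U * Matrix.diagonal s * Uᵀ = L at *
  have hLG : ‖L - G‖ ≤ √2 * frobNorm (P - G) := by
    refine (opNorm_le_frobNorm _).trans ?_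
    rw [← sq_le_sq₀ (frobNorm_nonneg _) (mul_nonneg (Real.sqrt_nonneg _) (frobNorm_nonneg _)),
      mul_pow, Real.sq_sqrt zero_le_two]
    exact hmod
  calc ‖Wᵀ * G * W - 1‖ = ‖Wᵀ * (L - G) * W‖ := by
        rw [← hone, norm_sub_rev, Matrix.mul_sub, Matrix.sub_mul]
    _ ≤ ‖Wᵀ‖ * ‖L - G‖ * ‖W‖ :=
        (Matrix.l2_opNorm_mul _ _).trans <|
          mul_le_mul_of_nonneg_right (Matrix.l2_opNorm_mul _ _) (norm_nonneg _)
    _ = ‖W‖ ^ 2 * ‖L - G‖ := by rw [opNorm_transpose]; ring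
    _ ≤ ‖W‖ ^ 2 * (√2 * frobNorm (P - G)) := by gcongr

end WhiteningPerturbation

/-! ### Singular vectors of nearly diagonal matrices -/

section NearlyOrthogonal

open scoped Matrix.Norms.L2Operator

variable {n : Type*} [Fintype n] [DecidableEq n] {B : Matrix n n ℝ}

lemma abs_norm_transpose_mulVec_sq_sub_le (B : Matrix n n ℝ) (x : n → ℝ) :
    |‖Bᵀ *ᵥ x‖₂ ^ 2 - ‖x‖₂ ^ 2| ≤ ‖B * Bᵀ - 1‖ * ‖x‖₂ ^ 2 := by
  have hx : ‖Bᵀ *ᵥ x‖₂ ^ 2 - ‖x‖₂ ^ 2 = x ⬝ᵥ ((B * Bᵀ - 1) *ᵥ x) := by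
    rw [Matrix.sub_mulVec, Matrix.one_mulVec, dotProduct_sub, ← norm_sq_eq_dotProduct,
      ← Matrix.mulVec_mulVec, dotProduct_mulVec_eq_transpose, ← norm_sq_eq_dotProduct]
  rw [hx, sq]
  exact abs_dotProduct_mulVec_le _ _ _

lemma opNorm_sq_le_one_add (B : Matrix n n ℝ) : ‖B‖ ^ 2 ≤ 1 + ‖B * Bᵀ - 1‖ := by
  have hle : ‖Bᵀ‖ ≤ √(1 + ‖B * Bᵀ - 1‖) := by
    refine opNorm_le_of_forall (Real.sqrt_nonneg _) fun x => ?_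
    rw [← sq_le_sq₀ (norm_nonneg _) (by positivity), mul_pow, Real.sq_sqrt (by positivity)]
    linarith [(abs_le.1 (abs_norm_transpose_mulVec_sq_sub_le B x)).2]
  rw [opNorm_transpose] at hle
  exact (Real.le_sqrt (norm_nonneg _) (by positivity)).1 hle

lemma opNorm_le_of_opNorm_mul_transpose_sub_one_le (hB : ‖B * Bᵀ - 1‖ ≤ 1 / 4) :
    ‖B‖ ≤ 9 / 8 := by
  nlinarith [opNorm_sq_le_one_add B]

lemma norm_le_two_mul_norm_mulVec (hB : ‖B * Bᵀ - 1‖ ≤ 1 / 4) (x : n → ℝ) :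
    ‖x‖₂ ≤ 2 * ‖B *ᵥ x‖₂ := by
  have hinj : Function.Injective (Matrix.mulVecLin Bᵀ) := by
    refine (injective_iff_map_eq_zero _).2 fun y (hy : Bᵀ *ᵥ y = 0) => ?_
    have h := (abs_le.1 (abs_norm_transpose_mulVec_sq_sub_le B y)).1
    rw [hy, WithLp.toLp_zero, norm_zero] at h
    have hy₀ : ‖y‖₂ = 0 := by nlinarith [sq_nonneg ‖y‖₂, norm_nonneg (WithLp.toLp 2 y)]
    exact (WithLp.toLp_eq_zero 2).1 (norm_eq_zero.1 hy₀)
  obtain ⟨y, hy : Bᵀ *ᵥ y = x⟩ := LinearMap.injective_iff_surjective.1 hinj x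
  have hx : ‖x‖₂ ≤ 9 / 8 * ‖y‖₂ := by
    rw [← hy]
    refine (norm_mulVec_le Bᵀ y).trans ?_
    rw [opNorm_transpose]
    gcongr
    exact opNorm_le_of_opNorm_mul_transpose_sub_one_le hB
  have hyB : ‖y‖₂ ≤ ‖B *ᵥ x‖₂ + 1 / 4 * ‖y‖₂ :=
    calc ‖y‖₂ = ‖B *ᵥ x - (B * Bᵀ - 1) *ᵥ y‖₂ := by
          rw [Matrix.sub_mulVec, Matrix.one_mulVec, ← Matrix.mulVec_mulVec, hy, sub_sub_cancel]
      _ ≤ ‖B *ᵥ x‖₂ + ‖(B * Bᵀ - 1) *ᵥ y‖₂ := by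
          rw [WithLp.toLp_sub]; exact norm_sub_le _ _
      _ ≤ ‖B *ᵥ x‖₂ + 1 / 4 * ‖y‖₂ := by
          gcongr
          exact (norm_mulVec_le _ _).trans (by gcongr)
  linarith [norm_nonneg (WithLp.toLp 2 x)]

end NearlyOrthogonal

section Coordinates

variable {ι : Type*}

lemma abs_le_of_le_abs_abs_sub {μ s c c' G : ℝ} (hs : 0 ≤ s) (hG : 0 < G)
    (hfar : G ≤ |(|μ| - s)|) : |c| ≤ (|μ * c - s * c'| + |μ * c' - s * c|) / G := by
  have hsub : G ≤ |μ - s| :=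
    hfar.trans (by simpa [abs_of_nonneg hs] using abs_abs_sub_abs_le_abs_sub μ s)
  have hadd : G ≤ |μ + s| :=
    hfar.trans (by simpa [abs_of_nonneg hs] using abs_abs_sub_abs_le_abs_sub μ (-s))
  have hplus : G * |c + c'| ≤ |μ * c - s * c'| + |μ * c' - s * c| :=
    calc G * |c + c'| ≤ |μ - s| * |c + c'| := by gcongr
      _ = |(μ * c - s * c') + (μ * c' - s * c)| := by rw [← abs_mul]; ring_nf
      _ ≤ _ := abs_add_le _ _
  have hminus : G * |c - c'| ≤ |μ * c - s * c'| + |μ * c' - s * c| :=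
    calc G * |c - c'| ≤ |μ + s| * |c - c'| := by gcongr
      _ = |(μ * c - s * c') - (μ * c' - s * c)| := by rw [← abs_mul]; ring_nf
      _ ≤ _ := abs_sub _ _
  have htwo : 2 * |c| ≤ |c + c'| + |c - c'| := by
    simpa [← two_mul, abs_mul] using abs_add_le (c + c') (c - c')
  rw [le_div_iff₀ hG]
  nlinarith

variable [Fintype ι]

lemma sum_sq_le_of_le_abs_abs_sub {μ c c' : ι → ℝ} {s χ G : ℝ} (hs : 0 ≤ s) (hG : 0 < G)
    (hc : ‖fun j => μ j * c j - s * c' j‖₂ ≤ χ) (hc' : ‖fun j => μ j * c' j - s * c j‖₂ ≤ χ)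
    {J : Finset ι} (hJ : ∀ j ∈ J, G ≤ |(|μ j| - s)|) :
    ∑ j ∈ J, c j ^ 2 ≤ (2 * χ / G) ^ 2 := by
  set e : ι → ℝ := fun j => μ j * c j - s * c' j
  set f : ι → ℝ := fun j => μ j * c' j - s * c j
  have hsum : ∑ j, (e j ^ 2 + f j ^ 2) ≤ χ ^ 2 + χ ^ 2 := by
    have he₂ := pow_le_pow_left₀ (norm_nonneg _) hc 2
    have hf₂ := pow_le_pow_left₀ (norm_nonneg _) hc' 2
    rw [EuclideanSpace.real_norm_sq_eq] at he₂ hf₂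
    rw [Finset.sum_add_distrib]
    exact add_le_add he₂ hf₂
  have hterm : ∀ j ∈ J, c j ^ 2 ≤ 2 / G ^ 2 * (e j ^ 2 + f j ^ 2) := fun j hj =>
    calc c j ^ 2 ≤ ((|e j| + |f j|) / G) ^ 2 := by
          rw [← sq_abs]
          exact pow_le_pow_left₀ (abs_nonneg _) (abs_le_of_le_abs_abs_sub hs hG (hJ j hj)) 2
      _ ≤ 2 * (|e j| ^ 2 + |f j| ^ 2) / G ^ 2 := by rw [div_pow]; gcongr; exact add_sq_le
      _ = 2 / G ^ 2 * (e j ^ 2 + f j ^ 2) := by rw [sq_abs, sq_abs]; ring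
  calc ∑ j ∈ J, c j ^ 2
      ≤ ∑ j ∈ J, 2 / G ^ 2 * (e j ^ 2 + f j ^ 2) := Finset.sum_le_sum hterm
    _ ≤ ∑ j, 2 / G ^ 2 * (e j ^ 2 + f j ^ 2) :=
        Finset.sum_le_sum_of_subset_of_nonneg J.subset_univ fun j _ _ => by positivity
    _ ≤ 2 / G ^ 2 * (χ ^ 2 + χ ^ 2) := by rw [← Finset.mul_sum]; gcongr
    _ = (2 * χ / G) ^ 2 := by ring

variable [DecidableEq ι] {η : ℝ}

lemma exists_perm_forall_sum_erase_sq_le {c : ι → ι → ℝ} (hη₀ : 0 ≤ η) (hη : η ≤ 1 / 4)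
    (hrow : ∀ a, 3 / 4 ≤ ∑ j, c a j ^ 2) (hcol : ∀ j, ∑ a, c a j ^ 2 ≤ 5 / 4)
    (hc : ∀ a, ∃ i, ∑ j ∈ Finset.univ.erase i, c a j ^ 2 ≤ η ^ 2) :
    ∃ τ : Equiv.Perm ι, ∀ i, ∑ j ∈ Finset.univ.erase i, c (τ i) j ^ 2 ≤ η ^ 2 := by
  choose π hπ using hc
  have hbig : ∀ a, 11 / 16 ≤ c a (π a) ^ 2 := fun a => by
    have ha := hrow a
    rw [← Finset.add_sum_erase _ _ (Finset.mem_univ (π a))] at ha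
    nlinarith [hπ a]
  have hinj : Function.Injective π := fun a b hab => by
    by_contra hne
    have hsum := Finset.add_le_sum (f := fun a' => c a' (π a) ^ 2) (fun i _ => sq_nonneg _)
      (Finset.mem_univ a) (Finset.mem_univ b) hne
    have hb := hbig b
    rw [← hab] at hb
    linarith [hbig a, hcol (π a)]
  let σ := Equiv.ofBijective π (Finite.injective_iff_bijective.1 hinj)
  refine ⟨σ.symm, fun i => ?_⟩
  have hi : π (σ.symm i) = i := σ.apply_symm_apply i
  simpa only [hi] using hπ (σ.symm i)

lemma exists_sign_norm_sub_single_le {g : ℝ} (hg₀ : 0 ≤ g) (hη₀ : 0 ≤ η)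
    (hη : η ≤ 1 / 4) {c : ι → ℝ} (hc : |‖c‖₂ ^ 2 - 1| ≤ g) {i : ι}
    (hi : ∑ j ∈ Finset.univ.erase i, c j ^ 2 ≤ η ^ 2) :
    ∃ ς : ℝ, ς ^ 2 = 1 ∧ ‖c - ς • Pi.single i 1‖₂ ≤ g + 2 * η := by
  have hci : |c i ^ 2 - 1| ≤ g + η ^ 2 := by
    have hsum : 0 ≤ ∑ j ∈ Finset.univ.erase i, c j ^ 2 := Finset.sum_nonneg fun j _ => sq_nonneg _
    rw [EuclideanSpace.real_norm_sq_eq, ← Finset.add_sum_erase _ _ (Finset.mem_univ i)] at hc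
    rw [abs_le] at hc ⊢
    constructor <;> linarith [hc.1, hc.2]
  obtain ⟨ς, hς, hςc⟩ : ∃ ς : ℝ, ς ^ 2 = 1 ∧ 0 ≤ ς * c i := by
    obtain h | h := le_total 0 (c i)
    · exact ⟨1, by norm_num, by linarith⟩
    · exact ⟨-1, by norm_num, by linarith⟩
  have hdiff : (c i - ς) ^ 2 ≤ (g + η ^ 2) ^ 2 :=
    calc (c i - ς) ^ 2 ≤ (c i - ς) ^ 2 * (c i + ς) ^ 2 :=
          le_mul_of_one_le_right (sq_nonneg _) (by nlinarith [sq_nonneg (c i)])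
      _ = (c i ^ 2 - 1) ^ 2 := by rw [← hς]; ring
      _ ≤ (g + η ^ 2) ^ 2 := sq_le_sq.2 (hci.trans (le_abs_self _))
  refine ⟨ς, hς, ?_⟩
  rw [← sq_le_sq₀ (norm_nonneg _) (by positivity), EuclideanSpace.real_norm_sq_eq,
    ← Finset.add_sum_erase _ _ (Finset.mem_univ i)]
  have herase : ∑ j ∈ Finset.univ.erase i, (c - ς • Pi.single i 1 : ι → ℝ) j ^ 2 =
      ∑ j ∈ Finset.univ.erase i, c j ^ 2 :=
    Finset.sum_congr rfl fun j hj => by simp [Pi.single_eq_of_ne (Finset.ne_of_mem_erase hj)]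
  rw [herase]
  simp only [Pi.sub_apply, Pi.smul_apply, Pi.single_eq_same, smul_eq_mul, mul_one]
  calc (c i - ς) ^ 2 + ∑ j ∈ Finset.univ.erase i, c j ^ 2 ≤ (g + η ^ 2) ^ 2 + η ^ 2 :=
        add_le_add hdiff hi
    _ ≤ (g + η) ^ 2 + η ^ 2 := by gcongr; exact pow_le_of_le_one hη₀ (by linarith) two_ne_zero
    _ ≤ (g + 2 * η) ^ 2 := by nlinarith [mul_nonneg hg₀ hη₀]

end Coordinates

section SingularVectors

open scoped Matrix.Norms.L2Operator

variable {k : ℕ} {M U V : Matrix (Fin k) (Fin k) ℝ} {s : Fin k → ℝ}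

lemma IsSVD.transpose (h : IsSVD M U s V) : IsSVD Mᵀ V s U :=
  ⟨h.right_orthogonal, h.left_orthogonal, h.nonneg, h.antitone, by
    rw [h.eq]; simp [Matrix.mul_assoc]⟩

lemma IsSVD.mulVec_col (h : IsSVD M U s V) (a : Fin k) : M *ᵥ V.col a = s a • U.col a := by
  have hV : Vᵀ *ᵥ V.col a = Pi.single a 1 := by
    rw [← Matrix.mulVec_single_one, Matrix.mulVec_mulVec, h.transpose_mul_right, Matrix.one_mulVec]
  rw [h.eq, ← Matrix.mulVec_mulVec, hV, ← Matrix.mulVec_mulVec, Matrix.diagonal_mulVec_single,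
    mul_one]
  ext b
  simp [Matrix.mulVec_single, mul_comm]

lemma IsSVD.norm_col_left (h : IsSVD M U s V) (a : Fin k) : ‖U.col a‖₂ = 1 := by
  rw [← Matrix.mulVec_single_one, norm_mulVec_of_transpose_mul_self h.transpose_mul_left,
    PiLp.toLp_single, PiLp.norm_single, norm_one]

variable {μ : Fin k → ℝ} {B : Matrix (Fin k) (Fin k) ℝ} {Λ Δ η : ℝ}

lemma IsSVD.singularValue_le_add (h : IsSVD M U s V) (hB : ‖B * Bᵀ - 1‖ ≤ 1 / 4)
    (hμ : ∀ j, |μ j| ≤ 5 / 4 * Λ) (a : Fin k) :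
    s a ≤ 2 * Λ + ‖M - B * Matrix.diagonal μ * Bᵀ‖ := by
  have hΛ : 0 ≤ 5 / 4 * Λ := (abs_nonneg _).trans (hμ a)
  have hBB : ‖B * Matrix.diagonal μ * Bᵀ‖ ≤ 5 / 4 * (5 / 4 * Λ) :=
    calc ‖B * Matrix.diagonal μ * Bᵀ‖ ≤ ‖B‖ * ‖Matrix.diagonal μ‖ * ‖Bᵀ‖ :=
          (Matrix.l2_opNorm_mul _ _).trans (by gcongr; exact Matrix.l2_opNorm_mul _ _)
      _ ≤ ‖B‖ * (5 / 4 * Λ) * ‖B‖ := by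
          rw [opNorm_transpose]; gcongr; exact opNorm_diagonal_le hΛ hμ
      _ = ‖B‖ ^ 2 * (5 / 4 * Λ) := by ring
      _ ≤ 5 / 4 * (5 / 4 * Λ) := by gcongr; linarith [opNorm_sq_le_one_add B]
  calc s a ≤ ‖M‖ := h.singularValue_le_opNorm a
    _ ≤ ‖B * Matrix.diagonal μ * Bᵀ‖ + ‖M - B * Matrix.diagonal μ * Bᵀ‖ :=
        norm_le_norm_add_norm_sub' _ _
    _ ≤ 2 * Λ + ‖M - B * Matrix.diagonal μ * Bᵀ‖ := by linarith

lemma IsSVD.norm_coordinates_sub_le (h : IsSVD M U s V) (hB : ‖B * Bᵀ - 1‖ ≤ 1 / 4)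
    (a : Fin k) :
    ‖fun j => μ j * (Bᵀ *ᵥ V.col a) j - s a * (Bᵀ *ᵥ U.col a) j‖₂ ≤
      2 * (‖M - B * Matrix.diagonal μ * Bᵀ‖ + s a * ‖B * Bᵀ - 1‖) := by
  set R := M - B * Matrix.diagonal μ * Bᵀ with hR
  set e : Fin k → ℝ := fun j => μ j * (Bᵀ *ᵥ V.col a) j - s a * (Bᵀ *ᵥ U.col a) j
  have he' : e = Matrix.diagonal μ *ᵥ (Bᵀ *ᵥ V.col a) - s a • (Bᵀ *ᵥ U.col a) := by
    ext j
    rw [Pi.sub_apply, Matrix.mulVec_diagonal]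
    rfl
  have hBe : B *ᵥ e = -(R *ᵥ V.col a + s a • ((B * Bᵀ - 1) *ᵥ U.col a)) := by
    have hM := h.mulVec_col a
    rw [he', hR, Matrix.mulVec_sub, Matrix.mulVec_smul, Matrix.sub_mulVec, hM, Matrix.sub_mulVec,
      Matrix.one_mulVec, ← Matrix.mulVec_mulVec, ← Matrix.mulVec_mulVec, ← Matrix.mulVec_mulVec,
      smul_sub]
    abel
  refine (norm_le_two_mul_norm_mulVec hB e).trans ?_
  rw [hBe, WithLp.toLp_neg, norm_neg, WithLp.toLp_add, WithLp.toLp_smul]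
  gcongr
  refine (norm_add_le _ _).trans (add_le_add ?_ ?_)
  · simpa [h.transpose.norm_col_left a] using norm_mulVec_le R (V.col a)
  · rw [norm_smul, Real.norm_of_nonneg (h.nonneg a)]
    exact mul_le_mul_of_nonneg_left
      (by simpa [h.norm_col_left a] using norm_mulVec_le (B * Bᵀ - 1) (U.col a)) (h.nonneg a)

lemma IsSVD.sum_coordinates_sq_le (h : IsSVD M U s V) (hB : ‖B * Bᵀ - 1‖ ≤ 1 / 4)
    (hμ : ∀ j, |μ j| ≤ 5 / 4 * Λ) {G : ℝ} (hG : 0 < G) {a : Fin k} {J : Finset (Fin k)}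
    (hJ : ∀ j ∈ J, G ≤ |(|μ j| - s a)|) :
    ∑ j ∈ J, (Bᵀ *ᵥ U.col a) j ^ 2 ≤
      (2 * (3 * ‖M - B * Matrix.diagonal μ * Bᵀ‖ + 4 * Λ * ‖B * Bᵀ - 1‖) / G) ^ 2 := by
  set ρ := ‖M - B * Matrix.diagonal μ * Bᵀ‖ with hρ
  have hρ' : ‖Mᵀ - B * Matrix.diagonal μ * Bᵀ‖ = ρ := by
    rw [hρ, ← opNorm_transpose]; simp [Matrix.mul_assoc]
  have hs : 2 * (ρ + s a * ‖B * Bᵀ - 1‖) ≤ 3 * ρ + 4 * Λ * ‖B * Bᵀ - 1‖ := by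
    have hρ₀ : 0 ≤ ρ := norm_nonneg _
    nlinarith [h.singularValue_le_add hB hμ a, norm_nonneg (B * Bᵀ - 1), h.nonneg a]
  refine sum_sq_le_of_le_abs_abs_sub (h.nonneg a) hG ?_
    ((h.norm_coordinates_sub_le hB a).trans hs) hJ
  exact (h.transpose.norm_coordinates_sub_le hB a).trans (by rwa [hρ'])

lemma IsSVD.exists_perm_sum_erase_sq_le (h : IsSVD M U s V) (hB : ‖B * Bᵀ - 1‖ ≤ 1 / 4)
    (hμ : ∀ j, |μ j| ≤ 5 / 4 * Λ) (hΔ : 0 < Δ) (hgap : ∀ i j, i ≠ j → Δ ≤ |(|μ i| - |μ j|)|)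
    (hη₀ : 0 ≤ η) (hη : η ≤ 1 / 4)
    (hMη : 4 * (3 * ‖M - B * Matrix.diagonal μ * Bᵀ‖ + 4 * Λ * ‖B * Bᵀ - 1‖) ≤ η * Δ) :
    ∃ τ : Equiv.Perm (Fin k), ∀ i,
      ∑ j ∈ Finset.univ.erase i, (Bᵀ *ᵥ U.col (τ i)) j ^ 2 ≤ η ^ 2 := by
  have hfar : ∀ (a : Fin k) (J : Finset (Fin k)), (∀ j ∈ J, Δ / 2 ≤ |(|μ j| - s a)|) →
      ∑ j ∈ J, (Bᵀ *ᵥ U.col a) j ^ 2 ≤ η ^ 2 := fun a J hJ => by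
    have hΛ : 0 ≤ Λ := by linarith [(abs_nonneg _).trans (hμ a)]
    refine (h.sum_coordinates_sq_le hB hμ (half_pos hΔ) hJ).trans
      (pow_le_pow_left₀ (by positivity) ?_ 2)
    rw [div_le_iff₀ (half_pos hΔ)]
    linarith
  have hrow : ∀ a, 3 / 4 ≤ ∑ j, (Bᵀ *ᵥ U.col a) j ^ 2 := fun a => by
    have ha := (abs_le.1 (abs_norm_transpose_mulVec_sq_sub_le B (U.col a))).1
    rw [h.norm_col_left, EuclideanSpace.real_norm_sq_eq] at ha
    linarith
  have hcol : ∀ j, ∑ a, (Bᵀ *ᵥ U.col a) j ^ 2 ≤ 5 / 4 := fun j => by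
    calc ∑ a, (Bᵀ *ᵥ U.col a) j ^ 2 = ‖B.col j‖₂ ^ 2 := by
          rw [h.norm_sq_eq_sum]
          exact Finset.sum_congr rfl fun a _ => congrArg (· ^ 2) (dotProduct_comm _ _)
      _ ≤ ‖B‖ ^ 2 := by gcongr; exact norm_col_le_opNorm B j
      _ ≤ 5 / 4 := by linarith [opNorm_sq_le_one_add B]
  refine exists_perm_forall_sum_erase_sq_le hη₀ hη hrow hcol fun a => ?_
  obtain ⟨i, hi⟩ : ∃ i, |(|μ i| - s a)| < Δ / 2 := by
    by_contra! hcon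
    nlinarith [hfar a Finset.univ fun j _ => hcon j, hrow a]
  refine ⟨i, hfar a _ fun j hj => ?_⟩
  have hji : Δ ≤ |(|μ j| - s a) - (|μ i| - s a)| := by
    rw [sub_sub_sub_cancel_right]; exact hgap j i (Finset.ne_of_mem_erase hj)
  linarith [abs_sub (|μ j| - s a) (|μ i| - s a)]

end SingularVectors

/-! ### Reconstruction of the topics -/

section CubicForms

variable {d k : ℕ}

/-- The cubic form `u ↦ uᵀ T(u) u` of a matrix-valued map `T`; its value at `W v` determines the
scale `Ẑ` of the reconstruction. -/
def cubicForm (T : (Fin d → ℝ) → Matrix (Fin d) (Fin d) ℝ) (u : Fin d → ℝ) : ℝ :=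
  u ⬝ᵥ (T u *ᵥ u)

lemma reconstruct_eq (α₀ : ℝ) (T : (Fin d → ℝ) → Matrix (Fin d) (Fin d) ℝ)
    (W : Matrix (Fin d) (Fin k) ℝ) (v : Fin k → ℝ) :
    reconstruct α₀ T W v = (pinv W)ᵀ *ᵥ (((α₀ + 2) / 2 * cubicForm T (W *ᵥ v)) • v) := by
  rw [reconstruct, scale, inv_div, Matrix.mulVec_smul, cubicForm]
  congr 1
  ring

open scoped Matrix.Norms.L2Operator

lemma opNorm_le_of_forall_abs_dotProduct_le {m n : Type*} [Fintype m] [Fintype n] [DecidableEq n]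
    {A : Matrix m n ℝ} {c : ℝ} (hc : 0 ≤ c)
    (hA : ∀ x y, |x ⬝ᵥ (A *ᵥ y)| ≤ c * (‖x‖₂ * ‖y‖₂)) : ‖A‖ ≤ c := by
  refine opNorm_le_of_forall hc fun y => ?_
  have h := hA (A *ᵥ y) y
  rw [← norm_sq_eq_dotProduct, abs_of_nonneg (sq_nonneg _)] at h
  obtain h₀ | h₀ := (norm_nonneg (WithLp.toLp 2 (A *ᵥ y))).eq_or_lt
  · rw [← h₀]; positivity
  · nlinarith

variable {T T' : (Fin d → ℝ) → Matrix (Fin d) (Fin d) ℝ} {F : ℝ}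
  {W : Matrix (Fin d) (Fin k) ℝ} {v : Fin k → ℝ}

lemma opNorm_transpose_mul_sub_mul_le (hF : 0 ≤ F)
    (hT : ∀ η x y, |x ⬝ᵥ ((T η - T' η) *ᵥ y)| ≤ F * (‖x‖₂ * (‖y‖₂ * ‖η‖₂))) (hv : ‖v‖₂ = 1) :
    ‖Wᵀ * (T (W *ᵥ v) - T' (W *ᵥ v)) * W‖ ≤ F * ‖W‖ ^ 3 := by
  refine opNorm_le_of_forall_abs_dotProduct_le (by positivity) fun x y => ?_
  have hxy : x ⬝ᵥ ((Wᵀ * (T (W *ᵥ v) - T' (W *ᵥ v)) * W) *ᵥ y) =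
      (W *ᵥ x) ⬝ᵥ ((T (W *ᵥ v) - T' (W *ᵥ v)) *ᵥ (W *ᵥ y)) := by
    rw [Matrix.mul_assoc, ← Matrix.mulVec_mulVec, dotProduct_mulVec_eq_transpose,
      Matrix.transpose_transpose, ← Matrix.mulVec_mulVec]
  calc |x ⬝ᵥ ((Wᵀ * (T (W *ᵥ v) - T' (W *ᵥ v)) * W) *ᵥ y)|
      ≤ F * (‖W *ᵥ x‖₂ * (‖W *ᵥ y‖₂ * ‖W *ᵥ v‖₂)) := by rw [hxy]; exact hT _ _ _
    _ ≤ F * ((‖W‖ * ‖x‖₂) * ((‖W‖ * ‖y‖₂) * (‖W‖ * ‖v‖₂))) := by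
        gcongr <;> exact norm_mulVec_le _ _
    _ = F * ‖W‖ ^ 3 * (‖x‖₂ * ‖y‖₂) := by rw [hv]; ring

lemma abs_cubicForm_sub_le (hF : 0 ≤ F)
    (hT : ∀ η x y, |x ⬝ᵥ ((T η - T' η) *ᵥ y)| ≤ F * (‖x‖₂ * (‖y‖₂ * ‖η‖₂))) (hv : ‖v‖₂ = 1) :
    |cubicForm T (W *ᵥ v) - cubicForm T' (W *ᵥ v)| ≤ F * ‖W‖ ^ 3 := by
  rw [cubicForm, cubicForm, ← dotProduct_sub, ← Matrix.sub_mulVec]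
  calc |(W *ᵥ v) ⬝ᵥ ((T (W *ᵥ v) - T' (W *ᵥ v)) *ᵥ (W *ᵥ v))|
      ≤ F * (‖W *ᵥ v‖₂ * (‖W *ᵥ v‖₂ * ‖W *ᵥ v‖₂)) := hT _ _ _
    _ ≤ F * ((‖W‖ * ‖v‖₂) * ((‖W‖ * ‖v‖₂) * (‖W‖ * ‖v‖₂))) := by
        gcongr <;> exact norm_mulVec_le _ _
    _ = F * ‖W‖ ^ 3 := by rw [hv]; ring

end CubicForms

section WeightedCubes

variable {ι : Type*} [Fintype ι] {a c : ι → ℝ} {Λ : ℝ}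

lemma abs_sum_mul_pow_three_le (hΛ : 0 ≤ Λ) (ha : ∀ j, |a j| ≤ Λ) (c : ι → ℝ) :
    |∑ j, a j * c j ^ 3| ≤ Λ * ‖c‖₂ ^ 3 :=
  calc |∑ j, a j * c j ^ 3| ≤ ∑ j, |a j| * (|c j| * c j ^ 2) := by
        refine (Finset.abs_sum_le_sum_abs _ _).trans_eq (Finset.sum_congr rfl fun j _ => ?_)
        rw [abs_mul, abs_pow, ← sq_abs (c j)]
        ring
    _ ≤ ∑ j, Λ * (‖c‖₂ * c j ^ 2) := by
        gcongr with j
        · exact ha j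
        · exact PiLp.norm_apply_le (WithLp.toLp 2 c) j
    _ = Λ * ‖c‖₂ ^ 3 := by
        rw [← Finset.mul_sum, ← Finset.mul_sum, pow_succ' ‖c‖₂ 2, EuclideanSpace.real_norm_sq_eq]

lemma abs_sum_mul_pow_three_sub_le [DecidableEq ι] (ha : ∀ j, |a j| ≤ Λ) {ς ζ : ℝ}
    (hς : ς ^ 2 = 1) (hζ : ζ ≤ 1) {i : ι} (hc : ‖c - ς • Pi.single i 1‖₂ ≤ ζ) :
    |∑ j, a j * c j ^ 3 - ς * a i| ≤ 7 * Λ * ζ := by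
  have hΛ : 0 ≤ Λ := (abs_nonneg _).trans (ha i)
  have hς₁ : |ς| = 1 := by rwa [← sq_eq_sq₀ (abs_nonneg _) zero_le_one, sq_abs, one_pow]
  set x : ι → ℝ := c - ς • Pi.single i 1 with hx
  have hζ₀ : 0 ≤ ζ := (norm_nonneg _).trans hc
  have hxi : |x i| ≤ ζ := (PiLp.norm_apply_le (WithLp.toLp 2 x) i).trans hc
  have hexpand : ∑ j, a j * c j ^ 3 - ς * a i =
      a i * (3 * x i + 3 * ς * x i ^ 2) + ∑ j, a j * x j ^ 3 := by
    have herase : ∑ j ∈ Finset.univ.erase i, a j * c j ^ 3 =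
        ∑ j ∈ Finset.univ.erase i, a j * x j ^ 3 :=
      Finset.sum_congr rfl fun j hj => by
        simp [hx, Pi.single_eq_of_ne (Finset.ne_of_mem_erase hj)]
    have hci : c i = ς + x i := by simp [hx]
    rw [← Finset.add_sum_erase _ _ (Finset.mem_univ i),
      ← Finset.add_sum_erase _ (fun j => a j * x j ^ 3) (Finset.mem_univ i), herase, hci]
    linear_combination (a i * ς + 3 * a i * x i) * hς
  have hlow : |3 * x i + 3 * ς * x i ^ 2| ≤ 6 * ζ :=
    calc |3 * x i + 3 * ς * x i ^ 2| ≤ 3 * |x i| + 3 * |x i| ^ 2 := by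
          refine (abs_add_le _ _).trans_eq ?_
          simp [abs_mul, hς₁]
      _ ≤ 6 * ζ := by nlinarith [abs_nonneg (x i)]
  have hcube : ‖x‖₂ ^ 3 ≤ ζ :=
    (pow_le_pow_left₀ (norm_nonneg _) hc 3).trans (pow_le_of_le_one hζ₀ hζ three_ne_zero)
  calc |∑ j, a j * c j ^ 3 - ς * a i|
      ≤ |a i| * |3 * x i + 3 * ς * x i ^ 2| + |∑ j, a j * x j ^ 3| := by
        rw [hexpand, ← abs_mul]; exact abs_add_le _ _
    _ ≤ Λ * (6 * ζ) + Λ * ‖x‖₂ ^ 3 := by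
        gcongr
        · exact ha i
        · exact abs_sum_mul_pow_three_le hΛ ha x
    _ ≤ Λ * (6 * ζ) + Λ * ζ := by gcongr
    _ = 7 * Λ * ζ := by ring

end WeightedCubes

section WhitenedTopics

variable {d k : ℕ}

/-- The whitened topics: the columns are `√(Dᵢ) Wᵀ Oᵢ`, where `D = topicWeight α`. They are
orthonormal when `W` whitens the population pairs `O diag(D) Oᵀ` exactly. -/
def whitenedTopics (α : Fin k → ℝ) (O W : Matrix (Fin d) (Fin k) ℝ) : Matrix (Fin k) (Fin k) ℝ :=
  Wᵀ * O * Matrix.diagonal fun i => √(topicWeight α i)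

/-- The coefficients of the population third moment in terms of the whitened topics. -/
def whitenedCoeff (α : Fin k → ℝ) (i : Fin k) : ℝ :=
  2 / ((∑ a, α a + 2) * √(topicWeight α i))

variable {α : Fin k → ℝ} {O W : Matrix (Fin d) (Fin k) ℝ}

lemma sum_pos_of_forall_pos (hα : ∀ i, 0 < α i) (i : Fin k) : 0 < ∑ a, α a :=
  Finset.sum_pos (fun a _ => hα a) ⟨i, Finset.mem_univ i⟩

lemma topicWeight_pos (hα : ∀ i, 0 < α i) (i : Fin k) : 0 < topicWeight α i := by
  have hs := sum_pos_of_forall_pos hα i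
  have hi := hα i
  unfold topicWeight
  positivity

lemma whitenedCoeff_mul_sqrt_topicWeight (hα : ∀ i, 0 < α i) (i : Fin k) :
    whitenedCoeff α i * √(topicWeight α i) = 2 / (∑ a, α a + 2) := by
  have hD := Real.sqrt_pos.2 (topicWeight_pos hα i)
  have hs := sum_pos_of_forall_pos hα i
  rw [whitenedCoeff]
  field_simp

lemma whitenedTopics_mul_transpose (hα : ∀ i, 0 < α i) :
    whitenedTopics α O W * (whitenedTopics α O W)ᵀ = Wᵀ * popPairs α O * W := by
  have hD : Matrix.diagonal (topicWeight α) = Matrix.diagonal (fun i => √(topicWeight α i)) *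
      Matrix.diagonal fun i => √(topicWeight α i) := by
    rw [Matrix.diagonal_mul_diagonal]
    simp_rw [Real.mul_self_sqrt (topicWeight_pos hα _).le]
  rw [popPairs, hD]
  simp only [whitenedTopics, Matrix.transpose_mul, Matrix.transpose_transpose,
    Matrix.diagonal_transpose, Matrix.mul_assoc]

lemma transpose_whitenedTopics_mulVec_apply (v : Fin k → ℝ) (j : Fin k) :
    ((whitenedTopics α O W)ᵀ *ᵥ v) j = √(topicWeight α j) * (Oᵀ *ᵥ (W *ᵥ v)) j := by
  have hB : (whitenedTopics α O W)ᵀ =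
      Matrix.diagonal (fun i => √(topicWeight α i)) * (Oᵀ * W) := by
    simp [whitenedTopics]
  rw [hB, ← Matrix.mulVec_mulVec, Matrix.mulVec_diagonal, Matrix.mulVec_mulVec]

lemma transpose_mul_popTriples_mul (hα : ∀ i, 0 < α i) (v : Fin k → ℝ) :
    Wᵀ * popTriples α O (W *ᵥ v) * W = whitenedTopics α O W *
      Matrix.diagonal (fun j => whitenedCoeff α j * ((whitenedTopics α O W)ᵀ *ᵥ v) j) *
        (whitenedTopics α O W)ᵀ := by
  have hdiag : Matrix.diagonal
        (fun i => 2 / (∑ a, α a + 2) * topicWeight α i * (Oᵀ *ᵥ (W *ᵥ v)) i) =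
      Matrix.diagonal (fun i => √(topicWeight α i)) *
        (Matrix.diagonal (fun j => whitenedCoeff α j * ((whitenedTopics α O W)ᵀ *ᵥ v) j) *
        Matrix.diagonal fun i => √(topicWeight α i)) := by
    rw [Matrix.diagonal_mul_diagonal, Matrix.diagonal_mul_diagonal]
    congr 1
    ext i
    rw [transpose_whitenedTopics_mulVec_apply, ← whitenedCoeff_mul_sqrt_topicWeight hα i]
    nth_rewrite 2 [← Real.mul_self_sqrt (topicWeight_pos hα i).le]
    ring
  rw [popTriples, hdiag]
  generalize (fun j => whitenedCoeff α j * ((whitenedTopics α O W)ᵀ *ᵥ v) j) = f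
  simp only [whitenedTopics, Matrix.transpose_mul, Matrix.transpose_transpose,
    Matrix.diagonal_transpose, Matrix.mul_assoc]

lemma cubicForm_popTriples (hα : ∀ i, 0 < α i) (v : Fin k → ℝ) :
    cubicForm (popTriples α O) (W *ᵥ v) =
      ∑ j, whitenedCoeff α j * ((whitenedTopics α O W)ᵀ *ᵥ v) j ^ 3 := by
  rw [cubicForm, popTriples, dotProduct_mul_diagonal_mul_transpose_mulVec]
  refine Finset.sum_congr rfl fun j _ => ?_
  rw [transpose_whitenedTopics_mulVec_apply, ← whitenedCoeff_mul_sqrt_topicWeight hα j]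
  nth_rewrite 2 [← Real.mul_self_sqrt (topicWeight_pos hα j).le]
  ring

lemma transpose_mulVec_col_eq_smul (hα : ∀ i, 0 < α i) (i : Fin k) :
    Wᵀ *ᵥ O.col i = ((∑ a, α a + 2) / 2 * whitenedCoeff α i) • (whitenedTopics α O W).col i := by
  have hs := sum_pos_of_forall_pos hα i
  have hcol : (whitenedTopics α O W).col i = √(topicWeight α i) • (Wᵀ *ᵥ O.col i) := by
    ext a
    rw [Matrix.col_apply, whitenedTopics, Matrix.mul_diagonal, mul_comm]
    rfl
  rw [hcol, smul_smul, mul_assoc, whitenedCoeff_mul_sqrt_topicWeight hα, div_mul_div_cancel₀' (by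
    positivity), div_self two_ne_zero, one_smul]

end WhitenedTopics

section RescaledVectors

open scoped Matrix.Norms.L2Operator

variable {n : Type*} [Fintype n] {v : n → ℝ} {ς : ℝ}

lemma norm_smul_sub_smul_le (hς : ς ^ 2 = 1) (hv : ‖v‖₂ = 1) (a K : ℝ) (b : n → ℝ) :
    ‖a • b - K • v‖₂ ≤ |K - ς * a| + |a| * ‖v - ς • b‖₂ := by
  have hς₁ : |ς| = 1 := by rwa [← sq_eq_sq₀ (abs_nonneg _) zero_le_one, sq_abs, one_pow]
  have hsplit : a • b - K • v = (-(K - ς * a)) • v - (ς * a) • (v - ς • b) := by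
    ext j
    simp only [Pi.sub_apply, Pi.smul_apply, smul_eq_mul]
    linear_combination -(a * b j) * hς
  rw [hsplit, WithLp.toLp_sub]
  refine (norm_sub_le _ _).trans_eq ?_
  rw [WithLp.toLp_smul, WithLp.toLp_smul, norm_smul, norm_smul, hv, norm_neg, norm_mul,
    Real.norm_eq_abs, Real.norm_eq_abs, Real.norm_eq_abs, hς₁, mul_one, one_mul]

variable [DecidableEq n] {B : Matrix n n ℝ}

lemma norm_sub_smul_col_le {ζ : ℝ} (hB : ‖B * Bᵀ - 1‖ ≤ 1 / 4) (hv : ‖v‖₂ = 1) {i : n}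
    (hc : ‖Bᵀ *ᵥ v - ς • Pi.single i 1‖₂ ≤ ζ) :
    ‖v - ς • B.col i‖₂ ≤ 9 / 8 * ζ + ‖B * Bᵀ - 1‖ := by
  have hsplit : v - ς • B.col i =
      B *ᵥ (Bᵀ *ᵥ v - ς • Pi.single i 1) - (B * Bᵀ - 1) *ᵥ v := by
    rw [Matrix.mulVec_sub, Matrix.mulVec_smul, Matrix.mulVec_single_one, Matrix.sub_mulVec,
      Matrix.one_mulVec, Matrix.mulVec_mulVec]
    abel
  rw [hsplit, WithLp.toLp_sub]
  refine (norm_sub_le _ _).trans (add_le_add ?_ ?_)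
  · refine (norm_mulVec_le _ _).trans ?_
    gcongr
    exact opNorm_le_of_opNorm_mul_transpose_sub_one_le hB
  · simpa [hv] using norm_mulVec_le (B * Bᵀ - 1) v

end RescaledVectors

section ReconstructionError

open scoped Matrix.Norms.L2Operator

variable {d k : ℕ} {α : Fin k → ℝ} {O W : Matrix (Fin d) (Fin k) ℝ}
  {T : (Fin d → ℝ) → Matrix (Fin d) (Fin d) ℝ} {F Λ : ℝ} {v : Fin k → ℝ}

lemma norm_col_sub_reconstruct_le (hα : ∀ i, 0 < α i) (v : Fin k → ℝ) (i : Fin k) :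
    ‖O.col i - reconstruct (∑ a, α a) T W v‖₂ ≤ ‖O.col i - (pinv W)ᵀ *ᵥ (Wᵀ *ᵥ O.col i)‖₂ +
      ‖(pinv W)ᵀ‖ * ((∑ a, α a + 2) / 2 *
        ‖whitenedCoeff α i • (whitenedTopics α O W).col i - cubicForm T (W *ᵥ v) • v‖₂) := by
  have hs := sum_pos_of_forall_pos hα i
  have hsplit : O.col i - reconstruct (∑ a, α a) T W v =
      (O.col i - (pinv W)ᵀ *ᵥ (Wᵀ *ᵥ O.col i)) + (pinv W)ᵀ *ᵥ (((∑ a, α a + 2) / 2) •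
        (whitenedCoeff α i • (whitenedTopics α O W).col i - cubicForm T (W *ᵥ v) • v)) := by
    rw [smul_sub, smul_smul, smul_smul, ← transpose_mulVec_col_eq_smul hα, Matrix.mulVec_sub,
      reconstruct_eq, sub_add_sub_cancel]
  rw [hsplit, WithLp.toLp_add]
  refine (norm_add_le _ _).trans (add_le_add le_rfl ?_)
  refine (norm_mulVec_le _ _).trans_eq ?_
  rw [WithLp.toLp_smul, norm_smul, Real.norm_of_nonneg (by positivity)]

lemma norm_smul_col_sub_cubicForm_smul_le_of_le_three (hα : ∀ i, 0 < α i) (hF : 0 ≤ F)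
    (hT : ∀ η x y, |x ⬝ᵥ ((T η - popTriples α O η) *ᵥ y)| ≤ F * (‖x‖₂ * (‖y‖₂ * ‖η‖₂)))
    (hΛ : ∀ j, |whitenedCoeff α j| ≤ Λ)
    (hB : ‖whitenedTopics α O W * (whitenedTopics α O W)ᵀ - 1‖ ≤ 3) (hv : ‖v‖₂ = 1) (i : Fin k) :
    ‖whitenedCoeff α i • (whitenedTopics α O W).col i - cubicForm T (W *ᵥ v) • v‖₂ ≤
      F * ‖W‖ ^ 3 + 10 * Λ := by
  set B := whitenedTopics α O W
  have hΛ₀ : 0 ≤ Λ := (abs_nonneg _).trans (hΛ i)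
  have hB₂ : ‖B‖ ≤ 2 := by nlinarith [opNorm_sq_le_one_add B, norm_nonneg B]
  have hBv : ‖Bᵀ *ᵥ v‖₂ ≤ 2 :=
    (norm_mulVec_le Bᵀ v).trans (by rwa [hv, mul_one, opNorm_transpose])
  have hpop : |cubicForm (popTriples α O) (W *ᵥ v)| ≤ Λ * 2 ^ 3 := by
    rw [cubicForm_popTriples hα]
    refine (abs_sum_mul_pow_three_le hΛ₀ hΛ _).trans ?_
    gcongr
  have hcubic : |cubicForm T (W *ᵥ v)| ≤ F * ‖W‖ ^ 3 + 8 * Λ := by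
    linarith [abs_sub_abs_le_abs_sub (cubicForm T (W *ᵥ v)) (cubicForm (popTriples α O) (W *ᵥ v)),
      abs_cubicForm_sub_le (W := W) hF hT hv]
  rw [WithLp.toLp_sub]
  calc _ ≤ |whitenedCoeff α i| * ‖B.col i‖₂ + |cubicForm T (W *ᵥ v)| := by
        refine (norm_sub_le _ _).trans_eq ?_
        rw [WithLp.toLp_smul, WithLp.toLp_smul, norm_smul, norm_smul, hv, mul_one,
          Real.norm_eq_abs, Real.norm_eq_abs]
    _ ≤ Λ * 2 + (F * ‖W‖ ^ 3 + 8 * Λ) := by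
        gcongr
        · exact hΛ i
        · exact (norm_col_le_opNorm B i).trans hB₂
    _ = F * ‖W‖ ^ 3 + 10 * Λ := by ring

lemma norm_smul_col_sub_cubicForm_smul_le_of_norm_sub_single_le (hα : ∀ i, 0 < α i) (hF : 0 ≤ F)
    (hT : ∀ η x y, |x ⬝ᵥ ((T η - popTriples α O η) *ᵥ y)| ≤ F * (‖x‖₂ * (‖y‖₂ * ‖η‖₂)))
    (hΛ : ∀ j, |whitenedCoeff α j| ≤ Λ)
    (hB : ‖whitenedTopics α O W * (whitenedTopics α O W)ᵀ - 1‖ ≤ 1 / 4) (hv : ‖v‖₂ = 1)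
    {ς ζ : ℝ} (hς : ς ^ 2 = 1) (hζ : ζ ≤ 1)
    (hBζ : ‖whitenedTopics α O W * (whitenedTopics α O W)ᵀ - 1‖ ≤ ζ) {i : Fin k}
    (hc : ‖(whitenedTopics α O W)ᵀ *ᵥ v - ς • Pi.single i 1‖₂ ≤ ζ) :
    ‖whitenedCoeff α i • (whitenedTopics α O W).col i - cubicForm T (W *ᵥ v) • v‖₂ ≤
      F * ‖W‖ ^ 3 + 10 * Λ * ζ := by
  have hΛ₀ : 0 ≤ Λ := (abs_nonneg _).trans (hΛ i)
  have hcubic : |cubicForm T (W *ᵥ v) - ς * whitenedCoeff α i| ≤ F * ‖W‖ ^ 3 + 7 * Λ * ζ :=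
    (abs_sub_le _ (cubicForm (popTriples α O) (W *ᵥ v)) _).trans <| add_le_add
      (abs_cubicForm_sub_le hF hT hv)
      (by rw [cubicForm_popTriples hα]; exact abs_sum_mul_pow_three_sub_le hΛ hς hζ hc)
  have hclose : ‖v - ς • (whitenedTopics α O W).col i‖₂ ≤ 3 * ζ := by
    linarith [norm_sub_smul_col_le hB hv hc, (norm_nonneg _).trans hc]
  calc _ ≤ |cubicForm T (W *ᵥ v) - ς * whitenedCoeff α i| +
        |whitenedCoeff α i| * ‖v - ς • (whitenedTopics α O W).col i‖₂ :=
        norm_smul_sub_smul_le hς hv _ _ _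
    _ ≤ (F * ‖W‖ ^ 3 + 7 * Λ * ζ) + Λ * (3 * ζ) := by
        gcongr
        exact hΛ i
    _ = F * ‖W‖ ^ 3 + 10 * Λ * ζ := by ring

lemma IsLeftSingularFamily.norm_eq_one {M : Matrix (Fin k) (Fin k) ℝ} {v : Fin k → Fin k → ℝ}
    (hv : IsLeftSingularFamily M v) (i : Fin k) : ‖v i‖₂ = 1 := by
  obtain ⟨U, s, V, hsvd, hvU⟩ := hv
  rw [hvU, hsvd.norm_col_left]

lemma IsLeftSingularFamily.exists_perm_norm_smul_col_sub_cubicForm_smul_le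
    (hα : ∀ i, 0 < α i) (hF : 0 ≤ F)
    (hT : ∀ η x y, |x ⬝ᵥ ((T η - popTriples α O η) *ᵥ y)| ≤ F * (‖x‖₂ * (‖y‖₂ * ‖η‖₂)))
    (hΛ : ∀ j, |whitenedCoeff α j| ≤ Λ)
    (hB : ‖whitenedTopics α O W * (whitenedTopics α O W)ᵀ - 1‖ ≤ 1 / 4)
    {θ : Fin k → ℝ} (hθ : ‖θ‖₂ = 1) {Δ η : ℝ} (hΔ : 0 < Δ)
    (hgap : ∀ i j, i ≠ j → Δ ≤ |(|whitenedCoeff α i * ((whitenedTopics α O W)ᵀ *ᵥ θ) i| -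
      |whitenedCoeff α j * ((whitenedTopics α O W)ᵀ *ᵥ θ) j|)|)
    (hη₀ : 0 ≤ η) (hη : η ≤ 1 / 4)
    (hΔη : 4 * (3 * (F * ‖W‖ ^ 3) +
      4 * Λ * ‖whitenedTopics α O W * (whitenedTopics α O W)ᵀ - 1‖) ≤ η * Δ)
    {v : Fin k → Fin k → ℝ} (hv : IsLeftSingularFamily (Wᵀ * T (W *ᵥ θ) * W) v) :
    ∃ τ : Equiv.Perm (Fin k), ∀ i, ‖whitenedCoeff α i • (whitenedTopics α O W).col i -
        cubicForm T (W *ᵥ v (τ i)) • v (τ i)‖₂ ≤ F * ‖W‖ ^ 3 +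
      10 * Λ * (‖whitenedTopics α O W * (whitenedTopics α O W)ᵀ - 1‖ + 2 * η) := by
  have hv₁ := hv.norm_eq_one
  obtain ⟨U, s, V, hsvd, hvU⟩ := hv
  set B := whitenedTopics α O W with hBdef
  have hnoise : ‖Wᵀ * T (W *ᵥ θ) * W -
      B * Matrix.diagonal (fun j => whitenedCoeff α j * (Bᵀ *ᵥ θ) j) * Bᵀ‖ ≤ F * ‖W‖ ^ 3 := by
    rw [hBdef, ← transpose_mul_popTriples_mul hα, ← Matrix.sub_mul, ← Matrix.mul_sub]
    exact opNorm_transpose_mul_sub_mul_le hF hT hθ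
  have hμ (j : Fin k) : |whitenedCoeff α j * (Bᵀ *ᵥ θ) j| ≤ 5 / 4 * Λ := by
    have hBθ : ‖Bᵀ *ᵥ θ‖₂ ≤ 5 / 4 := by
      refine (norm_mulVec_le Bᵀ θ).trans ?_
      rw [hθ, mul_one, opNorm_transpose]
      linarith [opNorm_le_of_opNorm_mul_transpose_sub_one_le hB]
    rw [abs_mul, mul_comm (5 / 4)]
    exact mul_le_mul (hΛ j) ((PiLp.norm_apply_le (WithLp.toLp 2 (Bᵀ *ᵥ θ)) j).trans hBθ)
      (abs_nonneg _) ((abs_nonneg _).trans (hΛ j))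
  obtain ⟨τ, hτ⟩ := hsvd.exists_perm_sum_erase_sq_le hB hμ hΔ hgap hη₀ hη
    (by linarith [hΔη])
  refine ⟨τ, fun i => ?_⟩
  have hc : |‖Bᵀ *ᵥ v (τ i)‖₂ ^ 2 - 1| ≤ ‖B * Bᵀ - 1‖ := by
    simpa [hv₁] using abs_norm_transpose_mulVec_sq_sub_le B (v (τ i))
  obtain ⟨ς, hς, hclose⟩ := exists_sign_norm_sub_single_le (norm_nonneg _) hη₀ hη hc
    (by rw [hvU]; exact hτ i)
  exact norm_smul_col_sub_cubicForm_smul_le_of_norm_sub_single_le hα hF hT hΛ hB (hv₁ _) hς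
    (by linarith) (by linarith) hclose

end ReconstructionError

section SingularValueGap

open scoped Matrix.Norms.L2Operator

/-- A sign attached to an ordered pair of distinct indices which is reversed when the pair is, so
that `x i + orderSign i j * x j` runs over the sums and the differences of two coordinates. -/
def orderSign {ι : Type*} [LinearOrder ι] (i j : ι) : ℝ :=
  if i < j then 1 else -1

lemma le_abs_abs_sub_abs_of_forall_orderSign {ι : Type*} [LinearOrder ι] {x : ι → ℝ} {Δ : ℝ}
    (hx : ∀ i j, i ≠ j → Δ ≤ |x i + orderSign i j * x j|) {i j : ι} (hij : i ≠ j) :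
    Δ ≤ |(|x i| - |x j|)| := by
  wlog hlt : i < j generalizing i j
  · rw [abs_sub_comm]
    exact this hij.symm (lt_of_le_of_ne (not_lt.1 hlt) hij.symm)
  have hadd : Δ ≤ |x i + x j| := by simpa [orderSign, hlt] using hx i j hij
  have hsub : Δ ≤ |x i - x j| := by
    rw [abs_sub_comm]
    simpa [orderSign, hlt.not_gt, sub_eq_add_neg] using hx j i hij.symm
  obtain hi | hi := abs_choice (x i) <;> obtain hj | hj := abs_choice (x j) <;> rw [hi, hj]
  · exact hsub
  · rwa [sub_neg_eq_add]
  · rwa [← neg_add', abs_neg]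
  · rwa [neg_sub_neg, abs_sub_comm]

variable {k : ℕ} [NeZero k] {B : Matrix (Fin k) (Fin k) ℝ} {a : Fin k → ℝ} {L : ℝ}

lemma sphereUniform_forall_le_abs_abs_sub_abs (hB : ‖B * Bᵀ - 1‖ ≤ 1 / 4) (hL : 0 < L)
    (ha : ∀ i, L ≤ a i) :
    3 / 4 < (sphereUniform k).real {θ | ∀ i j, i ≠ j → L / (64 * k ^ 3) ≤
      |(|a i * (Bᵀ *ᵥ θ.1) i| - |a j * (Bᵀ *ᵥ θ.1) j|)|} := by
  let x (p : Fin k × Fin k) : Fin k → ℝ :=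
    a p.1 • Pi.single p.1 1 + (orderSign p.1 p.2 * a p.2) • Pi.single p.2 1
  let u (p : Fin k × Fin k) : EuclideanSpace ℝ (Fin k) := WithLp.toLp 2 (B *ᵥ x p)
  have hu : ∀ p ∈ (Finset.univ : Finset (Fin k)).offDiag, L / 2 ≤ ‖u p‖ := by
    rintro ⟨i, j⟩ hp
    have hij : i ≠ j := (Finset.mem_offDiag.1 hp).2.2
    have hi : |a i| ≤ ‖x (i, j)‖₂ := by
      simpa [x, Pi.single_eq_of_ne hij] using PiLp.norm_apply_le (WithLp.toLp 2 (x (i, j))) i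
    have hx : ‖x (i, j)‖₂ ≤ 2 * ‖u (i, j)‖ := norm_le_two_mul_norm_mulVec hB _
    linarith [le_abs_self (a i), ha i]
  have hinner (p : Fin k × Fin k) (θ : EuclideanSpace ℝ (Fin k)) : inner ℝ (u p) θ =
      a p.1 * (Bᵀ *ᵥ θ) p.1 + orderSign p.1 p.2 * (a p.2 * (Bᵀ *ᵥ θ) p.2) := by
    rw [EuclideanSpace.inner_eq_star_dotProduct, star_trivial, dotProduct_mulVec_eq_transpose,
      dotProduct_add, dotProduct_smul, dotProduct_smul, dotProduct_single_one,
      dotProduct_single_one, smul_eq_mul, smul_eq_mul, mul_assoc]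
  have hcard : (Finset.univ : Finset (Fin k)).offDiag.card < k ^ 2 := by
    have hk := Nat.pos_of_ne_zero (NeZero.ne k)
    rw [Finset.offDiag_card, Finset.card_univ, Fintype.card_fin, sq]
    exact Nat.sub_lt (Nat.mul_pos hk hk) hk
  refine (sphereUniform_forall_le_abs_inner hcard fun p hp => norm_pos_iff.1
    ((half_pos hL).trans_le (hu p hp))).trans_le (measureReal_mono ?_)
  intro θ hθ _ _ hne
  refine le_abs_abs_sub_abs_of_forall_orderSign (x := fun i => a i * (Bᵀ *ᵥ θ.1) i)
    (fun i j hij => ?_) hne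
  have hp : (i, j) ∈ (Finset.univ : Finset (Fin k)).offDiag := by simp [hij]
  calc L / (64 * k ^ 3) = L / 2 / (32 * k ^ 3) := by rw [div_div]; ring_nf
    _ ≤ ‖u (i, j)‖ / (32 * k ^ 3) := by gcongr; exact hu _ hp
    _ ≤ _ := (hθ _ hp).trans_eq (congrArg abs (hinner (i, j) θ))

end SingularValueGap

/-! ### Accuracy of the empirical algorithm -/

section TopicWeights

variable {k : ℕ} {α : Fin k → ℝ}

lemma pMin_le (α : Fin k → ℝ) (i : Fin k) : pMin α ≤ α i / ∑ j, α j :=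
  ciInf_le (Set.finite_range _).bddBelow i

lemma pMin_div_le_topicWeight (hα : ∀ i, 0 < α i) (i : Fin k) :
    pMin α / (∑ j, α j + 1) ≤ topicWeight α i := by
  have hs := sum_pos_of_forall_pos hα i
  unfold topicWeight
  gcongr
  exact pMin_le α i

variable [NeZero k]

lemma pMin_pos (hα : ∀ i, 0 < α i) : 0 < pMin α := by
  obtain ⟨i, hi⟩ := exists_eq_ciInf_of_finite (f := fun i => α i / ∑ j, α j)
  rw [pMin, ← hi]
  exact div_pos (hα i) (sum_pos_of_forall_pos hα i)

lemma pMin_le_one (hα : ∀ i, 0 < α i) : pMin α ≤ 1 :=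
  (pMin_le α 0).trans <| div_le_one_of_le₀
    (Finset.single_le_sum (fun j _ => (hα j).le) (Finset.mem_univ _))
    (sum_pos_of_forall_pos hα 0).le

lemma sum_topicWeight (hα : ∀ i, 0 < α i) : ∑ i, topicWeight α i = 1 / (∑ i, α i + 1) := by
  simp only [topicWeight]
  rw [← Finset.sum_div, ← Finset.sum_div, div_self (sum_pos_of_forall_pos hα 0).ne']

lemma topicWeight_le (hα : ∀ i, 0 < α i) (i : Fin k) : topicWeight α i ≤ 1 / (∑ j, α j + 1) :=
  sum_topicWeight hα ▸
    Finset.single_le_sum (fun j _ => (topicWeight_pos hα j).le) (Finset.mem_univ i)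

lemma one_div_sqrt_le_whitenedCoeff (hα : ∀ i, 0 < α i) (i : Fin k) :
    1 / √(∑ j, α j + 1) ≤ whitenedCoeff α i := by
  have hs := sum_pos_of_forall_pos hα i
  have hA : 0 < √(∑ j, α j + 1) := Real.sqrt_pos.2 (by linarith)
  have hD : √(topicWeight α i) ≤ 1 / √(∑ j, α j + 1) := by
    rw [one_div, ← Real.sqrt_inv, ← one_div]
    exact Real.sqrt_le_sqrt (topicWeight_le hα i)
  have hD₀ := Real.sqrt_pos.2 (topicWeight_pos hα i)
  rw [whitenedCoeff, div_le_div_iff₀ hA (by positivity), one_mul]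
  rw [le_div_iff₀ hA] at hD
  nlinarith [Real.sq_sqrt (by linarith : 0 ≤ ∑ j, α j + 1)]

lemma whitenedCoeff_le (hα : ∀ i, 0 < α i) (i : Fin k) :
    whitenedCoeff α i ≤ 2 * √(∑ j, α j + 1) / ((∑ j, α j + 2) * √(pMin α)) := by
  have hs := sum_pos_of_forall_pos hα i
  have : 0 < √(∑ j, α j + 1) := Real.sqrt_pos.2 (by linarith)
  have hq := Real.sqrt_pos.2 (pMin_pos hα)
  calc whitenedCoeff α i ≤ 2 / ((∑ j, α j + 2) * (√(pMin α) / √(∑ j, α j + 1))) := by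
        rw [whitenedCoeff, ← Real.sqrt_div (pMin_pos hα).le]
        gcongr
        · exact mul_pos (by positivity) (Real.sqrt_pos.2 (div_pos (pMin_pos hα) (by positivity)))
        · exact pMin_div_le_topicWeight hα i
    _ = _ := by field_simp

end TopicWeights

section WhiteningBounds

open scoped Matrix.Norms.L2Operator

variable {d k : ℕ} {hkd : k ≤ d} {α : Fin k → ℝ} {O W : Matrix (Fin d) (Fin k) ℝ}
  {P : Matrix (Fin d) (Fin d) ℝ}

lemma IsTopicMatrix.norm_col_le_one (hO : IsTopicMatrix O) (i : Fin k) : ‖O.col i‖₂ ≤ 1 :=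
  norm_le_one_of_sum_eq_one (fun j => hO.nonneg j i) (hO.sum_col i)

variable [NeZero k]

lemma IsWhitening.exists_isSVD_le_singularValue (hW : IsWhitening hkd P W) (hα : ∀ i, 0 < α i)
    (hrank : O.rank = k)
    (hP : frobNorm (P - popPairs α O) ≤ 3 / 5 * (pMin α / (∑ i, α i + 1) * sigmaMin O ^ 2)) :
    ∃ U s V, IsSVD P U s V ∧ W = whitener hkd U s ∧ ∀ i : Fin k,
      2 / 5 * (pMin α / (∑ i, α i + 1) * sigmaMin O ^ 2) ≤ s (Fin.castLE hkd i) := by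
  obtain ⟨U, s, V, hsvd, hWU⟩ := (isWhitening_iff_exists_eq_whitener hkd).1 hW
  have hs := sum_pos_of_forall_pos hα 0
  have hp := pMin_pos hα
  exact ⟨U, s, V, hsvd, hWU, hsvd.le_singularValue_of_opNorm_sub_le hkd hrank (by positivity)
    (pMin_div_le_topicWeight hα) ((opNorm_le_frobNorm _).trans hP)⟩

variable (hW : IsWhitening hkd P W) (hα : ∀ i, 0 < α i) (hrank : O.rank = k)
  (hP : frobNorm (P - popPairs α O) ≤ 3 / 5 * (pMin α / (∑ i, α i + 1) * sigmaMin O ^ 2))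

include hW hα hrank hP

lemma IsWhitening.exists_isSVD_singularValue_pos :
    ∃ U s V, IsSVD P U s V ∧ W = whitener hkd U s ∧ ∀ i : Fin k, 0 < s (Fin.castLE hkd i) := by
  obtain ⟨U, s, V, hsvd, hWU, hs⟩ := hW.exists_isSVD_le_singularValue hα hrank hP
  have hsum := sum_pos_of_forall_pos hα 0
  have hp := pMin_pos hα
  have hσ := sigmaMin_pos hrank
  exact ⟨U, s, V, hsvd, hWU, fun i => lt_of_lt_of_le (by positivity) (hs i)⟩

lemma IsWhitening.rank_eq : W.rank = k := by
  obtain ⟨U, s, V, hsvd, rfl, hs⟩ := hW.exists_isSVD_singularValue_pos hα hrank hP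
  exact rank_whitener hkd hs hsvd.transpose_mul_left

lemma IsWhitening.opNorm_le : ‖W‖ ≤ 8 / 5 * (√(∑ i, α i + 1) / (√(pMin α) * sigmaMin O)) := by
  obtain ⟨U, s, V, hsvd, rfl, hs⟩ := hW.exists_isSVD_le_singularValue hα hrank hP
  have hsum := sum_pos_of_forall_pos hα 0
  have hp := pMin_pos hα
  have hσ := sigmaMin_pos hrank
  refine (opNorm_whitener_le hkd hsvd.transpose_mul_left (by positivity) hs).trans ?_
  refine Real.sqrt_le_iff.2 ⟨by positivity, ?_⟩
  rw [mul_pow, div_pow (√_), mul_pow (√_), Real.sq_sqrt hp.le, Real.sq_sqrt (by positivity)]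
  calc (2 / 5 * (pMin α / (∑ i, α i + 1) * sigmaMin O ^ 2))⁻¹
      = 5 / 2 * ((∑ i, α i + 1) / (pMin α * sigmaMin O ^ 2)) := by field_simp
    _ ≤ (8 / 5) ^ 2 * ((∑ i, α i + 1) / (pMin α * sigmaMin O ^ 2)) := by gcongr; norm_num

lemma IsWhitening.opNorm_transpose_pinv_le (hO : IsTopicMatrix O) :
    ‖(pinv W)ᵀ‖ ≤ 3 / 2 / √(∑ i, α i + 1) := by
  obtain ⟨U, s, V, hsvd, rfl, hs⟩ := hW.exists_isSVD_singularValue_pos hα hrank hP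
  have hsum := sum_pos_of_forall_pos hα 0
  have hD₀ : 0 ≤ pMin α / (∑ i, α i + 1) := by
    have hp := pMin_pos hα
    positivity
  have hs₂ (j : Fin d) : s j ≤ 2 * (1 / (∑ i, α i + 1)) := by
    rw [← sum_topicWeight hα]
    refine hsvd.singularValue_le_two_mul_sum hO.norm_col_le_one hD₀
      (pMin_div_le_topicWeight hα) ((opNorm_le_frobNorm _).trans (hP.trans ?_)) j
    exact mul_le_of_le_one_left (by positivity) (by norm_num)
  refine (opNorm_transpose_pinv_whitener_le hkd hs hsvd.transpose_mul_left
    fun i => hs₂ _).trans (Real.sqrt_le_iff.2 ⟨by positivity, ?_⟩)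
  rw [div_pow, Real.sq_sqrt (by positivity), mul_one_div]
  gcongr
  norm_num

lemma IsWhitening.norm_col_sub_transpose_pinv_mulVec_le (i : Fin k) :
    ‖O.col i - (pinv W)ᵀ *ᵥ (Wᵀ *ᵥ O.col i)‖₂ ≤
      2 * frobNorm (P - popPairs α O) / (pMin α / (∑ i, α i + 1) * sigmaMin O) := by
  obtain ⟨U, s, V, hsvd, rfl, hs⟩ := hW.exists_isSVD_singularValue_pos hα hrank hP
  have hsum := sum_pos_of_forall_pos hα i
  have hp := pMin_pos hα
  have hσ := sigmaMin_pos hrank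
  rw [Matrix.mulVec_mulVec, transpose_pinv_whitener_mul_transpose hkd hs hsvd.transpose_mul_left,
    le_div_iff₀ (by positivity), mul_comm]
  calc _ ≤ topicWeight α i * sigmaMin O * _ := by gcongr; exact pMin_div_le_topicWeight hα i
    _ ≤ 2 * ‖P - popPairs α O‖ :=
        hsvd.norm_col_sub_leadingCols_mulVec_le hkd (fun i => (topicWeight_pos hα i).le) i
    _ ≤ 2 * frobNorm (P - popPairs α O) := by gcongr; exact opNorm_le_frobNorm _

lemma IsWhitening.opNorm_whitenedTopics_mul_transpose_sub_one_le :
    ‖whitenedTopics α O W * (whitenedTopics α O W)ᵀ - 1‖ ≤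
      ‖W‖ ^ 2 * (√2 * frobNorm (P - popPairs α O)) := by
  obtain ⟨U, s, V, hsvd, rfl, hs⟩ := hW.exists_isSVD_singularValue_pos hα hrank hP
  rw [whitenedTopics_mul_transpose hα]
  exact hsvd.opNorm_whitener_transpose_mul_mul_sub_one_le hkd hs fun i => (topicWeight_pos hα i).le

end WhiteningBounds

/-- The dimensionless error level of the whitened moments when the empirical frequencies are
within `E` of their means. -/
def errorScale {d k : ℕ} (α : Fin k → ℝ) (O : Matrix (Fin d) (Fin k) ℝ) (E : ℝ) : ℝ :=
  (∑ i, α i + 1) ^ 2 * E / (√(pMin α) * sigmaMin O) ^ 3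

section WhiteningAccuracy

open scoped Matrix.Norms.L2Operator

variable {d k : ℕ} {hkd : k ≤ d} {α : Fin k → ℝ} {O W : Matrix (Fin d) (Fin k) ℝ}
  {P : Matrix (Fin d) (Fin d) ℝ} {E : ℝ}

lemma frobNorm_sub_popPairs_le (hP : frobNorm (P - popPairs α O) ≤ 3 * E)
    (hE : E ≤ pMin α * sigmaMin O ^ 2 / (5 * (∑ i, α i + 1))) :
    frobNorm (P - popPairs α O) ≤ 3 / 5 * (pMin α / (∑ i, α i + 1) * sigmaMin O ^ 2) := by
  refine hP.trans ((mul_le_mul_of_nonneg_left hE (by norm_num)).trans_eq ?_)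
  rw [mul_comm 5, ← div_div]
  ring

variable [NeZero k]

lemma errorScale_nonneg (hα : ∀ i, 0 < α i) (hrank : O.rank = k) (hE₀ : 0 ≤ E) :
    0 ≤ errorScale α O E := by
  have hs := sum_pos_of_forall_pos hα 0
  have hσ := sigmaMin_pos hrank
  unfold errorScale
  positivity

lemma mul_errorScale_div_sqrt_pMin (hα : ∀ i, 0 < α i) (x : ℝ) :
    x * errorScale α O E / √(pMin α) =
      (∑ i, α i + 1) ^ 2 * x * E / (pMin α ^ 2 * sigmaMin O ^ 3) := by
  have hp := pMin_pos hα
  have hq₄ : √(pMin α) ^ 3 * √(pMin α) = pMin α ^ 2 := by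
    rw [← pow_succ, pow_mul (√(pMin α)) 2 2, Real.sq_sqrt hp.le]
  rw [errorScale, ← hq₄, mul_div_assoc', div_div, mul_pow]
  ring

variable (hW : IsWhitening hkd P W) (hα : ∀ i, 0 < α i) (hrank : O.rank = k)
  (hP : frobNorm (P - popPairs α O) ≤ 3 * E)
  (hE : E ≤ pMin α * sigmaMin O ^ 2 / (5 * (∑ i, α i + 1)))

include hW hα hrank hP hE

lemma IsWhitening.mul_opNorm_pow_three_le :
    13 * E * ‖W‖ ^ 3 ≤ 54 * (errorScale α O E / √(∑ i, α i + 1)) := by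
  have hW' := hW.opNorm_le hα hrank (frobNorm_sub_popPairs_le hP hE)
  have hs := sum_pos_of_forall_pos hα 0
  have hp := pMin_pos hα
  have hσ := sigmaMin_pos hrank
  have hE₀ : 0 ≤ E := by linarith [frobNorm_nonneg (P - popPairs α O)]
  have hA : 0 < √(∑ i, α i + 1) := Real.sqrt_pos.2 (by linarith)
  have hA₂ : √(∑ i, α i + 1) ^ 2 = ∑ i, α i + 1 := Real.sq_sqrt (by linarith)
  have hz := errorScale_nonneg hα hrank hE₀
  calc 13 * E * ‖W‖ ^ 3
      ≤ 13 * E * (8 / 5 * (√(∑ i, α i + 1) / (√(pMin α) * sigmaMin O))) ^ 3 := by gcongr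
    _ = 13 * (8 / 5) ^ 3 * (errorScale α O E / √(∑ i, α i + 1)) := by
        rw [errorScale, ← hA₂, Real.sqrt_sq hA.le]
        field_simp
    _ ≤ 54 * (errorScale α O E / √(∑ i, α i + 1)) := by gcongr; norm_num

lemma IsWhitening.opNorm_whitenedTopics_mul_transpose_sub_one_le_div :
    ‖whitenedTopics α O W * (whitenedTopics α O W)ᵀ - 1‖ ≤
      11 * ((∑ i, α i + 1) * E / (pMin α * sigmaMin O ^ 2)) := by
  have hP' := frobNorm_sub_popPairs_le hP hE
  have hs := sum_pos_of_forall_pos hα 0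
  have hp := pMin_pos hα
  have hσ := sigmaMin_pos hrank
  have hf := frobNorm_nonneg (P - popPairs α O)
  have hsqrt₂ : √(2 : ℝ) ≤ 71 / 50 := Real.sqrt_le_iff.2 (by norm_num)
  calc _ ≤ ‖W‖ ^ 2 * (√2 * frobNorm (P - popPairs α O)) :=
        hW.opNorm_whitenedTopics_mul_transpose_sub_one_le hα hrank hP'
    _ ≤ (8 / 5 * (√(∑ i, α i + 1) / (√(pMin α) * sigmaMin O))) ^ 2 * (71 / 50 * (3 * E)) := by
        gcongr
        exact hW.opNorm_le hα hrank hP'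
    _ = (8 / 5) ^ 2 * (71 / 50) * 3 * ((∑ i, α i + 1) * E / (pMin α * sigmaMin O ^ 2)) := by
        rw [mul_pow, div_pow (√_), mul_pow (√_), Real.sq_sqrt hp.le, Real.sq_sqrt (by positivity)]
        ring
    _ ≤ _ := by
        have hE₀ : 0 ≤ E := by linarith
        gcongr
        norm_num

lemma IsWhitening.opNorm_whitenedTopics_mul_transpose_sub_one_le_three :
    ‖whitenedTopics α O W * (whitenedTopics α O W)ᵀ - 1‖ ≤ 3 := by
  have hs := sum_pos_of_forall_pos hα 0
  have hp := pMin_pos hα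
  have hσ := sigmaMin_pos hrank
  have hE' := (le_div_iff₀ (by positivity)).1 hE
  have hratio : (∑ i, α i + 1) * E / (pMin α * sigmaMin O ^ 2) ≤ 1 / 5 := by
    rw [div_le_iff₀ (by positivity)]
    linarith
  linarith [hW.opNorm_whitenedTopics_mul_transpose_sub_one_le_div hα hrank hP hE]

lemma IsWhitening.opNorm_whitenedTopics_mul_transpose_sub_one_le_errorScale
    (hO : IsTopicMatrix O) :
    ‖whitenedTopics α O W * (whitenedTopics α O W)ᵀ - 1‖ ≤
      11 * (√(pMin α) * errorScale α O E) := by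
  refine (hW.opNorm_whitenedTopics_mul_transpose_sub_one_le_div hα hrank hP hE).trans ?_
  have hs := sum_pos_of_forall_pos hα 0
  have hp := pMin_pos hα
  have hσ := sigmaMin_pos hrank
  have hσ₁ := sigmaMin_le_one hO.norm_col_le_one
  have hE₀ : 0 ≤ E := by linarith [frobNorm_nonneg (P - popPairs α O)]
  have hq₂ : √(pMin α) ^ 2 = pMin α := Real.sq_sqrt hp.le
  gcongr 11 * ?_
  calc (∑ i, α i + 1) * E / (pMin α * sigmaMin O ^ 2)
      = √(pMin α) * errorScale α O E * (sigmaMin O / (∑ i, α i + 1)) := by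
        rw [errorScale, ← hq₂, Real.sqrt_sq (Real.sqrt_nonneg _)]
        field_simp
    _ ≤ √(pMin α) * errorScale α O E :=
        mul_le_of_le_one_right (mul_nonneg (by positivity) (errorScale_nonneg hα hrank hE₀))
          (div_le_one_of_le₀ (by linarith) (by linarith))

lemma IsWhitening.norm_col_sub_transpose_pinv_mulVec_le_errorScale (hO : IsTopicMatrix O)
    (i : Fin k) :
    ‖O.col i - (pinv W)ᵀ *ᵥ (Wᵀ *ᵥ O.col i)‖₂ ≤ 6 * errorScale α O E := by
  refine (hW.norm_col_sub_transpose_pinv_mulVec_le hα hrank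
    (frobNorm_sub_popPairs_le hP hE) i).trans ?_
  have hs := sum_pos_of_forall_pos hα 0
  have hp := pMin_pos hα
  have hσ := sigmaMin_pos hrank
  have hσ₁ := sigmaMin_le_one hO.norm_col_le_one
  have hq₁ : √(pMin α) ≤ 1 := Real.sqrt_le_one.2 (pMin_le_one hα)
  have hE₀ : 0 ≤ E := by linarith [frobNorm_nonneg (P - popPairs α O)]
  have hq₂ : √(pMin α) ^ 2 = pMin α := Real.sq_sqrt hp.le
  calc _ ≤ 2 * (3 * E) / (pMin α / (∑ i, α i + 1) * sigmaMin O) := by gcongr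
    _ = 6 * errorScale α O E * (√(pMin α) * sigmaMin O ^ 2 / (∑ i, α i + 1)) := by
        rw [errorScale, ← hq₂, Real.sqrt_sq (Real.sqrt_nonneg _)]
        field_simp
        ring
    _ ≤ 6 * errorScale α O E := by
        refine mul_le_of_le_one_right
          (mul_nonneg (by norm_num) (errorScale_nonneg hα hrank hE₀))
          (div_le_one_of_le₀ ?_ (by linarith))
        exact (mul_le_one₀ hq₁ (by positivity) (pow_le_one₀ hσ.le hσ₁)).trans (by linarith)

end WhiteningAccuracy

section ReconstructionAccuracy

open scoped Matrix.Norms.L2Operator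

variable {d k : ℕ} [NeZero k] {hkd : k ≤ d} {α : Fin k → ℝ} {O W : Matrix (Fin d) (Fin k) ℝ}
  {P : Matrix (Fin d) (Fin d) ℝ} {T : (Fin d → ℝ) → Matrix (Fin d) (Fin d) ℝ} {E : ℝ}

lemma abs_whitenedCoeff_le (hα : ∀ i, 0 < α i) (i : Fin k) :
    |whitenedCoeff α i| ≤ 2 * √(∑ j, α j + 1) / ((∑ j, α j + 2) * √(pMin α)) := by
  rw [abs_of_nonneg ((by positivity : (0 : ℝ) ≤ _).trans (one_div_sqrt_le_whitenedCoeff hα i))]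
  exact whitenedCoeff_le hα i

lemma one_le_natCast_pow_three : (1 : ℝ) ≤ k ^ 3 :=
  one_le_pow₀ (by exact_mod_cast Nat.pos_of_ne_zero (NeZero.ne k))

variable (hW : IsWhitening hkd P W) (hα : ∀ i, 0 < α i) (hO : IsTopicMatrix O)
  (hrank : O.rank = k) (hP : frobNorm (P - popPairs α O) ≤ 3 * E)
  (hE : E ≤ pMin α * sigmaMin O ^ 2 / (5 * (∑ i, α i + 1)))

include hW hα hO hrank hP hE

lemma IsWhitening.norm_col_sub_reconstruct_le_of_norm_smul_sub_le {v : Fin k → ℝ} {i : Fin k}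
    {ζ : ℝ} (hv : ‖whitenedCoeff α i • (whitenedTopics α O W).col i -
        cubicForm T (W *ᵥ v) • v‖₂ ≤ 13 * E * ‖W‖ ^ 3 +
      10 * (2 * √(∑ i, α i + 1) / ((∑ i, α i + 2) * √(pMin α))) * ζ) :
    ‖O.col i - reconstruct (∑ i, α i) T W v‖₂ ≤ 87 * errorScale α O E + 15 / √(pMin α) * ζ := by
  have hs := sum_pos_of_forall_pos hα 0
  have hq := Real.sqrt_pos.2 (pMin_pos hα)
  have hE₀ : 0 ≤ E := by linarith [frobNorm_nonneg (P - popPairs α O)]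
  have hz := errorScale_nonneg hα hrank hE₀
  have hA : 0 < √(∑ i, α i + 1) := Real.sqrt_pos.2 (by linarith)
  have hv' := hv.trans (add_le_add_left (hW.mul_opNorm_pow_three_le hα hrank hP hE) _)
  calc _ ≤ _ := norm_col_sub_reconstruct_le hα v i
    _ ≤ 6 * errorScale α O E + 3 / 2 / √(∑ i, α i + 1) * ((∑ i, α i + 2) / 2 *
        (54 * (errorScale α O E / √(∑ i, α i + 1)) +
          10 * (2 * √(∑ i, α i + 1) / ((∑ i, α i + 2) * √(pMin α))) * ζ)) := by
        gcongr
        · exact hW.norm_col_sub_transpose_pinv_mulVec_le_errorScale hα hrank hP hE hO i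
        · exact hW.opNorm_transpose_pinv_le hα hrank (frobNorm_sub_popPairs_le hP hE) hO
    _ = 6 * errorScale α O E + 81 * errorScale α O E *
        ((∑ i, α i + 2) / (2 * √(∑ i, α i + 1) ^ 2)) + 15 / √(pMin α) * ζ := by
        generalize √(∑ i, α i + 1) = A at hA
        field_simp
        ring
    _ ≤ 6 * errorScale α O E + 81 * errorScale α O E * 1 + 15 / √(pMin α) * ζ := by
        rw [Real.sq_sqrt (by linarith)]
        gcongr
        exact div_le_one_of_le₀ (by linarith) (by linarith)
    _ = _ := by ring

lemma IsWhitening.opNorm_whitenedTopics_mul_transpose_sub_one_le_pow_mul :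
    ‖whitenedTopics α O W * (whitenedTopics α O W)ᵀ - 1‖ ≤ 11 * (k ^ 3 * errorScale α O E) := by
  have hq₁ : √(pMin α) ≤ 1 := Real.sqrt_le_one.2 (pMin_le_one hα)
  have hE₀ : 0 ≤ E := by linarith [frobNorm_nonneg (P - popPairs α O)]
  have hz := errorScale_nonneg hα hrank hE₀
  refine (hW.opNorm_whitenedTopics_mul_transpose_sub_one_le_errorScale hα hrank hP hE hO).trans ?_
  gcongr
  exact hq₁.trans one_le_natCast_pow_three

lemma IsWhitening.spectral_noise_le :
    4 * (3 * (13 * E * ‖W‖ ^ 3) + 4 * (2 * √(∑ i, α i + 1) / ((∑ i, α i + 2) * √(pMin α))) *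
      ‖whitenedTopics α O W * (whitenedTopics α O W)ᵀ - 1‖) ≤
      1000 * (errorScale α O E / √(∑ i, α i + 1)) := by
  have hs := sum_pos_of_forall_pos hα 0
  have hq := Real.sqrt_pos.2 (pMin_pos hα)
  have hA : 0 < √(∑ i, α i + 1) := Real.sqrt_pos.2 (by linarith)
  have hA₂ : √(∑ i, α i + 1) ^ 2 = ∑ i, α i + 1 := Real.sq_sqrt (by linarith)
  have hE₀ : 0 ≤ E := by linarith [frobNorm_nonneg (P - popPairs α O)]
  have hz := errorScale_nonneg hα hrank hE₀
  have hdefect : 2 * √(∑ i, α i + 1) / ((∑ i, α i + 2) * √(pMin α)) *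
      ‖whitenedTopics α O W * (whitenedTopics α O W)ᵀ - 1‖ ≤
      22 * (errorScale α O E / √(∑ i, α i + 1)) :=
    calc _ ≤ 2 * √(∑ i, α i + 1) / ((∑ i, α i + 1) * √(pMin α)) *
          (11 * (√(pMin α) * errorScale α O E)) := by
          gcongr
          · norm_num
          · exact hW.opNorm_whitenedTopics_mul_transpose_sub_one_le_errorScale hα hrank hP hE hO
      _ = 22 * (errorScale α O E / √(∑ i, α i + 1)) := by
          rw [← hA₂, Real.sqrt_sq hA.le]
          field_simp
          ring
  have : 0 ≤ errorScale α O E / √(∑ i, α i + 1) := by positivity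
  linarith [hW.mul_opNorm_pow_three_le hα hrank hP hE]

variable (hT : ∀ η x y, |x ⬝ᵥ ((T η - popTriples α O η) *ᵥ y)| ≤
  13 * E * (‖x‖₂ * (‖y‖₂ * ‖η‖₂)))

include hT

lemma IsWhitening.norm_col_sub_reconstruct_le {v : Fin k → ℝ} (hv : ‖v‖₂ = 1) (i : Fin k) :
    ‖O.col i - reconstruct (∑ i, α i) T W v‖₂ ≤ 87 * errorScale α O E + 15 / √(pMin α) := by
  have hE₀ : 0 ≤ E := by linarith [frobNorm_nonneg (P - popPairs α O)]
  have h := hW.norm_col_sub_reconstruct_le_of_norm_smul_sub_le (ζ := 1) hα hO hrank hP hE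
    ((norm_smul_col_sub_cubicForm_smul_le_of_le_three hα (by positivity) hT
      (abs_whitenedCoeff_le hα)
      (hW.opNorm_whitenedTopics_mul_transpose_sub_one_le_three hα hrank hP hE) hv i).trans_eq
      (by rw [mul_one]))
  rwa [mul_one] at h

lemma IsWhitening.exists_perm_norm_col_sub_reconstruct_le
    (hz : k ^ 3 * errorScale α O E ≤ 1 / 10 ^ 6) {θ : Fin k → ℝ} (hθ : ‖θ‖₂ = 1)
    (hgap : ∀ i j, i ≠ j → 1 / √(∑ i, α i + 1) / (64 * k ^ 3) ≤
      |(|whitenedCoeff α i * ((whitenedTopics α O W)ᵀ *ᵥ θ) i| -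
        |whitenedCoeff α j * ((whitenedTopics α O W)ᵀ *ᵥ θ) j|)|)
    {v : Fin k → Fin k → ℝ} (hv : IsLeftSingularFamily (Wᵀ * T (W *ᵥ θ) * W) v) :
    ∃ τ : Equiv.Perm (Fin k), ∀ i, ‖O.col i - reconstruct (∑ i, α i) T W (v (τ i))‖₂ ≤
      2 * 10 ^ 7 * (k ^ 3 * errorScale α O E / √(pMin α)) := by
  have hs := sum_pos_of_forall_pos hα 0
  have hq := Real.sqrt_pos.2 (pMin_pos hα)
  have hq₁ : √(pMin α) ≤ 1 := Real.sqrt_le_one.2 (pMin_le_one hα)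
  have : 0 < √(∑ i, α i + 1) := Real.sqrt_pos.2 (by linarith)
  have hk := one_le_natCast_pow_three (k := k)
  have hE₀ : 0 ≤ E := by linarith [frobNorm_nonneg (P - popPairs α O)]
  have hz₀ := errorScale_nonneg hα hrank hE₀
  have hB := hW.opNorm_whitenedTopics_mul_transpose_sub_one_le_pow_mul hα hO hrank hP hE
  obtain ⟨τ, hτ⟩ := hv.exists_perm_norm_smul_col_sub_cubicForm_smul_le
    (η := 64000 * (k ^ 3 * errorScale α O E)) hα (by positivity) hT (abs_whitenedCoeff_le hα)
    (by linarith) hθ (by positivity) hgap (by positivity) (by linarith)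
    ((hW.spectral_noise_le hα hO hrank hP hE).trans_eq (by
      have hk₀ : (k : ℝ) ≠ 0 := NeZero.ne _
      field_simp
      ring))
  refine ⟨τ, fun i => (hW.norm_col_sub_reconstruct_le_of_norm_smul_sub_le hα hO hrank hP hE
    (hτ i)).trans ?_⟩
  calc 87 * errorScale α O E + 15 / √(pMin α) * (_ + 2 * (64000 * (k ^ 3 * errorScale α O E)))
      ≤ 87 * (k ^ 3 * errorScale α O E / √(pMin α)) + 15 / √(pMin α) *
        (11 * (k ^ 3 * errorScale α O E) + 2 * (64000 * (k ^ 3 * errorScale α O E))) := by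
        gcongr
        · rw [mul_comm, mul_div_assoc]
          exact le_mul_of_one_le_right hz₀ ((one_le_div₀ hq).2 (hq₁.trans hk))
    _ = 1920252 * (k ^ 3 * errorScale α O E / √(pMin α)) := by ring
    _ ≤ _ := by gcongr; norm_num

lemma IsWhitening.norm_col_sub_reconstruct_le_of_le_pow_mul
    (hz : 1 / 10 ^ 6 ≤ k ^ 3 * errorScale α O E) {v : Fin k → ℝ} (hv : ‖v‖₂ = 1) (i : Fin k) :
    ‖O.col i - reconstruct (∑ i, α i) T W v‖₂ ≤
      2 * 10 ^ 7 * (k ^ 3 * errorScale α O E / √(pMin α)) := by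
  have hq := Real.sqrt_pos.2 (pMin_pos hα)
  have hq₁ : √(pMin α) ≤ 1 := Real.sqrt_le_one.2 (pMin_le_one hα)
  have hE₀ : 0 ≤ E := by linarith [frobNorm_nonneg (P - popPairs α O)]
  have hz₀ := errorScale_nonneg hα hrank hE₀
  have hk := one_le_natCast_pow_three (k := k)
  calc _ ≤ 87 * errorScale α O E + 15 / √(pMin α) * 1 := by
        rw [mul_one]
        exact hW.norm_col_sub_reconstruct_le hα hO hrank hP hE hT hv i
    _ ≤ 87 * (k ^ 3 * errorScale α O E / √(pMin α)) +
        15 / √(pMin α) * (10 ^ 6 * (k ^ 3 * errorScale α O E)) := by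
        gcongr
        · rw [mul_comm, mul_div_assoc]
          exact le_mul_of_one_le_right hz₀ ((one_le_div₀ hq).2 (hq₁.trans hk))
        · linarith
    _ = 15000087 * (k ^ 3 * errorScale α O E / √(pMin α)) := by ring
    _ ≤ _ := by gcongr; norm_num

/- Once `k ^ 3 * errorScale α O E` exceeds a constant, the claimed accuracy is weaker than the crude
bound valid for every unit vector, so a gap between the singular values is needed only below it. -/
lemma IsWhitening.sphereUniform_exists_perm_norm_col_sub_reconstruct_le :
    3 / 4 < (sphereUniform k).real {θ | ∀ v : Fin k → Fin k → ℝ,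
      IsLeftSingularFamily (Wᵀ * T (W *ᵥ (θ.1 : Fin k → ℝ)) * W) v →
      ∃ τ : Equiv.Perm (Fin k), ∀ i, ‖O.col i - reconstruct (∑ i, α i) T W (v (τ i))‖₂ ≤
        2 * 10 ^ 7 * (k ^ 3 * errorScale α O E / √(pMin α))} := by
  have hs := sum_pos_of_forall_pos hα 0
  rcases le_total (k ^ 3 * errorScale α O E) (1 / 10 ^ 6) with hz | hz
  · have hB : ‖whitenedTopics α O W * (whitenedTopics α O W)ᵀ - 1‖ ≤ 1 / 4 := by
      linarith [hW.opNorm_whitenedTopics_mul_transpose_sub_one_le_pow_mul hα hO hrank hP hE]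
    refine (sphereUniform_forall_le_abs_abs_sub_abs hB
      (by positivity : 0 < 1 / √(∑ i, α i + 1))
      (one_div_sqrt_le_whitenedCoeff hα)).trans_le (measureReal_mono fun θ hθ v hv => ?_)
    exact hW.exists_perm_norm_col_sub_reconstruct_le hα hO hrank hP hE hT hz
      (norm_eq_of_mem_sphere θ) hθ hv
  · have hall (θ : Metric.sphere (0 : EuclideanSpace ℝ (Fin k)) 1) (v : Fin k → Fin k → ℝ)
        (hv : IsLeftSingularFamily (Wᵀ * T (W *ᵥ (θ.1 : Fin k → ℝ)) * W) v) (i : Fin k) :=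
      hW.norm_col_sub_reconstruct_le_of_le_pow_mul hα hO hrank hP hE hT hz (hv.norm_eq_one i) i
    have huniv : 3 / 4 < (sphereUniform k).real Set.univ := by
      rw [probReal_univ]
      norm_num
    exact huniv.trans_le (measureReal_mono fun θ _ v hv => ⟨1, hall θ v hv⟩)

end ReconstructionAccuracy

section SampleComplexity

variable {N d k : ℕ} [NeZero k] {hkd : k ≤ d} {α : Fin k → ℝ} {O : Matrix (Fin d) (Fin k) ℝ}

lemma ECASucceeds.mono {α₀ ε ε' : ℝ} {w : Fin N → Fin 3 → Fin d}
    (h : ECASucceeds hkd α₀ O ε w) (hε : ε ≤ ε') : ECASucceeds hkd α₀ O ε' w := by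
  intro W hW
  obtain ⟨hrank, hθ⟩ := h W hW
  refine ⟨hrank, hθ.trans_le (measureReal_mono fun θ hθ v hv => ?_)⟩
  obtain ⟨τ, hτ⟩ := hθ v hv
  exact ⟨τ, fun i => (hτ i).trans hε⟩

lemma MomentsClose.ecaSucceeds {E : ℝ} {w : Fin N → Fin 3 → Fin d} (h : MomentsClose α O E w)
    (hα : ∀ i, 0 < α i) (hO : IsTopicMatrix O) (hrank : O.rank = k)
    (hE : E ≤ pMin α * sigmaMin O ^ 2 / (5 * (∑ i, α i + 1))) :
    ECASucceeds hkd (∑ i, α i) O (2 * 10 ^ 7 *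
      ((∑ i, α i + 1) ^ 2 * k ^ 3 * E / (pMin α ^ 2 * sigmaMin O ^ 3))) w := by
  intro W hW
  have hP := h.frobNorm_empPairs_sub_le hα hO
  refine ⟨hW.rank_eq hα hrank (frobNorm_sub_popPairs_le hP hE), ?_⟩
  rw [← mul_errorScale_div_sqrt_pMin hα]
  exact hW.sphereUniform_exists_perm_norm_col_sub_reconstruct_le hα hO hrank hP hE
    (h.abs_dotProduct_empTriples_sub_le hα hO)

lemma one_add_sqrt_log_three_div_le {δ : ℝ} (hδ₀ : 0 < δ) (hδ₁ : δ < 1) :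
    1 + √(Real.log (3 / δ)) ≤ 3 * (1 + √(Real.log (1 / δ))) := by
  have hlog : Real.log (3 / δ) = Real.log 3 + Real.log (1 / δ) := by
    rw [← Real.log_mul (by norm_num) (by positivity), mul_one_div]
  have hlog₁ : 0 ≤ Real.log (1 / δ) := Real.log_nonneg ((one_le_div hδ₀).2 hδ₁.le)
  have hlog₃ : Real.log 3 ≤ 2 := (Real.log_le_sub_one_of_pos (by norm_num)).trans (by norm_num)
  have hsqrt : √(Real.log (3 / δ)) ≤ 2 + √(Real.log (1 / δ)) := by
    rw [Real.sqrt_le_left (by positivity), hlog]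
    nlinarith [Real.sq_sqrt hlog₁, Real.sqrt_nonneg (Real.log (1 / δ))]
  linarith [Real.sqrt_nonneg (Real.log (1 / δ))]

lemma pos_of_sq_div_le {a b L n : ℝ} (ha : 0 < a) (hb : 0 < b) (hL : 0 ≤ L)
    (hn : (a * (6 + 6 * L) / b) ^ 2 ≤ n) : 0 < n :=
  lt_of_lt_of_le (by positivity) hn

lemma deviation_le_of_sq_div_le {a b L n : ℝ} (ha : 0 < a) (hb : 0 < b) (hL : 0 ≤ L)
    (hn : (a * (6 + 6 * L) / b) ^ 2 ≤ n) : 6 / 5 * (1 + L) / √n ≤ b / (5 * a) := by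
  have hroot : a * (6 + 6 * L) / b ≤ √n := Real.le_sqrt_of_sq_le hn
  have hsqrt : 0 < √n := Real.sqrt_pos.2 (pos_of_sq_div_le ha hb hL hn)
  rw [div_le_iff₀ hb] at hroot
  rw [div_le_div_iff₀ hsqrt (by positivity)]
  linarith

end SampleComplexity

end LDA

end

theorem theorem5 :
    ∃ c : ℝ, 0 < c ∧
      ∀ (k d : ℕ) (_hk : 0 < k) (hkd : k ≤ d)
        (α : Fin k → ℝ) (_hα : ∀ i, 0 < α i) (α₀ : ℝ) (_hα₀ : α₀ = ∑ i, α i)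
        (O : Matrix (Fin d) (Fin k) ℝ) (_hO : LDA.IsTopicMatrix O) (_hrank : O.rank = k)
        (δ : ℝ) (_hδ₀ : 0 < δ) (_hδ₁ : δ < 1)
        (N : ℕ)
        (_hN : ((α₀ + 1) * (6 + 6 * Real.sqrt (Real.log (3 / δ))) /
          (LDA.pMin α * LDA.sigmaMin O ^ 2)) ^ 2 ≤ (N : ℝ))
        (Ω : Type*) [MeasurableSpace Ω] (P : Measure Ω) [IsProbabilityMeasure P]
        (X : Fin N → Ω → (Fin 3 → Fin d)) (_hX : ∀ n, Measurable (X n))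
        (_hlaw : ∀ n, P.map (X n) = LDA.documentLaw α O) (_hindep : iIndepFun X P),
        1 - δ < P.real
          {ω | LDA.ECASucceeds hkd α₀ O
            (c * ((α₀ + 1) ^ 2 * (k : ℝ) ^ 3 / (LDA.pMin α ^ 2 * LDA.sigmaMin O ^ 3)) *
              ((1 + Real.sqrt (Real.log (1 / δ))) / Real.sqrt N))
            (fun n => X n ω)} := by
  refine ⟨10 ^ 8, by norm_num, ?_⟩
  intro k d hk hkd α hα α₀ hα₀ O hO hrank δ hδ₀ hδ₁ N hN Ω _ P _ X hX hlaw hindep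
  subst hα₀
  have : NeZero k := ⟨hk.ne'⟩
  have hs : 0 < ∑ i, α i + 1 := add_pos (LDA.sum_pos_of_forall_pos hα 0) one_pos
  have hp := LDA.pMin_pos hα
  have hσ := LDA.sigmaMin_pos hrank
  have hpσ : 0 < LDA.pMin α * LDA.sigmaMin O ^ 2 := by positivity
  have hL := Real.sqrt_nonneg (Real.log (3 / δ))
  have hN₀ : 0 < N := by exact_mod_cast LDA.pos_of_sq_div_le hs hpσ hL hN
  have hE := LDA.deviation_le_of_sq_div_le hs hpσ hL hN
  have hclose := LDA.measureReal_momentsClose_gt hα hO hX hlaw hindep hN₀ hδ₀ hδ₁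
  refine hclose.trans_le (measureReal_mono fun ω hω => ?_)
  refine (LDA.MomentsClose.ecaSucceeds hω hα hO hrank hE).mono ?_
  calc _ = 2 * 10 ^ 7 * (6 / 5 * (1 + √(Real.log (3 / δ)))) * ((∑ i, α i + 1) ^ 2 * k ^ 3 /
        (LDA.pMin α ^ 2 * LDA.sigmaMin O ^ 3) / √N) := by ring
    _ ≤ 10 ^ 8 * (1 + √(Real.log (1 / δ))) * ((∑ i, α i + 1) ^ 2 * k ^ 3 /
        (LDA.pMin α ^ 2 * LDA.sigmaMin O ^ 3) / √N) := by
        gcongr ?_ * _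
        linarith [LDA.one_add_sqrt_log_three_div_le hδ₀ hδ₁, Real.sqrt_nonneg (Real.log (1 / δ))]
    _ = _ := by ring
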